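/- Let $n\ge 2$, $\omega=(\omega_1,\dots,\omega_n)\in\mathbb R^n$, $A=\operatorname{diag}(i\omega_1,\dots,i\omega_n)$ and $s>0$. Write $|z|=\max_j|z_j|$ on $\mathbb C^n$, $D_1=\{z\in\mathbb C^n:|z|<1\}$, and $|\alpha|=\sum_i|\alpha_i|$ for $\alpha\in\mathbb Z^n$. Let $F:D_1\to\mathbb C^n$ be analytic with $F(z)=Az+f(z)$, $f(0)=0$, $Df(0)=0$. Assume that $A$ is non-resonant, i.e. $\alpha\cdot\omega\ne\omega_j$ for all $\alpha\in\mathbb N^n$ with $|\alpha|\ge2$ and all $j$, and that at least one of the following two conditions holds. (i) (Bruno-$s$ condition) There is a strictly increasing sequence $(p_k)_{k\ge0}$ of positive integers such that $$\limsup_{|\alpha|\to\infty,\ \alpha\in\mathbb N^n}\Big(2\sum_{m=0}^{\kappa(\alpha)}\frac{\log\Omega(p_{m+1})^{-1}}{p_m}-s\log|\alpha|\Big)<+\infty,$$ where $p_{\kappa(\alpha)}\le|\alpha|<p_{\kappa(\alpha)+1}$ and $\Omega(p)=\min\{|\alpha\cdot\omega-\omega_j|:1\le j\le n,\ \alpha\in\mathbb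 Z^n,\ 0<|\alpha|<p,\ \alpha\cdot\omega\neq\omega_j\}$. (ii) $n=2$, the number $x=-\omega_1/\omega_2$ is irrational, and $$\limsup_{N\to\infty}\Big(\sum_{j=0}^{k(N)}\frac{\log q_{j+1}}{q_j}-s\log N\Big)<+\infty,$$ where $(q_j)_{j\ge0}$ are the denominators of the convergents of the continued fraction of $x$ and $q_{k(N)}\le N<q_{k(N)+1}$. Then for all sufficiently small $0<r_{**}<1$ there exist positive constants $A_{**},B_{**},C_{**}$ such that for every $z_0\in\mathbb C^n$ with $0<|z_0|<r_{**}/2$ the solution $z(t;z_0)$ of $\frac{dz}{dt}=F(z)$, $z(0;z_0)=z_0$, exists in $D_1$, is unique, and satisfies $|z(t;z_0)|\le C_{**}r_{**}$ for all real $t$ with $$|t|\le T_*=A_{**}^{-1}\exp\Big\{B_{**}\big(r_{**}/|z_0|\big)^{1/s}\Big\}.$$ -/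

import Mathlib

open Filter

/-- The open unit polydisk `D₁ = {z ∈ ℂⁿ : |z_i| < 1 for all i}`. -/
def unitPolydisk (n : ℕ) : Set (Fin n → ℂ) :=
  {z | ∀ i, ‖z i‖ < 1}

/-- `diag(iω)` is non-resonant: `α · ω ≠ ω_j` for all `α ∈ ℕⁿ` with `|α| ≥ 2` and all `j`. -/
def NonResonant {n : ℕ} (ω : Fin n → ℝ) : Prop :=
  ∀ α : Fin n → ℕ, 2 ≤ ∑ i, α i → ∀ j, ∑ i, (α i : ℝ) * ω i ≠ ω j

/-- The small divisor function
`Ω(p) = min {|α · ω - ω_j| : 1 ≤ j ≤ n, α ∈ ℤⁿ, 0 < |α| < p, α · ω ≠ ω_j}`, with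
`|α| = ∑ |α_i|`. Vanishing divisors (such as `α = e_j`) do not count. The set is finite, and for
`p ≥ 2` and non-resonant `ω` it contains `|-2 ω_j|` (from `α = -e_j`), so the infimum is a positive
minimum. -/
noncomputable def smallDivisor {n : ℕ} (ω : Fin n → ℝ) (p : ℕ) : ℝ :=
  sInf {x : ℝ | ∃ (j : Fin n) (α : Fin n → ℤ), 0 < ∑ i, |α i| ∧ ∑ i, |α i| < (p : ℤ) ∧
    ∑ i, (α i : ℝ) * ω i ≠ ω j ∧ x = |∑ i, (α i : ℝ) * ω i - ω j|}

/-- The largest index `k` with `p k ≤ N`. For a nondecreasing unbounded sequence `p` with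
`p 0 ≤ N` this is the index determined by `p k ≤ N < p (k + 1)`. -/
noncomputable def lastIndex (p : ℕ → ℝ) (N : ℕ) : ℕ :=
  sSup {k : ℕ | p k ≤ N}

/-- The Bruno-`s` condition for `ω ∈ ℝⁿ`: for some increasing sequence of positive integers `p`,
`limsup_{|α| → ∞} (2 ∑_{m=0}^{κ(α)} log Ω(p_{m+1})⁻¹ / p_m - s log |α|) < +∞`, where
`p_{κ(α)} ≤ |α| < p_{κ(α)+1}`. -/
def BrunoS {n : ℕ} (ω : Fin n → ℝ) (s : ℝ) : Prop :=
  ∃ p : ℕ → ℕ, StrictMono p ∧ (∀ k, 0 < p k) ∧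
    limsup (fun α : Fin n → ℕ =>
      ((2 * ∑ m ∈ Finset.range (lastIndex (fun k => (p k : ℝ)) (∑ i, α i) + 1),
            Real.log (smallDivisor ω (p (m + 1)))⁻¹ / (p m : ℝ)
          - s * Real.log ((∑ i, α i : ℕ) : ℝ) : ℝ) : EReal))
      (comap (fun α : Fin n → ℕ => ∑ i, α i) atTop) < ⊤

/-- The denominator `q_k` of the `k`-th convergent of the continued fraction of `x`
(`q_0 = 1`, `q_1 = a_1`, ...). -/
noncomputable def convDenom (x : ℝ) (k : ℕ) : ℝ :=
  (GenContFract.of x).dens k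

/-- The continued fraction version of the Bruno-`s` condition for an irrational number `x`:
`limsup_{N → ∞} (∑_{j=0}^{k(N)} log q_{j+1} / q_j - s log N) < +∞`, where
`q_{k(N)} ≤ N < q_{k(N)+1}`. -/
def BrunoSContFract (x : ℝ) (s : ℝ) : Prop :=
  Irrational x ∧
    limsup (fun N : ℕ =>
      ((∑ j ∈ Finset.range (lastIndex (convDenom x) N + 1),
            Real.log (convDenom x (j + 1)) / convDenom x j
          - s * Real.log (N : ℝ) : ℝ) : EReal)) atTop < ⊤

/-- `z` is a solution on the time interval `J` of `dz/dt = F(z)`, `z(0) = z₀`, with values in the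
domain `D₁` of `F`. -/
def IsSolutionOn {n : ℕ} (F : (Fin n → ℂ) → (Fin n → ℂ)) (z₀ : Fin n → ℂ) (J : Set ℝ)
    (z : ℝ → Fin n → ℂ) : Prop :=
  z 0 = z₀ ∧ ∀ t ∈ J, z t ∈ unitPolydisk n ∧ HasDerivWithinAt z (F (z t)) J t

/-!
For each order `N`, a polynomial near-identity change of coordinates `h` of degree `N` conjugates
the linear field `A z` to `F` up to terms of order greater than `N`. The coefficients of `h` are
obtained by successively dividing by the small divisors `i (α · ω - ω_j)`. In a norm on polynomials
`∑ ‖c_α‖ M(α)⁻¹ t^|α|`, with a supermultiplicative weight `M` that absorbs one inverse divisor at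
each product, no divisor is lost, and the recursion closes. Both arithmetic conditions provide such
a weight with `M(α) ≤ K^|α| |α|^(s |α|)`: the logarithm of `M(α)` counts, scale by scale, how often
a small divisor can occur in nested decompositions of `α`, by Brjuno's counting argument in case (i)
and by Davie's in case (ii), where the near-resonances are multiples of the convergents. Hence `h`
is close to the identity on a ball of radius `c₀ / N^s`.

By the Schwarz lemma, the error of the conjugacy is of size `exp(-N)` on a smaller ball of
comparable radius. With `N` of the order of `‖z₀‖^(-1/s)`, the solution of the conjugated
equation, a perturbation of an isometric linear flow by `exp(-N)`, stays close to the origin for a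
time of order `exp(N)`, up to a constant power of `N`.
-/

/-! ### Packings of multi-indices and compensating weights -/

/-- The total values of the packings of `α` by elements of `S`; repetitions are allowed. -/
def packingValues {σ : Type*} (S : Set (σ →₀ ℕ)) (φ : (σ →₀ ℕ) → ℝ) (α : σ →₀ ℕ) : Set ℝ :=
  {x | ∃ l : Multiset (σ →₀ ℕ), (∀ γ ∈ l, γ ∈ S) ∧ l.sum ≤ α ∧ x = (l.map φ).sum}

/-- The largest total value of a packing of `α` by elements of `S`. -/
noncomputable def maxPacking {σ : Type*} (S : Set (σ →₀ ℕ)) (φ : (σ →₀ ℕ) → ℝ) (α : σ →₀ ℕ) : ℝ :=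
  sSup (packingValues S φ α)

/-- A value function on `S`, at most `c` per unit of degree, for which each `α ∈ S` beats every
packing of `α` by other elements of `S` by at least `1`. -/
structure HasPackingGap {σ : Type*} (S : Set (σ →₀ ℕ)) (c : ℝ) (φ : (σ →₀ ℕ) → ℝ) : Prop where
  nonneg : 0 ≤ c
  le_mul_degree : ∀ γ ∈ S, φ γ ≤ c * γ.degree
  sum_add_one_le : ∀ α ∈ S, ∀ l : Multiset (σ →₀ ℕ), (∀ γ ∈ l, γ ∈ S ∧ γ ≠ α) → l.sum ≤ α →
    (l.map φ).sum + 1 ≤ φ α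

/-- A superadditive function `g` that bounds the number of occurrences of elements of `S` in the
nested decompositions of a multi-index: cutting an element of `S` in two proper parts loses at
least `1`. -/
structure IsCountingFunction {σ : Type*} (S : Set (σ →₀ ℕ)) (c : ℝ) (g : (σ →₀ ℕ) → ℝ) :
    Prop where
  add_le : ∀ α β, g α + g β ≤ g (α + β)
  add_add_one_le : ∀ α β, α ≠ 0 → β ≠ 0 → α + β ∈ S → g α + g β + 1 ≤ g (α + β)
  le_mul_degree : ∀ α, g α ≤ c * α.degree
  eq_zero : ∀ α, (∀ γ ∈ S, α.degree < γ.degree) → g α = 0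

section Packing

variable {σ : Type*} {S : Set (σ →₀ ℕ)} {φ : (σ →₀ ℕ) → ℝ} {c : ℝ} {α β : σ →₀ ℕ}

theorem zero_mem_packingValues : (0 : ℝ) ∈ packingValues S φ α :=
  ⟨0, by simp, by simp, by simp⟩

theorem sum_add_le_add {l l' : Multiset (σ →₀ ℕ)} (hl : l.sum ≤ α) (hl' : l'.sum ≤ β) :
    (l + l').sum ≤ α + β := by
  simpa only [Multiset.sum_add] using add_le_add hl hl'

theorem le_of_mem_of_sum_le {l : Multiset (σ →₀ ℕ)} {γ : σ →₀ ℕ} (hγ : γ ∈ l) (hl : l.sum ≤ α) :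
    γ ≤ α :=
  (Multiset.single_le_sum (fun _ _ => zero_le) γ hγ).trans hl

theorem maxPacking_add_le_of_forall {y : ℝ}
    (h : ∀ a ∈ packingValues S φ α, ∀ b ∈ packingValues S φ β, a + b ≤ y) :
    maxPacking S φ α + maxPacking S φ β ≤ y := by
  have hβ : ∀ a ∈ packingValues S φ α, maxPacking S φ β ≤ y - a := fun a ha =>
    csSup_le ⟨0, zero_mem_packingValues⟩ fun b hb => by linarith [h a ha b hb]
  have hα : maxPacking S φ α ≤ y - maxPacking S φ β :=
    csSup_le ⟨0, zero_mem_packingValues⟩ fun a ha => by linarith [hβ a ha]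
  linarith

theorem maxPacking_eq_zero (h : ∀ γ ∈ S, α.degree < γ.degree) : maxPacking S φ α = 0 := by
  suffices packingValues S φ α = {0} by rw [maxPacking, this, csSup_singleton]
  refine Set.Subset.antisymm ?_ (Set.singleton_subset_iff.2 zero_mem_packingValues)
  rintro _ ⟨l, hl, hle, rfl⟩
  rcases Multiset.empty_or_exists_mem l with rfl | ⟨γ, hγ⟩
  · simp
  · exact absurd (Finsupp.degree_mono (le_of_mem_of_sum_le hγ hle)) (not_le.2 (h γ (hl γ hγ)))

theorem sum_map_le_mul_degree (hφ : ∀ γ ∈ S, φ γ ≤ c * γ.degree) (l : Multiset (σ →₀ ℕ))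
    (hl : ∀ γ ∈ l, γ ∈ S) : (l.map φ).sum ≤ c * (l.sum.degree : ℝ) := by
  induction l using Multiset.induction with
  | empty => simp
  | cons γ l ih =>
    have hγ := hφ γ (hl γ (Multiset.mem_cons_self γ l))
    have hrest := ih fun δ hδ => hl δ (Multiset.mem_cons_of_mem hδ)
    simp only [Multiset.map_cons, Multiset.sum_cons, map_add, Nat.cast_add]
    linarith

namespace HasPackingGap

theorem le_of_mem_packingValues (h : HasPackingGap S c φ) {x : ℝ}
    (hx : x ∈ packingValues S φ α) : x ≤ c * α.degree := by
  obtain ⟨l, hl, hle, rfl⟩ := hx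
  refine (sum_map_le_mul_degree h.le_mul_degree l hl).trans ?_
  exact mul_le_mul_of_nonneg_left (mod_cast Finsupp.degree_mono hle) h.nonneg

theorem le_maxPacking (h : HasPackingGap S c φ) {x : ℝ} (hx : x ∈ packingValues S φ α) :
    x ≤ maxPacking S φ α :=
  le_csSup ⟨_, fun _ => h.le_of_mem_packingValues⟩ hx

theorem maxPacking_add_le (h : HasPackingGap S c φ) :
    maxPacking S φ α + maxPacking S φ β ≤ maxPacking S φ (α + β) := by
  refine maxPacking_add_le_of_forall ?_
  rintro _ ⟨l, hl, hle, rfl⟩ _ ⟨l', hl', hle', rfl⟩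
  refine h.le_maxPacking ⟨l + l', fun γ hγ => ?_, sum_add_le_add hle hle', by simp⟩
  exact (Multiset.mem_add.1 hγ).elim (hl γ) (hl' γ)

theorem maxPacking_add_add_one_le (h : HasPackingGap S c φ) (hα : α ≠ 0) (hβ : β ≠ 0)
    (hS : α + β ∈ S) : maxPacking S φ α + maxPacking S φ β + 1 ≤ maxPacking S φ (α + β) := by
  have hparts : maxPacking S φ α + maxPacking S φ β ≤ φ (α + β) - 1 := by
    refine maxPacking_add_le_of_forall ?_
    rintro _ ⟨l, hl, hle, rfl⟩ _ ⟨l', hl', hle', rfl⟩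
    have hne : ∀ γ ∈ l + l', γ ∈ S ∧ γ ≠ α + β := by
      intro γ hγ
      rcases Multiset.mem_add.1 hγ with h | h
      · exact ⟨hl γ h, by rintro rfl; exact hβ (by simpa using le_of_mem_of_sum_le h hle)⟩
      · exact ⟨hl' γ h, by rintro rfl; exact hα (by simpa using le_of_mem_of_sum_le h hle')⟩
    have hgap := h.sum_add_one_le _ hS (l + l') hne (sum_add_le_add hle hle')
    rw [Multiset.map_add, Multiset.sum_add] at hgap
    linarith
  have hwhole : φ (α + β) ≤ maxPacking S φ (α + β) :=
    h.le_maxPacking ⟨{α + β}, by simpa using hS, by simp, by simp⟩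
  linarith

theorem isCountingFunction (h : HasPackingGap S c φ) :
    IsCountingFunction S c (maxPacking S φ) where
  add_le _ _ := h.maxPacking_add_le
  add_add_one_le _ _ hα hβ hS := h.maxPacking_add_add_one_le hα hβ hS
  le_mul_degree _ := csSup_le ⟨0, zero_mem_packingValues⟩ fun _ => h.le_of_mem_packingValues
  eq_zero _ := maxPacking_eq_zero

end HasPackingGap

end Packing

/-- `M` is a weight compensating the small divisors `1 / Δ` with at most `s`-Gevrey growth. -/
structure IsGevreyWeight {σ : Type*} (Δ : (σ →₀ ℕ) → ℝ) (s : ℝ) (M : (σ →₀ ℕ) → ℝ) : Prop where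
  pos : ∀ α, 0 < M α
  mul_le : ∀ α β, M α * M β ≤ M (α + β)
  divisor_mul_le : ∀ α β, α ≠ 0 → β ≠ 0 → Δ (α + β) * (M α * M β) ≤ M (α + β)
  growth : ∃ K : ℝ, 1 ≤ K ∧ ∀ α, α ≠ 0 →
    M α ≤ K ^ α.degree * (α.degree : ℝ) ^ (s * (α.degree : ℝ))

/-- The multi-indices are sorted by the size of `Δ`: outside `S k` the logarithm of `Δ` is at most
`c₀ + ℓ k`, and multi-indices of degree `N` occur only in the sets `S k` with `k < κ N`. -/
structure IsScaleDecomposition {σ : Type*} (Δ : (σ →₀ ℕ) → ℝ) (S : ℕ → Set (σ →₀ ℕ)) (c₀ : ℝ)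
    (ℓ : ℕ → ℝ) (κ : ℕ → ℕ) : Prop where
  const_nonneg : 0 ≤ c₀
  level_nonneg : ∀ k, 0 ≤ ℓ k
  mono : Monotone κ
  lt_degree : ∀ N k, κ N ≤ k → ∀ γ ∈ S k, N < γ.degree
  log_le : ∀ k α, 2 ≤ α.degree → α ∉ S k → Real.log (Δ α) ≤ c₀ + ℓ k

/-- The total cost of the scales up to the degree of `α`, where each occurrence counted by `g k`
costs `ℓ (k + 1)`. -/
noncomputable def scaleSum {σ : Type*} (ℓ : ℕ → ℝ) (g : ℕ → (σ →₀ ℕ) → ℝ) (κ : ℕ → ℕ)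
    (α : σ →₀ ℕ) : ℝ :=
  ∑ k ∈ Finset.range (κ α.degree), ℓ (k + 1) * g k α

namespace IsScaleDecomposition

variable {σ : Type*} {Δ : (σ →₀ ℕ) → ℝ} {S : ℕ → Set (σ →₀ ℕ)} {c₀ : ℝ} {ℓ c : ℕ → ℝ} {κ : ℕ → ℕ}
  {g : ℕ → (σ →₀ ℕ) → ℝ} {α β : σ →₀ ℕ}

theorem notMem (h : IsScaleDecomposition Δ S c₀ ℓ κ) {k : ℕ} (hk : κ α.degree ≤ k) : α ∉ S k :=
  fun hα => lt_irrefl _ (h.lt_degree _ k hk α hα)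

theorem scaleSum_eq (h : IsScaleDecomposition Δ S c₀ ℓ κ)
    (hg : ∀ k, IsCountingFunction (S k) (c k) (g k)) {m : ℕ} (hm : κ α.degree ≤ m) :
    scaleSum ℓ g κ α = ∑ k ∈ Finset.range m, ℓ (k + 1) * g k α := by
  refine Finset.sum_subset (Finset.range_mono hm) fun k _ hk => ?_
  rw [(hg k).eq_zero α (h.lt_degree _ k (by simpa using hk)), mul_zero]

theorem scaleSum_add (h : IsScaleDecomposition Δ S c₀ ℓ κ)
    (hg : ∀ k, IsCountingFunction (S k) (c k) (g k)) (α β : σ →₀ ℕ) :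
    scaleSum ℓ g κ α + scaleSum ℓ g κ β =
      ∑ k ∈ Finset.range (κ (α + β).degree), ℓ (k + 1) * (g k α + g k β) := by
  rw [h.scaleSum_eq hg (α := α) (h.mono (Finsupp.degree_mono le_self_add)),
    h.scaleSum_eq hg (α := β) (h.mono (Finsupp.degree_mono le_add_self)),
    ← Finset.sum_add_distrib]
  simp only [mul_add]

theorem scaleSum_add_le (h : IsScaleDecomposition Δ S c₀ ℓ κ)
    (hg : ∀ k, IsCountingFunction (S k) (c k) (g k)) (α β : σ →₀ ℕ) :
    scaleSum ℓ g κ α + scaleSum ℓ g κ β ≤ scaleSum ℓ g κ (α + β) := by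
  rw [h.scaleSum_add hg]
  exact Finset.sum_le_sum fun k _ =>
    mul_le_mul_of_nonneg_left ((hg k).add_le α β) (h.level_nonneg (k + 1))

theorem level_add_scaleSum_add_le (h : IsScaleDecomposition Δ S c₀ ℓ κ)
    (hg : ∀ k, IsCountingFunction (S k) (c k) (g k)) (hα : α ≠ 0) (hβ : β ≠ 0) {k : ℕ}
    (hk : α + β ∈ S k) :
    ℓ (k + 1) + (scaleSum ℓ g κ α + scaleSum ℓ g κ β) ≤ scaleSum ℓ g κ (α + β) := by
  have hmem : k ∈ Finset.range (κ (α + β).degree) :=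
    Finset.mem_range.2 (lt_of_not_ge fun hle => h.notMem hle hk)
  rw [h.scaleSum_add hg, scaleSum, ← Finset.add_sum_erase _ _ hmem,
    ← Finset.add_sum_erase _ _ hmem, ← add_assoc]
  refine add_le_add ?_ (Finset.sum_le_sum fun m _ =>
    mul_le_mul_of_nonneg_left ((hg m).add_le α β) (h.level_nonneg (m + 1)))
  calc ℓ (k + 1) + ℓ (k + 1) * (g k α + g k β) = ℓ (k + 1) * (g k α + g k β + 1) := by ring
    _ ≤ ℓ (k + 1) * g k (α + β) :=
      mul_le_mul_of_nonneg_left ((hg k).add_add_one_le α β hα hβ hk) (h.level_nonneg (k + 1))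

theorem log_add_scaleSum_add_le (h : IsScaleDecomposition Δ S c₀ ℓ κ)
    (hg : ∀ k, IsCountingFunction (S k) (c k) (g k)) (hα : α ≠ 0) (hβ : β ≠ 0)
    (h2 : 2 ≤ (α + β).degree) :
    Real.log (Δ (α + β)) + (scaleSum ℓ g κ α + scaleSum ℓ g κ β) ≤
      c₀ + ℓ 0 + scaleSum ℓ g κ (α + β) := by
  classical
  have hex : ∃ k, α + β ∉ S k := ⟨_, h.notMem le_rfl⟩
  have hlog := h.log_le _ _ h2 (Nat.find_spec hex)
  rcases hk : Nat.find hex with _ | k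
  · rw [hk] at hlog
    linarith [h.scaleSum_add_le hg α β]
  · have hmem : α + β ∈ S k := not_not.1 (Nat.find_min hex (hk ▸ k.lt_succ_self))
    rw [hk] at hlog
    linarith [h.level_add_scaleSum_add_le hg hα hβ hmem, h.level_nonneg 0]

theorem scaleSum_le (h : IsScaleDecomposition Δ S c₀ ℓ κ)
    (hg : ∀ k, IsCountingFunction (S k) (c k) (g k)) (α : σ →₀ ℕ) :
    scaleSum ℓ g κ α ≤ (∑ k ∈ Finset.range (κ α.degree), ℓ (k + 1) * c k) * α.degree := by
  rw [scaleSum, Finset.sum_mul]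
  refine Finset.sum_le_sum fun k _ => ?_
  rw [mul_assoc]
  exact mul_le_mul_of_nonneg_left ((hg k).le_mul_degree α) (h.level_nonneg (k + 1))

theorem exp_scaleSum_le (h : IsScaleDecomposition Δ S c₀ ℓ κ)
    (hg : ∀ k, IsCountingFunction (S k) (c k) (g k)) {s C : ℝ} (hα : 1 ≤ α.degree)
    (hgrow : ∑ k ∈ Finset.range (κ α.degree), ℓ (k + 1) * c k ≤ s * Real.log α.degree + C) :
    Real.exp ((c₀ + ℓ 0) * ((α.degree : ℝ) - 1) + scaleSum ℓ g κ α) ≤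
      Real.exp (c₀ + ℓ 0 + |C|) ^ α.degree * (α.degree : ℝ) ^ (s * (α.degree : ℝ)) := by
  have hdeg : (0 : ℝ) < α.degree := mod_cast hα
  rw [← Real.exp_nat_mul, Real.rpow_def_of_pos hdeg, ← Real.exp_add, Real.exp_le_exp]
  have hsum : scaleSum ℓ g κ α ≤ (s * Real.log α.degree + |C|) * α.degree :=
    (h.scaleSum_le hg α).trans
      (mul_le_mul_of_nonneg_right (hgrow.trans (by gcongr; exact le_abs_self C)) hdeg.le)
  linarith [h.const_nonneg, h.level_nonneg 0]

theorem exists_isGevreyWeight (h : IsScaleDecomposition Δ S c₀ ℓ κ)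
    (hg : ∀ k, IsCountingFunction (S k) (c k) (g k)) {s C : ℝ}
    (hgrow : ∀ N : ℕ, 1 ≤ N →
      ∑ k ∈ Finset.range (κ N), ℓ (k + 1) * c k ≤ s * Real.log N + C) :
    ∃ M, IsGevreyWeight Δ s M := by
  have hdeg : ∀ α : σ →₀ ℕ, α ≠ 0 → 1 ≤ α.degree := fun α hα =>
    Nat.one_le_iff_ne_zero.2 (by rwa [Ne, Finsupp.degree_eq_zero_iff])
  have hnonneg : 0 ≤ c₀ + ℓ 0 := add_nonneg h.const_nonneg (h.level_nonneg 0)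
  refine ⟨fun α => Real.exp ((c₀ + ℓ 0) * ((α.degree : ℝ) - 1) + scaleSum ℓ g κ α),
    fun α => Real.exp_pos _, fun α β => ?_, fun α β hα hβ => ?_,
    Real.exp (c₀ + ℓ 0 + |C|), Real.one_le_exp (by positivity),
    fun α hα => h.exp_scaleSum_le hg (hdeg α hα) (hgrow _ (hdeg α hα))⟩
  · rw [← Real.exp_add, Real.exp_le_exp, map_add, Nat.cast_add]
    linarith [h.scaleSum_add_le hg α β]
  · have h2 : 2 ≤ (α + β).degree := by
      rw [map_add]
      linarith [hdeg α hα, hdeg β hβ]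
    have hlog := h.log_add_scaleSum_add_le hg hα hβ h2
    rw [← Real.exp_add]
    refine (mul_le_mul_of_nonneg_right (Real.le_exp_log _) (Real.exp_pos _).le).trans ?_
    rw [← Real.exp_add, Real.exp_le_exp, map_add, Nat.cast_add]
    linarith

end IsScaleDecomposition

/-! ### Small divisors -/

/-- The divisor `α · ω - ω_j`. -/
noncomputable def divisor {n : ℕ} (ω : Fin n → ℝ) (α : Fin n →₀ ℕ) (j : Fin n) : ℝ :=
  ∑ i, (α i : ℝ) * ω i - ω j

/-- The largest inverse divisor `1 / |α · ω - ω_j|` over all `j`. -/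
noncomputable def invDivisor {n : ℕ} (ω : Fin n → ℝ) (α : Fin n →₀ ℕ) : ℝ :=
  ⨆ j, |divisor ω α j|⁻¹

/-- The set of moduli of divisors whose minimum is `Ω(p)`. -/
def divisorValues {n : ℕ} (ω : Fin n → ℝ) (p : ℕ) : Set ℝ :=
  {x : ℝ | ∃ (j : Fin n) (α : Fin n → ℤ), 0 < ∑ i, |α i| ∧ ∑ i, |α i| < (p : ℤ) ∧
    ∑ i, (α i : ℝ) * ω i ≠ ω j ∧ x = |∑ i, (α i : ℝ) * ω i - ω j|}

section SmallDivisors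

variable {n : ℕ} {ω : Fin n → ℝ} {p : ℕ} {α : Fin n →₀ ℕ}

theorem inv_abs_divisor_le (ω : Fin n → ℝ) (α : Fin n →₀ ℕ) (j : Fin n) :
    |divisor ω α j|⁻¹ ≤ invDivisor ω α :=
  le_ciSup (f := fun j => |divisor ω α j|⁻¹) (Set.finite_range _).bddAbove j

theorem divisor_add_sub_divisor (ω : Fin n → ℝ) (β γ : Fin n →₀ ℕ) (i j : Fin n) :
    divisor ω (β + γ) j - divisor ω β i = divisor ω (γ + Finsupp.single i 1) j := by
  have hsingle : ∑ k, ((Finsupp.single i 1 : Fin n →₀ ℕ) k : ℝ) * ω k = ω i := by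
    rw [Finset.sum_eq_single i] <;> simp +contextual [eq_comm]
  simp only [divisor, Finsupp.add_apply, Nat.cast_add, add_mul, Finset.sum_add_distrib, hsingle]
  ring

theorem divisorValues_finite (ω : Fin n → ℝ) (p : ℕ) : (divisorValues ω p).Finite := by
  have hbox : (Set.univ ×ˢ Set.Icc (fun _ : Fin n => -(p : ℤ)) (fun _ => (p : ℤ)) :
      Set (Fin n × (Fin n → ℤ))).Finite := Set.finite_univ.prod (Set.finite_Icc _ _)
  refine (hbox.image fun q => |∑ i, (q.2 i : ℝ) * ω i - ω q.1|).subset ?_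
  rintro x ⟨j, α, -, hα, -, rfl⟩
  have habs : ∀ i, |α i| ≤ p := fun i =>
    (Finset.single_le_sum (fun i _ => abs_nonneg (α i)) (Finset.mem_univ i)).trans hα.le
  exact ⟨(j, α), ⟨trivial, fun i => (abs_le.1 (habs i)).1, fun i => (abs_le.1 (habs i)).2⟩, rfl⟩

theorem smallDivisor_le {x : ℝ} (hx : x ∈ divisorValues ω p) : smallDivisor ω p ≤ x :=
  csInf_le (divisorValues_finite ω p).bddBelow hx

namespace NonResonant

theorem divisor_ne_zero (hω : NonResonant ω) (hα : 2 ≤ α.degree) (j : Fin n) :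
    divisor ω α j ≠ 0 :=
  sub_ne_zero.2 (hω _ (α.degree_eq_sum ▸ hα) j)

theorem ne_zero (hω : NonResonant ω) (j : Fin n) : ω j ≠ 0 := by
  intro hj
  have htwo : ∑ i, ((Pi.single j 2 : Fin n → ℕ) i : ℝ) * ω i = 2 * ω j := by
    rw [Finset.sum_eq_single j] <;> simp +contextual
  exact hω (Pi.single j 2) (by simp) j (by rw [htwo, hj, mul_zero])

theorem smallDivisor_le_abs_divisor (hω : NonResonant ω) (hα : 2 ≤ α.degree) (hp : α.degree < p)
    (j : Fin n) : smallDivisor ω p ≤ |divisor ω α j| := by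
  have hsum : ∑ i, |((α i : ℕ) : ℤ)| = (α.degree : ℤ) := by simp [Finsupp.degree_eq_sum]
  refine smallDivisor_le ⟨j, fun i => α i, by rw [hsum]; omega, by rw [hsum]; omega, ?_, ?_⟩
  · simpa [divisor, sub_eq_zero] using hω.divisor_ne_zero hα j
  · simp [divisor]

variable [NeZero n]

theorem invDivisor_pos (hω : NonResonant ω) (hα : 2 ≤ α.degree) : 0 < invDivisor ω α :=
  (inv_pos.2 (abs_pos.2 (hω.divisor_ne_zero hα 0))).trans_le (inv_abs_divisor_le ω α 0)

theorem log_invDivisor_le (hω : NonResonant ω) (hα : 2 ≤ α.degree) {c : ℝ}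
    (h : ∀ j, Real.exp (-c) ≤ |divisor ω α j|) : Real.log (invDivisor ω α) ≤ c := by
  rw [Real.log_le_iff_le_exp (hω.invDivisor_pos hα)]
  refine ciSup_le fun j => ?_
  rw [inv_le_comm₀ ((Real.exp_pos _).trans_le (h j)) (Real.exp_pos _), ← Real.exp_neg]
  exact h j

theorem divisorValues_nonempty (hω : NonResonant ω) (hp : 2 ≤ p) :
    (divisorValues ω p).Nonempty := by
  have habs : ∑ i, |(-Pi.single 0 1 : Fin n → ℤ) i| = 1 := by
    rw [Finset.sum_eq_single 0] <;> simp +contextual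
  have hsum : ∑ i, ((-Pi.single 0 1 : Fin n → ℤ) i : ℝ) * ω i = -ω 0 := by
    rw [Finset.sum_eq_single 0] <;> simp +contextual
  refine ⟨_, 0, -Pi.single 0 1, by rw [habs]; omega, by rw [habs]; omega, ?_, rfl⟩
  rw [hsum]
  exact neg_ne_self.2 (hω.ne_zero 0)

theorem smallDivisor_pos (hω : NonResonant ω) (hp : 2 ≤ p) : 0 < smallDivisor ω p := by
  obtain ⟨j, α, -, -, hne, heq⟩ :=
    (hω.divisorValues_nonempty hp).csInf_mem (divisorValues_finite ω p)
  exact (abs_pos.2 (sub_ne_zero.2 hne)).trans_eq heq.symm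

theorem smallDivisor_anti (hω : NonResonant ω) {q : ℕ} (hp : 2 ≤ p) (hpq : p ≤ q) :
    smallDivisor ω q ≤ smallDivisor ω p := by
  refine le_csInf (hω.divisorValues_nonempty hp) ?_
  rintro x ⟨j, α, hpos, hlt, hne, rfl⟩
  exact smallDivisor_le ⟨j, α, hpos, hlt.trans_le (mod_cast hpq), hne, rfl⟩

end NonResonant

/-- The multi-indices of degree at least two with a divisor below a quarter of `Ω(p)`. -/
def smallSet (ω : Fin n → ℝ) (p : ℕ) : Set (Fin n →₀ ℕ) :=
  {α | 2 ≤ α.degree ∧ ∃ j, |divisor ω α j| < smallDivisor ω p / 4}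

namespace NonResonant

variable [NeZero n] {β : Fin n →₀ ℕ}

theorem le_degree_of_mem_smallSet (hω : NonResonant ω) (hp : 2 ≤ p) (hα : α ∈ smallSet ω p) :
    p ≤ α.degree := by
  obtain ⟨h2, j, hj⟩ := hα
  by_contra! hlt
  linarith [hω.smallDivisor_le_abs_divisor h2 hlt j, hω.smallDivisor_pos hp]

theorem add_degree_le_of_mem_smallSet (hω : NonResonant ω) (hp : 2 ≤ p) (hα : α ∈ smallSet ω p)
    (hβ : β ∈ smallSet ω p) (hle : β ≤ α) (hne : β ≠ α) : p + β.degree ≤ α.degree + 1 := by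
  obtain ⟨γ, rfl⟩ := le_iff_exists_add.1 hle
  obtain ⟨-, j, hj⟩ := hα
  obtain ⟨-, i, hi⟩ := hβ
  have hγ : γ.degree ≠ 0 := by
    rw [Ne, Finsupp.degree_eq_zero_iff]
    rintro rfl
    exact hne (add_zero β).symm
  have hdeg : (γ + Finsupp.single i 1).degree = γ.degree + 1 := by simp
  rw [map_add]
  by_contra hlt
  have hdiff : smallDivisor ω p ≤ |divisor ω (β + γ) j - divisor ω β i| := by
    rw [divisor_add_sub_divisor]
    exact hω.smallDivisor_le_abs_divisor (by omega) (by omega) j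
  linarith [abs_sub (divisor ω (β + γ) j) (divisor ω β i), hω.smallDivisor_pos hp]

end NonResonant

theorem sum_map_two_mul_degree_div_sub_one (p : ℝ) (l : Multiset (Fin n →₀ ℕ)) :
    (l.map fun γ => 2 * (γ.degree : ℝ) / p - 1).sum = 2 * (l.sum.degree : ℝ) / p - l.card := by
  induction l using Multiset.induction with
  | empty => simp
  | cons γ l ih =>
    simp only [Multiset.map_cons, Multiset.sum_cons, map_add, Nat.cast_add, Multiset.card_cons,
      ih, Nat.cast_one]
    ring

/-- Brjuno's counting lemma: the degree gap between comparable elements of `smallSet ω p` is nearly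
`p`, so an element of degree `d` contains the others at most `2 d / p - 1` times. -/
theorem NonResonant.hasPackingGap_smallSet [NeZero n] (hω : NonResonant ω) (hp : 2 ≤ p) :
    HasPackingGap (smallSet ω p) (2 / p) fun γ => 2 * (γ.degree : ℝ) / p - 1 where
  nonneg := by positivity
  le_mul_degree γ _ := by rw [div_mul_eq_mul_div]; exact sub_le_self _ zero_le_one
  sum_add_one_le α hα l hl hle := by
    have hp0 : (0 : ℝ) < p := by positivity
    rw [sum_map_two_mul_degree_div_sub_one]
    rcases hcard : l.card with _ | _ | m
    · rw [Multiset.card_eq_zero.1 hcard, Multiset.sum_zero, map_zero, Nat.cast_zero, mul_zero,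
        zero_div, le_sub_iff_add_le, le_div_iff₀ hp0]
      have hdeg : (p : ℝ) ≤ α.degree := mod_cast hω.le_degree_of_mem_smallSet hp hα
      linarith
    · obtain ⟨γ, rfl⟩ := Multiset.card_eq_one.1 hcard
      obtain ⟨hγ, hne⟩ := hl γ (Multiset.mem_singleton_self γ)
      rw [Multiset.sum_singleton] at hle ⊢
      have hgap := hω.add_degree_le_of_mem_smallSet hp hα hγ hle hne
      have hgap2 : (p : ℝ) + 2 * γ.degree ≤ 2 * α.degree := by
        have := Finsupp.degree_mono hle
        exact_mod_cast (by omega : p + 2 * γ.degree ≤ 2 * α.degree)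
      have hdiv : 1 + 2 * (γ.degree : ℝ) / p ≤ 2 * (α.degree : ℝ) / p := by
        rw [le_div_iff₀ hp0, add_mul, div_mul_cancel₀ _ hp0.ne']
        linarith
      push_cast
      linarith
    · have hdiv : 2 * (l.sum.degree : ℝ) / p ≤ 2 * (α.degree : ℝ) / p := by
        gcongr
        exact Finsupp.degree_mono hle
      push_cast
      linarith [m.cast_nonneg (α := ℝ)]

end SmallDivisors

/-! ### The weight under the Bruno-`s` condition -/

section LastIndex

variable {p : ℕ → ℝ}

theorem le_lastIndex {N k : ℕ} (hp : {k : ℕ | p k ≤ N}.Finite) (hk : p k ≤ N) :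
    k ≤ lastIndex p N :=
  le_csSup hp.bddAbove hk

theorem lastIndex_mono (hp : ∀ N : ℕ, {k : ℕ | p k ≤ N}.Finite) : Monotone (lastIndex p) := by
  intro N N' h
  rcases Set.eq_empty_or_nonempty {k : ℕ | p k ≤ N} with hempty | hne
  · simp [lastIndex, hempty]
  · exact csSup_le hne fun k hk => le_lastIndex (hp N') (le_trans hk (mod_cast h))

theorem exists_forall_sum_le_of_eventually {x : ℕ → ℝ} {s C : ℝ} (hs : 0 ≤ s)
    (hp : ∀ N : ℕ, {k : ℕ | p k ≤ N}.Finite) (hx : ∀ k, 0 ≤ x k)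
    (h : ∀ᶠ N : ℕ in atTop,
      ∑ k ∈ Finset.range (lastIndex p N + 1), x k ≤ s * Real.log N + C) :
    ∃ C', ∀ N : ℕ,
      ∑ k ∈ Finset.range (lastIndex p N + 1), x k ≤ s * Real.log N + C' := by
  obtain ⟨N₀, hN₀⟩ := eventually_atTop.1 h
  refine ⟨s * Real.log (N₀ : ℝ) + |C|, fun N => ?_⟩
  have hlog : 0 ≤ s * Real.log N := mul_nonneg hs (Real.log_natCast_nonneg N)
  have hlog₀ : 0 ≤ s * Real.log N₀ := mul_nonneg hs (Real.log_natCast_nonneg N₀)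
  rcases le_total N₀ N with hle | hle
  · linarith [hN₀ N hle, le_abs_self C]
  · have hmono : ∑ k ∈ Finset.range (lastIndex p N + 1), x k ≤
        ∑ k ∈ Finset.range (lastIndex p N₀ + 1), x k :=
      Finset.sum_le_sum_of_subset_of_nonneg
        (Finset.range_mono (Nat.succ_le_succ (lastIndex_mono hp hle))) fun k _ _ => hx k
    linarith [hN₀ N₀ le_rfl, le_abs_self C]

end LastIndex

theorem exists_eventually_le_of_limsup_lt_top {ι : Type*} {l : Filter ι} {u : ι → ℝ}
    (h : limsup (fun i => (u i : EReal)) l < ⊤) : ∃ C : ℝ, ∀ᶠ i in l, u i ≤ C := by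
  obtain ⟨C, hC, -⟩ := EReal.lt_iff_exists_real_btwn.1 h
  exact ⟨C, (eventually_lt_of_limsup_lt hC).mono fun i hi => mod_cast hi.le⟩

theorem exists_sum_max_zero_le {x : ℕ → ℝ} (hx : ∀ k m, k ≤ m → 0 ≤ x k → 0 ≤ x m) :
    ∃ C, 0 ≤ C ∧ ∀ m, ∑ k ∈ Finset.range m, max 0 (x k) ≤
      max 0 (∑ k ∈ Finset.range m, x k + C) := by
  by_cases hpos : ∃ k₀, 0 ≤ x k₀
  · obtain ⟨k₀, hk₀⟩ := hpos
    have hdiff : ∀ k, 0 ≤ max 0 (x k) - x k := fun k => sub_nonneg.2 (le_max_right 0 (x k))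
    refine ⟨∑ k ∈ Finset.range k₀, (max 0 (x k) - x k), Finset.sum_nonneg fun k _ => hdiff k,
      fun m => le_max_of_le_right ?_⟩
    have hsum : ∑ k ∈ Finset.range m, (max 0 (x k) - x k) ≤
        ∑ k ∈ Finset.range k₀, (max 0 (x k) - x k) := by
      rw [Finset.sum_subset (Finset.range_mono (le_max_left k₀ m)) fun k _ hk => ?_]
      · exact Finset.sum_le_sum_of_subset_of_nonneg (Finset.range_mono (le_max_right k₀ m))
          fun k _ _ => hdiff k
      · rw [max_eq_right (hx k₀ k (by simpa using hk) hk₀), sub_self]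
    rw [Finset.sum_sub_distrib] at hsum
    linarith
  · push Not at hpos
    exact ⟨0, le_rfl, fun m => le_max_of_le_left
      (Finset.sum_eq_zero fun k _ => max_eq_left (hpos k).le).le⟩

/-- The term `log Ω(p_{m+1})⁻¹` of the Bruno series. -/
noncomputable def brunoLevel {n : ℕ} (ω : Fin n → ℝ) (p : ℕ → ℕ) (m : ℕ) : ℝ :=
  Real.log (smallDivisor ω (p (m + 1)))⁻¹

section BrunoWeight

variable {n : ℕ} [NeZero n] {ω : Fin n → ℝ} {p : ℕ → ℕ}

theorem finite_setOf_cast_le (hp : StrictMono p) (N : ℕ) : {k : ℕ | (p k : ℝ) ≤ N}.Finite :=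
  (Set.finite_Iic N).subset fun k hk => (hp.id_le k).trans (Nat.cast_le.1 (Set.mem_ofPred_eq ▸ hk))

theorem two_le_apply_succ (hp : StrictMono p) (hpos : 0 < p 0) (k : ℕ) : 2 ≤ p (k + 1) :=
  (Nat.succ_le_of_lt hpos).trans_lt (hp k.succ_pos)

theorem NonResonant.brunoLevel_monotone (hω : NonResonant ω) (hp : StrictMono p)
    (hpos : 0 < p 0) : Monotone (brunoLevel ω p) := by
  refine monotone_nat_of_le_succ fun m => ?_
  simp only [brunoLevel, Real.log_inv, neg_le_neg_iff]
  exact Real.log_le_log (hω.smallDivisor_pos (two_le_apply_succ hp hpos _))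
    (hω.smallDivisor_anti (two_le_apply_succ hp hpos _) (hp.monotone m.succ.le_succ))

theorem NonResonant.isScaleDecomposition_smallSet (hω : NonResonant ω) (hp : StrictMono p)
    (hpos : 0 < p 0) :
    IsScaleDecomposition (invDivisor ω) (fun k => smallSet ω (p (k + 1))) (Real.log 4)
      (fun k => max 0 (brunoLevel ω p k)) (lastIndex fun k => (p k : ℝ)) where
  const_nonneg := Real.log_nonneg (by norm_num)
  level_nonneg k := le_max_left _ _
  mono := lastIndex_mono (finite_setOf_cast_le hp)
  lt_degree N k hk γ hγ := by
    by_contra! hN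
    have hpN : p (k + 1) ≤ N :=
      (hω.le_degree_of_mem_smallSet (two_le_apply_succ hp hpos k) hγ).trans hN
    have hlast := le_lastIndex (p := fun k => (p k : ℝ)) (finite_setOf_cast_le hp N)
      (k := k + 1) (mod_cast hpN)
    omega
  log_le k α hα hmem := by
    refine hω.log_invDivisor_le hα fun j => ?_
    simp only [smallSet, Set.mem_ofPred_eq, not_and, not_exists, not_lt] at hmem
    have hlevel : Real.exp (-max 0 (brunoLevel ω p k)) ≤ smallDivisor ω (p (k + 1)) := by
      rw [← Real.le_log_iff_exp_le (hω.smallDivisor_pos (two_le_apply_succ hp hpos k)), neg_le,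
        ← Real.log_inv]
      exact le_max_right 0 _
    calc Real.exp (-(Real.log 4 + max 0 (brunoLevel ω p k)))
        = Real.exp (-max 0 (brunoLevel ω p k)) / 4 := by
          rw [neg_add, Real.exp_add, Real.exp_neg (Real.log 4), Real.exp_log (by norm_num)]
          ring
      _ ≤ smallDivisor ω (p (k + 1)) / 4 := by gcongr
      _ ≤ |divisor ω α j| := hmem hα j

theorem exists_eventually_sum_brunoLevel_le {s : ℝ}
    (hlim : limsup (fun α : Fin n → ℕ =>
      ((2 * ∑ m ∈ Finset.range (lastIndex (fun k => (p k : ℝ)) (∑ i, α i) + 1),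
            Real.log (smallDivisor ω (p (m + 1)))⁻¹ / (p m : ℝ)
          - s * Real.log ((∑ i, α i : ℕ) : ℝ) : ℝ) : EReal))
      (comap (fun α : Fin n → ℕ => ∑ i, α i) atTop) < ⊤) :
    ∃ C, ∀ᶠ N : ℕ in atTop, ∑ m ∈ Finset.range (lastIndex (fun k => (p k : ℝ)) N + 1),
      2 / (p m : ℝ) * brunoLevel ω p m ≤ s * Real.log N + C := by
  obtain ⟨C, hC⟩ := exists_eventually_le_of_limsup_lt_top hlim
  obtain ⟨t, ht, hsub⟩ := mem_comap.1 hC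
  refine ⟨C, ?_⟩
  filter_upwards [ht] with N hN
  have hα := hsub (show (Pi.single 0 N : Fin n → ℕ) ∈ _ by simpa using hN)
  simp only [Set.mem_ofPred_eq, Finset.sum_pi_single', Finset.mem_univ, if_true,
    Finset.mul_sum] at hα
  rw [← sub_le_iff_le_add']
  refine le_of_eq_of_le (congrArg (· - _) (Finset.sum_congr rfl fun m _ => ?_)) hα
  rw [brunoLevel]
  ring

theorem NonResonant.exists_sum_max_brunoLevel_le (hω : NonResonant ω) (hp : StrictMono p)
    (hpos : 0 < p 0) {s C : ℝ} (hs : 0 ≤ s)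
    (h : ∀ᶠ N : ℕ in atTop, ∑ m ∈ Finset.range (lastIndex (fun k => (p k : ℝ)) N + 1),
      2 / (p m : ℝ) * brunoLevel ω p m ≤ s * Real.log N + C) :
    ∃ C', ∀ N : ℕ,
      ∑ m ∈ Finset.range (lastIndex (fun k => (p k : ℝ)) N + 1),
        max 0 (2 / (p m : ℝ) * brunoLevel ω p m) ≤ s * Real.log N + C' := by
  have hp0 : ∀ k, (0 : ℝ) < p k := fun k =>
    mod_cast hpos.trans_le (hp.monotone (Nat.zero_le k))
  have hsign : ∀ k m, k ≤ m → 0 ≤ 2 / (p k : ℝ) * brunoLevel ω p k →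
      0 ≤ 2 / (p m : ℝ) * brunoLevel ω p m := fun k m hkm hk =>
    mul_nonneg (by positivity) ((nonneg_of_mul_nonneg_right hk (div_pos two_pos (hp0 k))).trans
      (hω.brunoLevel_monotone hp hpos hkm))
  obtain ⟨C₁, hC₁, hmax⟩ := exists_sum_max_zero_le hsign
  refine exists_forall_sum_le_of_eventually (C := |C| + C₁) hs (finite_setOf_cast_le hp)
    (fun k => le_max_left _ _) ?_
  filter_upwards [h] with N hN
  exact (hmax _).trans (max_le (by positivity) (by linarith [le_abs_self C]))

theorem BrunoS.exists_isGevreyWeight {s : ℝ} (hs : 0 ≤ s) (hω : NonResonant ω)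
    (h : BrunoS ω s) : ∃ M, IsGevreyWeight (invDivisor ω) s M := by
  obtain ⟨p, hp, hpos, hlim⟩ := h
  obtain ⟨C₀, hC₀⟩ := exists_eventually_sum_brunoLevel_le hlim
  obtain ⟨C, hC⟩ := hω.exists_sum_max_brunoLevel_le hp (hpos 0) hs hC₀
  refine (hω.isScaleDecomposition_smallSet hp (hpos 0)).exists_isGevreyWeight (C := C)
    (fun k => (hω.hasPackingGap_smallSet (two_le_apply_succ hp (hpos 0) k)).isCountingFunction)
    fun N _ => le_trans ?_ (hC N)
  rw [Finset.sum_range_succ']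
  refine le_add_of_le_of_nonneg (Finset.sum_le_sum fun k _ => ?_) (le_max_left _ _)
  rw [mul_comm, mul_max_of_nonneg _ _ (by positivity), mul_zero]

end BrunoWeight

/-! ### Convergents of continued fractions -/

section ContFract

open GenContFract

variable {x : ℝ}

theorem not_terminatedAt_of_irrational (hx : Irrational x) (k : ℕ) :
    ¬(GenContFract.of x).TerminatedAt k := by
  intro hk
  obtain ⟨q, hq⟩ := (terminates_iff_rat x).1 ⟨k, hk⟩
  exact hx ⟨q, hq.symm⟩

theorem exists_partialQuotients (hx : Irrational x) :
    ∃ b : ℕ → ℤ, ∀ k, 1 ≤ b k ∧ (GenContFract.of x).s.get? k = some ⟨1, b k⟩ := by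
  have hget (k : ℕ) : ∃ b : ℤ, 1 ≤ b ∧ (GenContFract.of x).s.get? k = some ⟨1, b⟩ := by
    obtain ⟨a, ha⟩ := Option.ne_none_iff_exists'.1 (not_terminatedAt_of_irrational hx k)
    obtain ⟨hnum, b, hden⟩ := of_partNum_eq_one_and_exists_int_partDen_eq ha
    have hb : (1 : ℝ) ≤ b := hden ▸ of_one_le_get?_partDen (partDen_eq_s_b ha)
    exact ⟨b, mod_cast hb, by rw [ha, ← hnum, ← hden]⟩
  exact ⟨fun k => (hget k).choose, fun k => (hget k).choose_spec⟩

theorem one_le_convDenom (hx : Irrational x) (k : ℕ) : 1 ≤ convDenom x k := by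
  have hfib : (1 : ℝ) ≤ Nat.fib (k + 1) := mod_cast Nat.fib_pos.2 k.succ_pos
  exact hfib.trans (succ_nth_fib_le_of_nth_den (Or.inr (not_terminatedAt_of_irrational hx _)))

theorem convDenom_add_le (hx : Irrational x) (k : ℕ) :
    convDenom x k + convDenom x (k + 1) ≤ convDenom x (k + 2) := by
  obtain ⟨b, hb⟩ := exists_partialQuotients hx
  have hrec : convDenom x (k + 2) = b (k + 1) * convDenom x (k + 1) + convDenom x k := by
    rw [convDenom, dens_recurrence (hb (k + 1)).2 rfl rfl, one_mul]
    rfl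
  have hb1 : (1 : ℝ) ≤ b (k + 1) := mod_cast (hb (k + 1)).1
  rw [hrec, add_comm]
  gcongr
  exact le_mul_of_one_le_left (zero_le_one.trans (one_le_convDenom hx _)) hb1

theorem exists_int_eq_nums_dens (hx : Irrational x) (k : ℕ) :
    ∃ p q : ℤ, (GenContFract.of x).nums k = p ∧ (GenContFract.of x).dens k = q := by
  obtain ⟨b, hb⟩ := exists_partialQuotients hx
  induction k using Nat.twoStepInduction with
  | zero => exact ⟨⌊x⌋, 1, by rw [zeroth_num_eq_h, of_h_eq_floor], by simp⟩
  | one =>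
    refine ⟨b 0 * ⌊x⌋ + 1, b 0, ?_, first_den_eq (hb 0).2⟩
    rw [first_num_eq (hb 0).2, of_h_eq_floor]
    push_cast
    rfl
  | more k ih ih' =>
    obtain ⟨p, q, hp, hq⟩ := ih
    obtain ⟨p', q', hp', hq'⟩ := ih'
    refine ⟨b (k + 1) * p' + p, b (k + 1) * q' + q, ?_, ?_⟩
    · rw [nums_recurrence (hb (k + 1)).2 hp hp']
      push_cast
      ring
    · rw [dens_recurrence (hb (k + 1)).2 hq hq']
      push_cast
      ring

theorem exists_stream_fr_ne_zero (hx : Irrational x) (k : ℕ) :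
    ∃ ifp, IntFractPair.stream x k = some ifp ∧ ifp.fr ≠ 0 := by
  have hne : IntFractPair.stream x (k + 1) ≠ none :=
    (not_congr of_terminatedAt_n_iff_succ_nth_intFractPair_stream_eq_none).1
      (not_terminatedAt_of_irrational hx k)
  obtain ⟨_, hsucc⟩ := Option.ne_none_iff_exists'.1 hne
  obtain ⟨ifp, hifp, hfr, -⟩ := IntFractPair.succ_nth_stream_eq_some_iff.1 hsucc
  exact ⟨ifp, hifp, hfr⟩

theorem neg_one_pow_mul_convergent_error_pos (hx : Irrational x) (k : ℕ) :
    0 < (-1) ^ k * ((GenContFract.of x).dens k * x - (GenContFract.of x).nums k) := by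
  obtain ⟨ifp, hifp, hfr⟩ := exists_stream_fr_ne_zero hx k
  have hfr_pos : 0 < ifp.fr := (IntFractPair.nth_stream_fr_nonneg hifp).lt_of_ne' hfr
  have hq : 0 < (GenContFract.of x).dens k := one_pos.trans_le (one_le_convDenom hx k)
  have hb : 0 ≤ ((GenContFract.of x).contsAux k).b := zero_le_of_contsAux_b
  have herr := sub_convs_eq hifp
  simp only [hfr, if_false, ← nth_cont_eq_succ_nth_contAux, ← den_eq_conts_b,
    conv_eq_num_div_den] at herr
  set y := ifp.fr⁻¹ * (GenContFract.of x).dens k + ((GenContFract.of x).contsAux k).b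
  have hy : 0 < y := by positivity
  have hmul : (GenContFract.of x).dens k * x - (GenContFract.of x).nums k = (-1) ^ k / y := by
    rw [← mul_div_mul_left _ _ hq.ne', mul_div_assoc, ← herr, mul_sub, mul_div_cancel₀ _ hq.ne']
  rw [hmul, ← mul_div_assoc, ← mul_pow, neg_one_mul, neg_neg, one_pow]
  exact one_div_pos.2 hy

end ContFract

/-- The properties of the numerators `P` and denominators `Q` of the convergents of an irrational
number `x` that are used for the small divisors. -/
structure IsConvergentSeq (x : ℝ) (P Q : ℕ → ℤ) : Prop where
  one_le : ∀ k, 1 ≤ Q k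
  mono : ∀ k, Q k ≤ Q (k + 1)
  add_le : ∀ k, Q k + Q (k + 1) ≤ Q (k + 2)
  det : ∀ k, P k * Q (k + 1) - Q k * P (k + 1) = (-1) ^ (k + 1)
  sign : ∀ k, 0 < (-1) ^ k * (Q k * x - P k)

theorem exists_isConvergentSeq {x : ℝ} (hx : Irrational x) :
    ∃ P Q : ℕ → ℤ, IsConvergentSeq x P Q ∧ ∀ k, convDenom x k = Q k := by
  choose P Q hP hQ using exists_int_eq_nums_dens hx
  have hQ' : ∀ k, convDenom x k = Q k := hQ
  refine ⟨P, Q, ⟨fun k => ?_, fun k => ?_, fun k => ?_, fun k => ?_, fun k => ?_⟩, hQ⟩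
  · exact_mod_cast hQ' k ▸ one_le_convDenom hx k
  · have hle : convDenom x k ≤ convDenom x (k + 1) := GenContFract.of_den_mono
    rw [hQ', hQ'] at hle
    exact_mod_cast hle
  · have hadd := convDenom_add_le hx k
    simp only [hQ'] at hadd
    exact_mod_cast hadd
  · have hdet : (GenContFract.of x).nums k * (GenContFract.of x).dens (k + 1) -
        (GenContFract.of x).dens k * (GenContFract.of x).nums (k + 1) = (-1) ^ (k + 1) :=
      (SimpContFract.of x).determinant (not_terminatedAt_of_irrational hx k)
    simp only [hP, hQ] at hdet
    exact_mod_cast hdet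
  · simpa only [hP, hQ] using neg_one_pow_mul_convergent_error_pos hx k

namespace IsConvergentSeq

variable {x : ℝ} {P Q : ℕ → ℤ}

theorem cast_pos (h : IsConvergentSeq x P Q) (k : ℕ) : (0 : ℝ) < Q k :=
  mod_cast h.one_le k

theorem two_le (h : IsConvergentSeq x P Q) (k : ℕ) : 2 ≤ Q (k + 2) := by
  linarith [h.add_le k, h.one_le k, h.one_le (k + 1)]

theorem abs_error (h : IsConvergentSeq x P Q) (k : ℕ) :
    |Q k * x - P k| = (-1) ^ k * (Q k * x - P k) := by
  rw [← abs_of_pos (h.sign k), abs_mul, abs_pow, abs_neg, abs_one, one_pow, one_mul]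

theorem mul_abs_error_add (h : IsConvergentSeq x P Q) (k : ℕ) :
    Q (k + 1) * |Q k * x - P k| + Q k * |Q (k + 1) * x - P (k + 1)| = 1 := by
  have hdet : (P k * Q (k + 1) - Q k * P (k + 1) : ℝ) = (-1) ^ (k + 1) := mod_cast h.det k
  have hsq : (-1 : ℝ) ^ k * (-1) ^ k = 1 := by rw [← mul_pow]; simp
  rw [h.abs_error, h.abs_error]
  rw [pow_succ] at hdet ⊢
  linear_combination (-(-1) ^ k) * hdet + hsq

theorem abs_error_le (h : IsConvergentSeq x P Q) (k : ℕ) :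
    |Q k * x - P k| ≤ 1 / Q (k + 1) := by
  rw [le_div_iff₀ (h.cast_pos _), mul_comm, ← h.mul_abs_error_add k]
  exact le_add_of_nonneg_right (mul_nonneg (h.cast_pos k).le (abs_nonneg _))

theorem le_abs_error (h : IsConvergentSeq x P Q) (k : ℕ) :
    1 / (2 * Q (k + 1)) ≤ |Q k * x - P k| := by
  have hsum := h.mul_abs_error_add k
  have hq := h.cast_pos k
  have hq1 := h.cast_pos (k + 1)
  have hq2 : 2 * (Q k : ℝ) ≤ Q (k + 2) :=
    mod_cast (by linarith [h.add_le k, h.mono k] : 2 * Q k ≤ Q (k + 2))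
  have hhalf : Q k * |Q (k + 1) * x - P (k + 1)| ≤ 1 / 2 := by
    calc Q k * |Q (k + 1) * x - P (k + 1)| ≤ Q k * (1 / Q (k + 1 + 1)) := by
          gcongr
          exact h.abs_error_le (k + 1)
      _ ≤ 1 / 2 := by
        rw [mul_one_div, div_le_div_iff₀ (h.cast_pos (k + 2)) two_pos]
        linarith
  rw [div_le_iff₀ (by positivity)]
  linarith

theorem error_mul_error_neg (h : IsConvergentSeq x P Q) (k : ℕ) :
    (Q k * x - P k) * (Q (k + 1) * x - P (k + 1)) < 0 := by
  have hsq : (-1 : ℝ) ^ k * (-1) ^ k = 1 := by rw [← mul_pow]; simp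
  have hprod := mul_pos (h.sign k) (h.sign (k + 1))
  rw [pow_succ] at hprod
  linear_combination hprod - (Q k * x - P k) * (Q (k + 1) * x - P (k + 1)) * hsq

theorem exists_eq_combination (h : IsConvergentSeq x P Q) (k : ℕ) (m b : ℤ) :
    ∃ u v : ℤ, m = u * Q k + v * Q (k + 1) ∧ b = u * P k + v * P (k + 1) := by
  have hdet := h.det k
  have hsq : (-1 : ℤ) ^ (k + 1) * (-1) ^ (k + 1) = 1 := by rw [← mul_pow]; simp
  set ε : ℤ := (-1) ^ (k + 1)
  refine ⟨ε * (b * Q (k + 1) - m * P (k + 1)), ε * (m * P k - b * Q k), ?_, ?_⟩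
  · linear_combination (-m) * hsq - ε * m * hdet
  · linear_combination (-b) * hsq - ε * b * hdet

theorem coeff_ne_zero_and_mul_nonpos (h : IsConvergentSeq x P Q) (k : ℕ) {u v : ℤ}
    (hne : u * Q k + v * Q (k + 1) ≠ 0) (hlt : |u * Q k + v * Q (k + 1)| < Q (k + 1)) :
    u ≠ 0 ∧ u * v ≤ 0 := by
  have hq := h.one_le k
  have hq1 := h.one_le (k + 1)
  obtain ⟨hlo, hhi⟩ := abs_lt.1 hlt
  constructor
  · rintro rfl
    have hv : v ≠ 0 := by rintro rfl; simp at hne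
    rw [zero_mul, zero_add, abs_mul, abs_of_pos (one_pos.trans_le hq1)] at hlt
    nlinarith [Int.one_le_abs hv]
  · by_contra! huv
    rcases pos_and_pos_or_neg_and_neg_of_mul_pos huv with ⟨hu, hv⟩ | ⟨hu, hv⟩ <;> nlinarith

/-- The best approximation property: in `m x - b = u (Q_k x - P_k) + v (Q_{k+1} x - P_{k+1})` the
two summands have the same sign. -/
theorem le_abs_of_abs_lt (h : IsConvergentSeq x P Q) (k : ℕ) {m b : ℤ} (hm : m ≠ 0)
    (hlt : |m| < Q (k + 1)) : 1 / (2 * Q (k + 1)) ≤ |m * x - b| := by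
  obtain ⟨u, v, rfl, rfl⟩ := h.exists_eq_combination k m b
  obtain ⟨hu, huv⟩ := h.coeff_ne_zero_and_mul_nonpos k hm hlt
  have hu1 : (1 : ℝ) ≤ |(u : ℝ)| := mod_cast Int.one_le_abs hu
  have huv' : (u : ℝ) * v ≤ 0 := mod_cast huv
  have hsame : 0 ≤ (u * (Q k * x - P k)) * (v * (Q (k + 1) * x - P (k + 1))) := by
    rw [mul_mul_mul_comm]
    exact mul_nonneg_of_nonpos_of_nonpos huv' (h.error_mul_error_neg k).le
  calc 1 / (2 * (Q (k + 1) : ℝ)) ≤ |Q k * x - P k| := h.le_abs_error k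
    _ ≤ |u * (Q k * x - P k)| := by
      rw [abs_mul]
      exact le_mul_of_one_le_left (abs_nonneg _) hu1
    _ ≤ |u * (Q k * x - P k) + v * (Q (k + 1) * x - P (k + 1))| := by
      rw [← sq_le_sq]
      nlinarith [sq_nonneg (v * (Q (k + 1) * x - P (k + 1)))]
    _ = |((u * Q k + v * Q (k + 1) : ℤ) : ℝ) * x - (u * P k + v * P (k + 1) : ℤ)| := by
      congr 1
      push_cast
      ring

theorem abs_mul_error_le (h : IsConvergentSeq x P Q) (k : ℕ) {t : ℤ} (ht : 0 ≤ t)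
    (hlt : 4 * (t * Q (k + 1)) ≤ Q (k + 2)) :
    |t * (Q (k + 1) * x - P (k + 1))| ≤ 1 / (4 * Q (k + 1)) := by
  have hq := h.cast_pos (k + 1)
  have ht' : (0 : ℝ) ≤ t := mod_cast ht
  have hlt' : 4 * (t * (Q (k + 1) : ℝ)) ≤ Q (k + 2) := mod_cast hlt
  rw [abs_mul, abs_of_nonneg ht']
  calc (t : ℝ) * |Q (k + 1) * x - P (k + 1)| ≤ t * (1 / Q (k + 2)) := by
        gcongr
        exact h.abs_error_le (k + 1)
    _ ≤ 1 / (4 * Q (k + 1)) := by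
      rw [mul_one_div, div_le_div_iff₀ (h.cast_pos (k + 2)) (by positivity)]
      linarith

theorem exists_eq_mul (h : IsConvergentSeq x P Q) (k : ℕ) {m b : ℤ} (hm : 0 ≤ m)
    (hlt : 4 * m < Q (k + 2)) (happ : |m * x - b| < 1 / (4 * Q (k + 1))) :
    ∃ t : ℤ, 0 ≤ t ∧ m = t * Q (k + 1) ∧ b = t * P (k + 1) := by
  have hq := h.one_le (k + 1)
  have hq' := h.cast_pos (k + 1)
  have hdivmod : m / Q (k + 1) * Q (k + 1) + m % Q (k + 1) = m := Int.ediv_mul_add_emod m _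
  have ht : 0 ≤ m / Q (k + 1) := Int.ediv_nonneg hm (by omega)
  have hr : 0 ≤ m % Q (k + 1) := Int.emod_nonneg _ (by omega)
  have hrlt : m % Q (k + 1) < Q (k + 1) := Int.emod_lt_of_pos _ (by omega)
  set t := m / Q (k + 1)
  set r := m % Q (k + 1)
  have hrem : |(r : ℝ) * x - ((b - t * P (k + 1) : ℤ) : ℝ)| < 1 / (2 * Q (k + 1)) := by
    have herr := h.abs_mul_error_le k ht (by linarith)
    have htri := abs_sub (m * x - b) (t * (Q (k + 1) * x - P (k + 1)))
    calc _ = |(m * x - b) - t * (Q (k + 1) * x - P (k + 1))| := by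
          rw [← hdivmod]
          push_cast
          ring_nf
      _ < 1 / (4 * (Q (k + 1) : ℝ)) + 1 / (4 * Q (k + 1)) := by linarith
      _ = 1 / (2 * Q (k + 1)) := by field_simp; norm_num
  have hr0 : r = 0 := by
    by_contra hne
    exact hrem.not_ge (h.le_abs_of_abs_lt k hne (by rwa [abs_of_nonneg hr]))
  have hb : |((b - t * P (k + 1) : ℤ) : ℝ)| < 1 := by
    rw [hr0, Int.cast_zero, zero_mul, zero_sub, abs_neg] at hrem
    refine hrem.trans_le ((div_le_one (by positivity)).2 ?_)
    linarith [(mod_cast hq : (1 : ℝ) ≤ Q (k + 1))]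
  exact ⟨t, ht, by rw [← hdivmod, hr0, add_zero],
    sub_eq_zero.1 (Int.abs_lt_one_iff.1 (mod_cast hb))⟩

end IsConvergentSeq

/-! ### Multi-indices near a resonant line -/

/-- The arithmetic of the near-resonance `(q, p)` of the line `m x = b`, where `q'` is the next
denominator: the integer points close to the line, except the origin, have first coordinate at
least `q`, and those with first coordinate below `q' / 4` are multiples of `(q, p)`. -/
structure IsLineApprox (x : ℝ) (p q q' : ℤ) : Prop where
  two_le : 2 ≤ q
  eq_zero_or_le : ∀ m b : ℤ, -1 ≤ m → |m * x - b| < 1 / (4 * q) → (m = 0 ∧ b = 0) ∨ q ≤ m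
  exists_eq_mul : ∀ m b : ℤ, 0 ≤ m → 4 * m < q' → |m * x - b| < 1 / (4 * q) →
    ∃ t : ℤ, 0 ≤ t ∧ m = t * q ∧ b = t * p

theorem IsConvergentSeq.isLineApprox {x : ℝ} {P Q : ℕ → ℤ} (h : IsConvergentSeq x P Q) (k : ℕ) :
    IsLineApprox x (P (k + 2)) (Q (k + 2)) (Q (k + 3)) where
  two_le := h.two_le k
  exists_eq_mul m b hm hlt happ := h.exists_eq_mul (k + 1) hm hlt happ
  eq_zero_or_le m b hm happ := by
    have hq := h.cast_pos (k + 2)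
    have hq2 := h.two_le k
    by_cases hm0 : m = 0
    · refine Or.inl ⟨hm0, Int.abs_lt_one_iff.1 ?_⟩
      rw [hm0, Int.cast_zero, zero_mul, zero_sub, abs_neg] at happ
      have hb : |(b : ℝ)| < 1 := by
        refine happ.trans_le ((div_le_one (by positivity)).2 ?_)
        linarith [(mod_cast hq2 : (2 : ℝ) ≤ Q (k + 2))]
      exact_mod_cast hb
    · refine Or.inr (not_lt.1 fun hlt => ?_)
      have hbest := h.le_abs_of_abs_lt (k + 1) (b := b) hm0
        (show |m| < Q (k + 2) by rw [abs_lt]; omega)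
      have hquarter : 1 / (4 * (Q (k + 2) : ℝ)) ≤ 1 / (2 * Q (k + 2)) := by gcongr; norm_num
      exact (happ.trans_le hquarter).not_ge hbest

theorem degree_fin_two (α : Fin 2 →₀ ℕ) : α.degree = α 0 + α 1 := by
  rw [Finsupp.degree_eq_sum, Fin.sum_univ_two]

/-- The coordinates of `α - e_j`. -/
def subSingle (α : Fin 2 →₀ ℕ) (j i : Fin 2) : ℤ := α i - if i = j then 1 else 0

/-- The multi-indices `α` for which some `α - e_j` is within `1 / (16 q)` of the resonant line. -/
def nearLine (x : ℝ) (q : ℤ) : Set (Fin 2 →₀ ℕ) :=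
  {α | 2 ≤ α.degree ∧ ∃ j, |subSingle α j 0 * x - subSingle α j 1| < 1 / (16 * q)}

open Classical in
/-- A point `α - e_j` witnessing that `α` is near the resonant line. -/
noncomputable def nearPoint (x : ℝ) (q : ℤ) (α : Fin 2 →₀ ℕ) : Fin 2 → ℤ :=
  subSingle α (if |subSingle α 0 0 * x - subSingle α 0 1| < 1 / (16 * q) then 0 else 1)

section NearPoint

variable {x : ℝ} {q : ℤ} {α γ : Fin 2 →₀ ℕ}

theorem abs_nearPoint_lt (hα : α ∈ nearLine x q) :
    |nearPoint x q α 0 * x - nearPoint x q α 1| < 1 / (16 * q) := by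
  obtain ⟨-, j, hj⟩ := hα
  unfold nearPoint
  split_ifs with h0
  · exact h0
  · obtain rfl : j = 1 := by
      fin_cases j
      exacts [absurd hj h0, rfl]
    exact hj

theorem nearPoint_le (x : ℝ) (q : ℤ) (α : Fin 2 →₀ ℕ) (i : Fin 2) : nearPoint x q α i ≤ α i := by
  simp only [nearPoint, subSingle]
  split_ifs <;> omega

theorem le_nearPoint_add_one (x : ℝ) (q : ℤ) (α : Fin 2 →₀ ℕ) (i : Fin 2) :
    α i ≤ nearPoint x q α i + 1 := by
  simp only [nearPoint, subSingle]
  split_ifs <;> omega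

theorem nearPoint_add (x : ℝ) (q : ℤ) (α : Fin 2 →₀ ℕ) :
    nearPoint x q α 0 + nearPoint x q α 1 + 1 = α 0 + α 1 := by
  simp only [nearPoint, subSingle]
  split_ifs <;> grind

theorem nearPoint_le_degree (x : ℝ) (q : ℤ) (α : Fin 2 →₀ ℕ) : nearPoint x q α 0 ≤ α.degree := by
  have hle := nearPoint_le x q α 0
  rw [degree_fin_two]
  omega

theorem abs_nearPoint_sub_lt (hα : α ∈ nearLine x q) (hγ : γ ∈ nearLine x q) :
    |((nearPoint x q α 0 - nearPoint x q γ 0 : ℤ) : ℝ) * x -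
      (nearPoint x q α 1 - nearPoint x q γ 1 : ℤ)| < 1 / (16 * q) + 1 / (16 * q) := by
  push_cast
  calc _ = |(nearPoint x q α 0 * x - nearPoint x q α 1) -
        (nearPoint x q γ 0 * x - nearPoint x q γ 1)| := by ring_nf
    _ ≤ |nearPoint x q α 0 * x - nearPoint x q α 1| +
        |nearPoint x q γ 0 * x - nearPoint x q γ 1| := abs_sub _ _
    _ < _ := add_lt_add (abs_nearPoint_lt hα) (abs_nearPoint_lt hγ)

end NearPoint

namespace IsLineApprox

variable {x : ℝ} {p q q' : ℤ} {α γ : Fin 2 →₀ ℕ} {l : Multiset (Fin 2 →₀ ℕ)}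

theorem pos (h : IsLineApprox x p q q') : 0 < q := two_pos.trans_le h.two_le

theorem cast_pos (h : IsLineApprox x p q q') : (0 : ℝ) < q := mod_cast h.pos

theorem exists_eq_mul_of_le (h : IsLineApprox x p q q') {m b : ℤ} (hm : q ≤ m) (hlt : 4 * m < q')
    (happ : |m * x - b| < 1 / (4 * q)) : ∃ t : ℤ, m = t * q ∧ b = t * p := by
  have hq := h.two_le
  obtain ⟨t, -, ht⟩ := h.exists_eq_mul m b (by omega) hlt happ
  exact ⟨t, ht⟩

theorem abs_nearPoint_lt_quarter (h : IsLineApprox x p q q') (hα : α ∈ nearLine x q) :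
    |nearPoint x q α 0 * x - nearPoint x q α 1| < 1 / (4 * q) := by
  have hq := h.cast_pos
  refine (abs_nearPoint_lt hα).trans_le ?_
  gcongr
  norm_num

theorem abs_nearPoint_sub_lt_quarter (h : IsLineApprox x p q q') (hα : α ∈ nearLine x q)
    (hγ : γ ∈ nearLine x q) :
    |((nearPoint x q α 0 - nearPoint x q γ 0 : ℤ) : ℝ) * x -
      (nearPoint x q α 1 - nearPoint x q γ 1 : ℤ)| < 1 / (4 * q) := by
  have hq := h.cast_pos
  refine (abs_nearPoint_sub_lt hα hγ).trans_le ?_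
  rw [← add_div, div_le_div_iff₀ (by positivity) (by positivity)]
  linarith

theorem le_nearPoint (h : IsLineApprox x p q q') (hα : α ∈ nearLine x q) :
    q ≤ nearPoint x q α 0 := by
  have hdeg := hα.1
  rw [degree_fin_two] at hdeg
  have hle := le_nearPoint_add_one x q α 0
  have hadd := nearPoint_add x q α
  refine (h.eq_zero_or_le _ _ (by omega) (h.abs_nearPoint_lt_quarter hα)).resolve_left ?_
  rintro ⟨h0, h1⟩
  omega

theorem le_nearPoint_sub (h : IsLineApprox x p q q') (hα : α ∈ nearLine x q)
    (hγ : γ ∈ nearLine x q) (hle : γ ≤ α) (hne : γ ≠ α) :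
    q ≤ nearPoint x q α 0 - nearPoint x q γ 0 := by
  have hle0 := hle 0
  have hle1 := hle 1
  have hα1 := le_nearPoint_add_one x q α 0
  have hγ1 := nearPoint_le x q γ 0
  have hαadd := nearPoint_add x q α
  have hγadd := nearPoint_add x q γ
  refine (h.eq_zero_or_le _ _ (by omega) (h.abs_nearPoint_sub_lt_quarter hα hγ)).resolve_left ?_
  rintro ⟨h0, h1⟩
  refine hne (Finsupp.ext fun i => ?_)
  fin_cases i
  exacts [by simp only [Fin.zero_eta]; omega, by simp only [Fin.mk_one]; omega]

theorem exists_sum_eq (h : IsLineApprox x p q q')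
    (hl : ∀ γ ∈ l, γ ∈ nearLine x q ∧ 4 * nearPoint x q γ 0 < q') :
    ∃ t n₀ n₁ : ℤ, 0 ≤ n₀ ∧ n₀ + n₁ = l.card ∧
      (l.map (nearPoint x q · 0)).sum = t * q ∧
      (l.sum 0 : ℤ) = t * q + n₀ ∧ (l.sum 1 : ℤ) = t * p + n₁ := by
  induction l using Multiset.induction with
  | empty => exact ⟨0, 0, 0, by simp⟩
  | cons a l ih =>
    obtain ⟨t, n₀, n₁, hn₀, hcard, hsum, hsum0, hsum1⟩ :=
      ih fun γ hγ => hl γ (Multiset.mem_cons_of_mem hγ)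
    obtain ⟨ha, hlt⟩ := hl a (Multiset.mem_cons_self a l)
    obtain ⟨u, hu0, hu1⟩ :=
      h.exists_eq_mul_of_le (h.le_nearPoint ha) hlt (h.abs_nearPoint_lt_quarter ha)
    have hle0 := nearPoint_le x q a 0
    have hle1 := nearPoint_le x q a 1
    have hadd := nearPoint_add x q a
    simp only [Multiset.map_cons, Multiset.sum_cons, Multiset.card_cons, Finsupp.add_apply,
      Nat.cast_add, Nat.cast_one]
    exact ⟨u + t, n₀ + (a 0 - u * q), n₁ + (a 1 - u * p), by omega, by omega,
      by rw [hsum, hu0, add_mul], by rw [hsum0]; ring, by rw [hsum1]; ring⟩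

theorem sum_nearPoint_le (h : IsLineApprox x p q q')
    (hl : ∀ γ ∈ l, γ ∈ nearLine x q ∧ 4 * nearPoint x q γ 0 < q') {t w₀ w₁ : ℤ} (hw : w₀ ≤ 1)
    (hle0 : l.sum 0 ≤ t * q + w₀) (hle1 : l.sum 1 ≤ t * p + w₁) :
    (l.map (nearPoint x q · 0)).sum + q ≤ t * q ∨
      ((l.map (nearPoint x q · 0)).sum = t * q ∧ l.card ≤ w₀ + w₁) := by
  obtain ⟨u, n₀, n₁, hn₀, hcard, hsum, hsum0, hsum1⟩ := h.exists_sum_eq hl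
  have hq := h.two_le
  have hut : u ≤ t := by
    by_contra! hlt
    nlinarith
  rcases hut.lt_or_eq with hlt | rfl
  · left
    nlinarith
  · right
    exact ⟨hsum, by linarith⟩

end IsLineApprox

theorem le_of_sum_le {l : Multiset (Fin 2 →₀ ℕ)} {α γ : Fin 2 →₀ ℕ} (hle : l.sum ≤ α)
    (hγ : γ ∈ l) : γ ≤ α :=
  (Multiset.single_le_sum (fun _ _ => zero_le) _ hγ).trans hle

theorem sum_nearPoint_le_apply (x : ℝ) (q : ℤ) (l : Multiset (Fin 2 →₀ ℕ)) :
    (l.map (nearPoint x q · 0)).sum ≤ l.sum 0 := by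
  induction l using Multiset.induction with
  | empty => simp
  | cons a l ih =>
    have hle := nearPoint_le x q a 0
    rw [Multiset.map_cons, Multiset.sum_cons, Multiset.sum_cons, Finsupp.add_apply, Nat.cast_add]
    omega

namespace IsLineApprox

variable {x : ℝ} {p q q' : ℤ} {α γ : Fin 2 →₀ ℕ} {l : Multiset (Fin 2 →₀ ℕ)}

theorem sum_nearPoint_add_le (h : IsLineApprox x p q q') (hα : α ∈ nearLine x q)
    (hsmall : 4 * nearPoint x q α 0 < q') (hl : ∀ γ ∈ l, γ ∈ nearLine x q ∧ γ ≠ α)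
    (hle : l.sum ≤ α) : (l.map (nearPoint x q · 0)).sum + q ≤ nearPoint x q α 0 := by
  have hq := h.pos
  have hle0 := hle 0
  have hle1 := hle 1
  have hgap : ∀ γ ∈ l, q ≤ nearPoint x q α 0 - nearPoint x q γ 0 := fun γ hγ =>
    h.le_nearPoint_sub hα (hl γ hγ).1 (le_of_sum_le hle hγ) (hl γ hγ).2
  have hlsmall : ∀ γ ∈ l, γ ∈ nearLine x q ∧ 4 * nearPoint x q γ 0 < q' := fun γ hγ =>
    ⟨(hl γ hγ).1, by linarith [hgap γ hγ]⟩
  obtain ⟨t, ht0, ht1⟩ :=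
    h.exists_eq_mul_of_le (h.le_nearPoint hα) hsmall (h.abs_nearPoint_lt_quarter hα)
  have hα1 := le_nearPoint_add_one x q α 0
  have hadd := nearPoint_add x q α
  rcases h.sum_nearPoint_le hlsmall (t := t) (w₀ := α 0 - t * q) (w₁ := α 1 - t * p)
    (by omega) (by omega) (by omega) with hsum | ⟨hsum, hcard⟩
  · rwa [ht0]
  · rcases Nat.le_one_iff_eq_zero_or_eq_one.1 (by omega : l.card ≤ 1) with h0 | h1
    · rw [Multiset.card_eq_zero.1 h0, Multiset.map_zero, Multiset.sum_zero, zero_add]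
      exact h.le_nearPoint hα
    · obtain ⟨γ, rfl⟩ := Multiset.card_eq_one.1 h1
      rw [Multiset.map_singleton, Multiset.sum_singleton]
      linarith [hgap γ (Multiset.mem_singleton_self γ)]

theorem sum_nearPoint_add_le_sub (h : IsLineApprox x p q q') (hα : α ∈ nearLine x q)
    (hγ : γ ∈ nearLine x q) (hne : γ ≠ α)
    (hsmall : 4 * (nearPoint x q α 0 - nearPoint x q γ 0) < q')
    (hl : ∀ β ∈ l, β ∈ nearLine x q ∧ 4 * nearPoint x q β 0 < q') (hle : γ + l.sum ≤ α) :
    (l.map (nearPoint x q · 0)).sum + q ≤ nearPoint x q α 0 - nearPoint x q γ 0 := by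
  have hle0 := hle 0
  have hle1 := hle 1
  rw [Finsupp.add_apply] at hle0 hle1
  have hgap := h.le_nearPoint_sub hα hγ (le_self_add.trans hle) hne
  obtain ⟨t, ht0, ht1⟩ :=
    h.exists_eq_mul_of_le hgap hsmall (h.abs_nearPoint_sub_lt_quarter hα hγ)
  have hα1 := le_nearPoint_add_one x q α 0
  have hγ1 := nearPoint_le x q γ 0
  have hαadd := nearPoint_add x q α
  have hγadd := nearPoint_add x q γ
  rcases h.sum_nearPoint_le hl (t := t) (w₀ := α 0 - γ 0 - t * q) (w₁ := α 1 - γ 1 - t * p)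
    (by omega) (by omega) (by omega) with hsum | ⟨-, hcard⟩
  · rwa [ht0]
  · rw [Multiset.card_eq_zero.1 (by omega : l.card = 0), Multiset.map_zero, Multiset.sum_zero,
      zero_add]
    exact hgap

end IsLineApprox

/-- The relative surcharge, in `lineValue`, for multi-indices that are far out on the resonant
line. -/
noncomputable def excess (q q' : ℤ) : ℝ := 6 * q / max (q : ℝ) (q' / 4)

/-- The value of a multi-index near the resonant line in the packing estimate: the number of
multiples of `(q, p)` below it as long as these exhaust the near-resonances, and a superadditive
correction of this number from `q' / 4` on, where further near-resonances appear. -/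
noncomputable def lineValue (x : ℝ) (q q' : ℤ) (γ : Fin 2 →₀ ℕ) : ℝ :=
  if 4 * nearPoint x q γ 0 < q' then (nearPoint x q γ 0 : ℝ) / q
  else (1 + excess q q') * (nearPoint x q γ 0 / q) - ((1 + excess q q') / 2 + 1)

section LineValue

variable {x : ℝ} {q q' : ℤ} {γ : Fin 2 →₀ ℕ}

theorem max_div_four_pos (hq : 0 < q) : (0 : ℝ) < max (q : ℝ) (q' / 4) :=
  lt_max_of_lt_left (mod_cast hq)

theorem excess_nonneg (hq : 0 < q) : 0 ≤ excess q q' := by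
  have hq' : (0 : ℝ) ≤ 6 * q := mod_cast (by omega : 0 ≤ 6 * q)
  exact div_nonneg hq' (max_div_four_pos hq).le

theorem excess_le (hq : 0 < q) : excess q q' ≤ 6 := by
  rw [excess, div_le_iff₀ (max_div_four_pos hq)]
  gcongr
  exact le_max_left _ _

theorem excess_mul_div (hq : 0 < q) (y : ℝ) :
    excess q q' * (y / q) = 6 * y / max (q : ℝ) (q' / 4) := by
  have hq' : (q : ℝ) ≠ 0 := mod_cast hq.ne'
  rw [excess]
  field_simp

theorem excess_div_le (hq : 0 < q) (hq' : 0 < q') : excess q q' / q ≤ 24 / q' := by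
  have hmul := excess_mul_div (q' := q') hq 1
  rw [mul_one_div, mul_one] at hmul
  rw [hmul, div_le_div_iff₀ (max_div_four_pos hq) (mod_cast hq')]
  linarith [le_max_right (q : ℝ) (q' / 4)]

theorem six_le_excess_mul {m : ℤ} (hq : 0 < q) (hm : q ≤ m) (hm' : q' ≤ 4 * m) :
    6 ≤ excess q q' * (m / q) := by
  have hm_cast : (q : ℝ) ≤ m := mod_cast hm
  have hm'_cast : (q' : ℝ) ≤ 4 * m := mod_cast hm'
  rw [excess_mul_div hq, le_div_iff₀ (max_div_four_pos hq)]
  gcongr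
  exact max_le hm_cast (by linarith)

theorem lineValue_le_mul (hq : 0 < q) (hγ : 0 ≤ nearPoint x q γ 0) :
    lineValue x q q' γ ≤ (1 + excess q q') * (nearPoint x q γ 0 / q) := by
  have hexc := excess_nonneg (q' := q') hq
  unfold lineValue
  split_ifs
  · refine le_mul_of_one_le_left ?_ (by linarith)
    exact div_nonneg (mod_cast hγ) (mod_cast hq.le)
  · linarith

theorem lineValue_le_mul_degree (hq : 0 < q) (hγ : 0 ≤ nearPoint x q γ 0) :
    lineValue x q q' γ ≤ (1 + excess q q') / q * γ.degree := by
  have hexc := excess_nonneg (q' := q') hq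
  have hdeg : (nearPoint x q γ 0 : ℝ) ≤ γ.degree := mod_cast nearPoint_le_degree x q γ
  rw [div_mul_eq_mul_div, ← mul_div_assoc']
  refine (lineValue_le_mul hq hγ).trans ?_
  gcongr

theorem sum_lineValue_le_mul (hq : 0 < q) {l : Multiset (Fin 2 →₀ ℕ)}
    (hl : ∀ γ ∈ l, 0 ≤ nearPoint x q γ 0) :
    (l.map (lineValue x q q')).sum ≤
      (1 + excess q q') * ((l.map (nearPoint x q · 0)).sum / q) := by
  induction l using Multiset.induction with
  | empty => simp
  | cons a l ih =>
    simp only [Multiset.map_cons, Multiset.sum_cons, Int.cast_add, add_div, mul_add]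
    exact add_le_add (lineValue_le_mul hq (hl a (Multiset.mem_cons_self a l)))
      (ih fun γ hγ => hl γ (Multiset.mem_cons_of_mem hγ))

theorem sum_lineValue_of_small {l : Multiset (Fin 2 →₀ ℕ)}
    (hl : ∀ γ ∈ l, 4 * nearPoint x q γ 0 < q') :
    (l.map (lineValue x q q')).sum = ((l.map (nearPoint x q · 0)).sum : ℝ) / q := by
  induction l using Multiset.induction with
  | empty => simp
  | cons a l ih =>
    simp only [Multiset.map_cons, Multiset.sum_cons, Int.cast_add, add_div]
    rw [ih fun γ hγ => hl γ (Multiset.mem_cons_of_mem hγ), lineValue,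
      if_pos (hl a (Multiset.mem_cons_self a l))]

end LineValue

namespace IsLineApprox

variable {x : ℝ} {p q q' : ℤ} {α β γ : Fin 2 →₀ ℕ} {l : Multiset (Fin 2 →₀ ℕ)}

theorem nearPoint_nonneg (h : IsLineApprox x p q q') (hα : α ∈ nearLine x q) :
    0 ≤ nearPoint x q α 0 :=
  h.pos.le.trans (h.le_nearPoint hα)

theorem one_div_le_half (h : IsLineApprox x p q q') : 1 / (q : ℝ) ≤ 1 / 2 := by
  have hq : (2 : ℝ) ≤ q := mod_cast h.two_le
  gcongr

theorem sum_nearPoint_div_le (h : IsLineApprox x p q q') (hle : l.sum ≤ α) :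
    ((l.map (nearPoint x q · 0)).sum : ℝ) / q ≤ nearPoint x q α 0 / q + 1 / 2 := by
  have hq := h.cast_pos
  have hle0 : (l.sum 0 : ℤ) ≤ α 0 := mod_cast hle 0
  have hsum : ((l.map (nearPoint x q · 0)).sum : ℝ) ≤ nearPoint x q α 0 + 1 :=
    mod_cast (sum_nearPoint_le_apply x q l).trans (hle0.trans (le_nearPoint_add_one x q α 0))
  calc ((l.map (nearPoint x q · 0)).sum : ℝ) / q ≤ (nearPoint x q α 0 + 1) / q := by gcongr
    _ ≤ nearPoint x q α 0 / q + 1 / 2 := by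
      rw [add_div]
      linarith [h.one_div_le_half]

theorem lineValue_packing_of_small (h : IsLineApprox x p q q') (hα : α ∈ nearLine x q)
    (hsmall : 4 * nearPoint x q α 0 < q') (hl : ∀ γ ∈ l, γ ∈ nearLine x q ∧ γ ≠ α)
    (hle : l.sum ≤ α) : (l.map (lineValue x q q')).sum + 1 ≤ lineValue x q q' α := by
  have hq := h.cast_pos
  have hlsmall : ∀ γ ∈ l, 4 * nearPoint x q γ 0 < q' := fun γ hγ => by
    linarith [h.pos, h.le_nearPoint_sub hα (hl γ hγ).1 (le_of_sum_le hle hγ) (hl γ hγ).2]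
  have hsum : ((l.map (nearPoint x q · 0)).sum : ℝ) + q ≤ nearPoint x q α 0 :=
    mod_cast h.sum_nearPoint_add_le hα hsmall hl hle
  rw [sum_lineValue_of_small hlsmall, lineValue, if_pos hsmall, div_add_one hq.ne']
  gcongr

theorem lineValue_packing_of_forall_small (h : IsLineApprox x p q q') (hα : α ∈ nearLine x q)
    (hbig : q' ≤ 4 * nearPoint x q α 0) (hl : ∀ γ ∈ l, 4 * nearPoint x q γ 0 < q')
    (hle : l.sum ≤ α) : (l.map (lineValue x q q')).sum + 1 ≤ lineValue x q q' α := by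
  have hsix := six_le_excess_mul h.pos (h.le_nearPoint hα) hbig
  rw [sum_lineValue_of_small hl, lineValue, if_neg hbig.not_gt, add_mul, one_mul]
  linarith [h.sum_nearPoint_div_le hle, excess_le (q' := q') h.pos]

theorem sum_nearPoint_div_add_one_le (h : IsLineApprox x p q q') (hα : α ∈ nearLine x q)
    (hγ : γ ∈ nearLine x q) (hne : γ ≠ α)
    (hl : ∀ β ∈ l, β ∈ nearLine x q ∧ 4 * nearPoint x q β 0 < q') (hle : γ + l.sum ≤ α) :
    ((l.map (nearPoint x q · 0)).sum : ℝ) / q + 1 ≤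
      (1 + excess q q') * ((nearPoint x q α 0 - nearPoint x q γ 0 : ℤ) / q) := by
  have hq := h.cast_pos
  have hgap := h.le_nearPoint_sub hα hγ (le_self_add.trans hle) hne
  rw [add_mul, one_mul]
  rcases lt_or_ge (4 * (nearPoint x q α 0 - nearPoint x q γ 0)) q' with hsmall | hbig
  · have hsum : ((l.map (nearPoint x q · 0)).sum : ℝ) + q ≤
        (nearPoint x q α 0 - nearPoint x q γ 0 : ℤ) :=
      mod_cast h.sum_nearPoint_add_le_sub hα hγ hne hsmall hl hle
    have hexc : 0 ≤ excess q q' * ((nearPoint x q α 0 - nearPoint x q γ 0 : ℤ) / q) :=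
      mul_nonneg (excess_nonneg h.pos) (div_nonneg (mod_cast h.pos.le.trans hgap) hq.le)
    refine le_add_of_le_of_nonneg ?_ hexc
    rw [div_add_one hq.ne']
    gcongr
  · have hsix := six_le_excess_mul h.pos hgap hbig
    have hsum : ((l.map (nearPoint x q · 0)).sum : ℝ) ≤
        (nearPoint x q α 0 - nearPoint x q γ 0 : ℤ) + 1 := by
      have hle0 := hle 0
      rw [Finsupp.add_apply] at hle0
      have hlsum := sum_nearPoint_le_apply x q l
      have hα1 := le_nearPoint_add_one x q α 0
      have hγ1 := nearPoint_le x q γ 0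
      exact_mod_cast (by omega : (l.map (nearPoint x q · 0)).sum ≤
        nearPoint x q α 0 - nearPoint x q γ 0 + 1)
    have hdiv : ((l.map (nearPoint x q · 0)).sum : ℝ) / q ≤
        (nearPoint x q α 0 - nearPoint x q γ 0 : ℤ) / q + 1 / q := by
      rw [← add_div]
      gcongr
    linarith [h.one_div_le_half]

theorem lineValue_packing_cons (h : IsLineApprox x p q q') (hα : α ∈ nearLine x q)
    (hγ : γ ∈ nearLine x q) (hne : γ ≠ α) (hγbig : q' ≤ 4 * nearPoint x q γ 0)
    (hl : ∀ β ∈ l, β ∈ nearLine x q ∧ 4 * nearPoint x q β 0 < q') (hle : γ + l.sum ≤ α) :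
    ((γ ::ₘ l).map (lineValue x q q')).sum + 1 ≤ lineValue x q q' α := by
  have hgap := h.le_nearPoint_sub hα hγ (le_self_add.trans hle) hne
  have hbig : q' ≤ 4 * nearPoint x q α 0 := by linarith [h.pos]
  have hsum := h.sum_nearPoint_div_add_one_le hα hγ hne hl hle
  rw [Int.cast_sub, sub_div, mul_sub] at hsum
  rw [Multiset.map_cons, Multiset.sum_cons, sum_lineValue_of_small fun β hβ => (hl β hβ).2,
    lineValue, if_neg hγbig.not_gt, lineValue, if_neg hbig.not_gt]
  linarith

theorem lineValue_packing_cons_cons (h : IsLineApprox x p q q')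
    (hbig : q' ≤ 4 * nearPoint x q α 0) (hγbig : q' ≤ 4 * nearPoint x q γ 0)
    (hβbig : q' ≤ 4 * nearPoint x q β 0) (hl : ∀ δ ∈ l, δ ∈ nearLine x q)
    (hle : (γ ::ₘ β ::ₘ l).sum ≤ α) :
    ((γ ::ₘ β ::ₘ l).map (lineValue x q q')).sum + 1 ≤ lineValue x q q' α := by
  have hexc := excess_nonneg (q' := q') h.pos
  have hvalue := sum_lineValue_le_mul (q' := q') h.pos fun δ hδ => h.nearPoint_nonneg (hl δ hδ)
  have hsum : (1 + excess q q') * (((γ ::ₘ β ::ₘ l).map (nearPoint x q · 0)).sum / q) ≤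
      (1 + excess q q') * (nearPoint x q α 0 / q + 1 / 2) := by
    gcongr
    exact h.sum_nearPoint_div_le hle
  simp only [Multiset.map_cons, Multiset.sum_cons, Int.cast_add, add_div, mul_add] at hsum ⊢
  rw [lineValue, if_neg hγbig.not_gt, lineValue, if_neg hβbig.not_gt, lineValue,
    if_neg hbig.not_gt]
  linarith

theorem hasPackingGap (h : IsLineApprox x p q q') :
    HasPackingGap (nearLine x q) ((1 + excess q q') / q) (lineValue x q q') where
  nonneg := div_nonneg (by linarith [excess_nonneg (q' := q') h.pos]) h.cast_pos.le
  le_mul_degree _ hγ := lineValue_le_mul_degree h.pos (h.nearPoint_nonneg hγ)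
  sum_add_one_le α hα l hl hle := by
    rcases lt_or_ge (4 * nearPoint x q α 0) q' with hsmall | hbig
    · exact h.lineValue_packing_of_small hα hsmall hl hle
    by_cases hall : ∀ γ ∈ l, 4 * nearPoint x q γ 0 < q'
    · exact h.lineValue_packing_of_forall_small hα hbig hall hle
    push Not at hall
    obtain ⟨γ, hγ, hγbig⟩ := hall
    obtain ⟨l, rfl⟩ := Multiset.exists_cons_of_mem hγ
    have hl' : ∀ β ∈ l, β ∈ nearLine x q := fun β hβ => (hl β (Multiset.mem_cons_of_mem hβ)).1
    by_cases hall' : ∀ β ∈ l, 4 * nearPoint x q β 0 < q'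
    · exact h.lineValue_packing_cons hα (hl γ hγ).1 (hl γ hγ).2 hγbig
        (fun β hβ => ⟨hl' β hβ, hall' β hβ⟩) (by rwa [← Multiset.sum_cons])
    push Not at hall'
    obtain ⟨β, hβ, hβbig⟩ := hall'
    obtain ⟨l, rfl⟩ := Multiset.exists_cons_of_mem hβ
    exact h.lineValue_packing_cons_cons hbig hγbig hβbig
      (fun δ hδ => hl' δ (Multiset.mem_cons_of_mem hδ)) hle

end IsLineApprox

theorem log_div_le_two_div_sqrt {y : ℝ} (hy : 0 < y) : Real.log y / y ≤ 2 / √y := by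
  have hsqrt : 0 < √y := Real.sqrt_pos.2 hy
  have hlog : Real.log y = 2 * Real.log √y := by
    rw [Real.log_sqrt hy.le, mul_div_cancel₀ _ two_ne_zero]
  rw [div_le_div_iff₀ hy hsqrt, hlog]
  calc 2 * Real.log √y * √y ≤ 2 * √y * √y := by
        gcongr
        exact Real.log_le_self hsqrt.le
    _ = 2 * y := by rw [mul_assoc, Real.mul_self_sqrt hy.le]

namespace IsConvergentSeq

variable {x : ℝ} {P Q : ℕ → ℤ}

theorem one_le_cast (h : IsConvergentSeq x P Q) (k : ℕ) : (1 : ℝ) ≤ Q k :=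
  mod_cast h.one_le k

theorem log_nonneg (h : IsConvergentSeq x P Q) (k : ℕ) : 0 ≤ Real.log (Q k) :=
  Real.log_nonneg (h.one_le_cast k)

theorem le_add_one (h : IsConvergentSeq x P Q) (k : ℕ) : k ≤ Q k + 1 := by
  induction k using Nat.twoStepInduction with
  | zero =>
    have hone := h.one_le 0
    push_cast
    omega
  | one =>
    have hone := h.one_le 1
    push_cast
    omega
  | more k _ ih =>
    have hadd := h.add_le k
    have hone := h.one_le k
    push_cast at ih ⊢
    omega

theorem finite_setOf_le (h : IsConvergentSeq x P Q) (hQ : ∀ k, convDenom x k = Q k) (N : ℕ) :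
    {k : ℕ | convDenom x k ≤ N}.Finite := by
  refine (Set.finite_Iic (N + 1)).subset fun k hk => ?_
  have hle : Q k ≤ N := by
    rw [Set.mem_ofPred_eq, hQ] at hk
    exact_mod_cast hk
  have hk1 := h.le_add_one k
  rw [Set.mem_Iic]
  omega

theorem inv_sqrt_add_two_le (h : IsConvergentSeq x P Q) (k : ℕ) :
    (√(Q (k + 2) : ℝ))⁻¹ ≤ 81 / 100 * (√(Q k : ℝ))⁻¹ := by
  have hq := h.cast_pos k
  have htwo : (2 : ℝ) * Q k ≤ Q (k + 2) :=
    mod_cast (by linarith [h.add_le k, h.mono k] : 2 * Q k ≤ Q (k + 2))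
  have hsqrt : 100 / 81 * √(Q k : ℝ) ≤ √(Q (k + 2) : ℝ) := by
    refine Real.le_sqrt_of_sq_le ?_
    rw [mul_pow, Real.sq_sqrt hq.le]
    linarith
  calc (√(Q (k + 2) : ℝ))⁻¹ ≤ (100 / 81 * √(Q k : ℝ))⁻¹ := by gcongr
    _ = 81 / 100 * (√(Q k : ℝ))⁻¹ := by rw [mul_inv, inv_div]

theorem inv_sqrt_le (h : IsConvergentSeq x P Q) (k : ℕ) :
    (√(Q k : ℝ))⁻¹ ≤ 2 * (9 / 10) ^ k := by
  have hone : ∀ j, (√(Q j : ℝ))⁻¹ ≤ 1 := fun j =>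
    inv_le_one_of_one_le₀ (Real.one_le_sqrt.2 (h.one_le_cast j))
  induction k using Nat.twoStepInduction with
  | zero => linarith [hone 0]
  | one => linarith [hone 1]
  | more k ih _ =>
    refine (h.inv_sqrt_add_two_le k).trans ?_
    rw [pow_add]
    linarith

theorem sum_log_div_le (h : IsConvergentSeq x P Q) (m : ℕ) :
    ∑ k ∈ Finset.range m, Real.log (Q k) / Q k ≤ 40 := by
  have hgeom : ∑ k ∈ Finset.range m, (9 / 10 : ℝ) ^ k ≤ 10 := by
    rw [geom_sum_eq (by norm_num), div_le_iff_of_neg (by norm_num)]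
    linarith [pow_nonneg (by norm_num : (0 : ℝ) ≤ 9 / 10) m]
  have hterm : ∀ k ∈ Finset.range m, Real.log (Q k) / Q k ≤ 4 * (9 / 10 : ℝ) ^ k := fun k _ => by
    have hlog := log_div_le_two_div_sqrt (h.cast_pos k)
    rw [div_eq_mul_inv 2] at hlog
    linarith [h.inv_sqrt_le k]
  calc ∑ k ∈ Finset.range m, Real.log (Q k) / Q k
      ≤ ∑ k ∈ Finset.range m, 4 * (9 / 10 : ℝ) ^ k := Finset.sum_le_sum hterm
    _ = 4 * ∑ k ∈ Finset.range m, (9 / 10 : ℝ) ^ k := by rw [Finset.mul_sum]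
    _ ≤ 40 := by linarith

end IsConvergentSeq

theorem abs_divisor_eq {ω : Fin 2 → ℝ} (hω : ω 1 ≠ 0) (α : Fin 2 →₀ ℕ) (j : Fin 2) :
    |divisor ω α j| = |ω 1| * |subSingle α j 0 * (-ω 0 / ω 1) - subSingle α j 1| := by
  rw [← abs_mul, ← abs_neg]
  congr 1
  simp only [divisor, Fin.sum_univ_two, subSingle]
  fin_cases j <;> simp <;> field_simp <;> ring

section BrunoSContFract

variable {ω : Fin 2 → ℝ} {P Q : ℕ → ℤ}

theorem NonResonant.log_invDivisor_le_of_notMem_nearLine (hω : NonResonant ω) {q : ℤ} (hq : 0 < q)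
    {α : Fin 2 →₀ ℕ} (hα : 2 ≤ α.degree) (hmem : α ∉ nearLine (-ω 0 / ω 1) q) :
    Real.log (invDivisor ω α) ≤ |Real.log (|ω 1| / 16)| + Real.log q := by
  have hq' : (0 : ℝ) < q := mod_cast hq
  have hω1 : 0 < |ω 1| := abs_pos.2 (hω.ne_zero 1)
  have hexp : Real.exp (-|Real.log (|ω 1| / 16)|) ≤ |ω 1| / 16 := by
    rw [← Real.le_log_iff_exp_le (by positivity)]
    exact neg_abs_le _
  simp only [nearLine, Set.mem_ofPred_eq, not_and, not_exists, not_lt] at hmem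
  refine hω.log_invDivisor_le hα fun j => ?_
  rw [abs_divisor_eq (hω.ne_zero 1), neg_add, Real.exp_add, Real.exp_neg (Real.log q),
    Real.exp_log hq']
  calc Real.exp (-|Real.log (|ω 1| / 16)|) * (q : ℝ)⁻¹ ≤ |ω 1| / 16 * (q : ℝ)⁻¹ := by gcongr
    _ = |ω 1| * (1 / (16 * q)) := by field_simp
    _ ≤ |ω 1| * |subSingle α j 0 * (-ω 0 / ω 1) - subSingle α j 1| := by
      gcongr
      exact hmem hα j

/-- The scales start at `Q 2`, the first denominator that is certainly greater than `1`. -/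
theorem IsConvergentSeq.isScaleDecomposition (h : IsConvergentSeq (-ω 0 / ω 1) P Q)
    (hQ : ∀ k, convDenom (-ω 0 / ω 1) k = Q k) (hω : NonResonant ω) :
    IsScaleDecomposition (invDivisor ω) (fun k => nearLine (-ω 0 / ω 1) (Q (k + 2)))
      |Real.log (|ω 1| / 16)| (fun k => Real.log (Q (k + 2)))
      (fun N => lastIndex (convDenom (-ω 0 / ω 1)) N - 1) where
  const_nonneg := abs_nonneg _
  level_nonneg k := h.log_nonneg (k + 2)
  mono _ _ hN := Nat.sub_le_sub_right (lastIndex_mono (h.finite_setOf_le hQ) hN) 1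
  lt_degree N k hk γ hγ := by
    by_contra! hlt
    have hQN : Q (k + 2) ≤ N := ((h.isLineApprox k).le_nearPoint hγ).trans
      ((nearPoint_le_degree _ _ γ).trans (Nat.cast_le.2 hlt))
    have hle : convDenom (-ω 0 / ω 1) (k + 2) ≤ N := by
      rw [hQ]
      exact_mod_cast hQN
    have hidx := le_lastIndex (h.finite_setOf_le hQ N) hle
    omega
  log_le k _ hα hmem :=
    hω.log_invDivisor_le_of_notMem_nearLine (h.isLineApprox k).pos hα hmem

theorem IsConvergentSeq.log_mul_excess_le {x : ℝ} (h : IsConvergentSeq x P Q) (k : ℕ) :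
    Real.log (Q (k + 1)) * ((1 + excess (Q k) (Q (k + 1))) / Q k) ≤
      Real.log (Q (k + 1)) / Q k + 24 * (Real.log (Q (k + 1)) / Q (k + 1)) := by
  have hexc := mul_le_mul_of_nonneg_left
    (excess_div_le (one_pos.trans_le (h.one_le k)) (one_pos.trans_le (h.one_le (k + 1))))
    (h.log_nonneg (k + 1))
  calc _ = Real.log (Q (k + 1)) / Q k +
        Real.log (Q (k + 1)) * (excess (Q k) (Q (k + 1)) / Q k) := by ring
    _ ≤ Real.log (Q (k + 1)) / Q k + Real.log (Q (k + 1)) * (24 / Q (k + 1)) := by gcongr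
    _ = _ := by ring

theorem sum_range_add_le_sum_range {a : ℕ → ℝ} (ha : ∀ k, 0 ≤ a k) {m i N : ℕ}
    (hN : m = 0 ∨ m + i ≤ N) :
    ∑ k ∈ Finset.range m, a (k + i) ≤ ∑ k ∈ Finset.range N, a k := by
  rcases hN with rfl | hN
  · simpa only [Finset.range_zero, Finset.sum_empty] using Finset.sum_nonneg fun k _ => ha k
  · calc ∑ k ∈ Finset.range m, a (k + i) ≤ ∑ k ∈ Finset.range (m + i), a k := by
          rw [add_comm m i, Finset.sum_range_add]
          simp only [add_comm _ i]
          exact le_add_of_nonneg_left (Finset.sum_nonneg fun k _ => ha k)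
      _ ≤ ∑ k ∈ Finset.range N, a k :=
        Finset.sum_le_sum_of_subset_of_nonneg (Finset.range_subset_range.2 hN) fun k _ _ => ha k

theorem BrunoSContFract.exists_sum_le {x s : ℝ} (hs : 0 ≤ s) (hx : BrunoSContFract x s)
    (h : IsConvergentSeq x P Q) (hQ : ∀ k, convDenom x k = Q k) :
    ∃ C : ℝ, ∀ N : ℕ,
      ∑ k ∈ Finset.range (lastIndex (convDenom x) N + 1), Real.log (Q (k + 1)) / Q k ≤
        s * Real.log N + C := by
  obtain ⟨C, hC⟩ := exists_eventually_le_of_limsup_lt_top hx.2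
  simp only [hQ] at hC
  exact exists_forall_sum_le_of_eventually hs (h.finite_setOf_le hQ)
    (fun k => div_nonneg (h.log_nonneg (k + 1)) (h.cast_pos k).le)
    (hC.mono fun N hN => sub_le_iff_le_add'.1 hN)

theorem BrunoSContFract.exists_isGevreyWeight {s : ℝ} (hs : 0 ≤ s) (hω : NonResonant ω)
    (hx : BrunoSContFract (-ω 0 / ω 1) s) : ∃ M, IsGevreyWeight (invDivisor ω) s M := by
  obtain ⟨P, Q, h, hQ⟩ := exists_isConvergentSeq hx.1
  obtain ⟨C, hC⟩ := hx.exists_sum_le hs h hQ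
  refine (h.isScaleDecomposition hQ hω).exists_isGevreyWeight (C := C + 24 * 40)
    (fun k => (h.isLineApprox k).hasPackingGap.isCountingFunction) fun N _ => ?_
  have hquot : ∀ k, 0 ≤ Real.log (Q (k + 1)) / Q k := fun k =>
    div_nonneg (h.log_nonneg (k + 1)) (h.cast_pos k).le
  have hself : ∀ k, 0 ≤ Real.log (Q k) / Q k := fun k =>
    div_nonneg (h.log_nonneg k) (h.cast_pos k).le
  set m := lastIndex (convDenom (-ω 0 / ω 1)) N - 1
  calc ∑ k ∈ Finset.range m,
        Real.log (Q (k + 3)) * ((1 + excess (Q (k + 2)) (Q (k + 3))) / Q (k + 2))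
      ≤ ∑ k ∈ Finset.range m, (Real.log (Q (k + 2 + 1)) / Q (k + 2) +
          24 * (Real.log (Q (k + 3)) / Q (k + 3))) :=
        Finset.sum_le_sum fun k _ => h.log_mul_excess_le (k + 2)
    _ = ∑ k ∈ Finset.range m, Real.log (Q (k + 2 + 1)) / Q (k + 2) +
          24 * ∑ k ∈ Finset.range m, Real.log (Q (k + 3)) / Q (k + 3) := by
        rw [Finset.sum_add_distrib, Finset.mul_sum]
    _ ≤ (s * Real.log N + C) + 24 * 40 := by
        gcongr
        · exact (sum_range_add_le_sum_range hquot (by omega)).trans (hC N)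
        · exact (sum_range_add_le_sum_range hself (Or.inr le_rfl)).trans (h.sum_log_div_le (m + 3))
    _ = s * Real.log N + (C + 24 * 40) := by ring

end BrunoSContFract

/-! ### Weighted norms of polynomials -/

section WeightedNorm

open MvPolynomial

variable {σ R : Type*}

/-- The `ℓ¹` norm of the coefficients of a polynomial with weight `w`. -/
noncomputable def weightedNorm [SeminormedCommRing R] (w : (σ →₀ ℕ) → ℝ)
    (p : MvPolynomial σ R) : ℝ :=
  ∑ α ∈ p.support, ‖coeff α p‖ * w α

/-- The diagonal operator that multiplies the coefficient of the monomial `α` by `d α`. -/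
noncomputable def coeffMultiplier [CommSemiring R] (d : (σ →₀ ℕ) → R) :
    MvPolynomial σ R →ₗ[R] MvPolynomial σ R :=
  (basisMonomials σ R).constr R fun α => monomial α (d α)

@[simp]
theorem coeffMultiplier_monomial [CommSemiring R] (d : (σ →₀ ℕ) → R) (α : σ →₀ ℕ) (a : R) :
    coeffMultiplier d (monomial α a) = monomial α (d α * a) := by
  have hmon : monomial α a = a • basisMonomials σ R α := by
    rw [coe_basisMonomials, smul_monomial, smul_eq_mul, mul_one]
  rw [hmon, map_smul, coeffMultiplier, Module.Basis.constr_basis, smul_monomial, smul_eq_mul,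
    mul_comm]

@[simp]
theorem coeff_coeffMultiplier [CommSemiring R] (d : (σ →₀ ℕ) → R) (p : MvPolynomial σ R)
    (α : σ →₀ ℕ) : coeff α (coeffMultiplier d p) = d α * coeff α p := by
  classical
  induction p using MvPolynomial.monomial_add_induction_on with
  | C a =>
    rw [← monomial_zero', coeffMultiplier_monomial, coeff_monomial, coeff_monomial]
    split_ifs with h <;> simp [h]
  | monomial_add β b p _ _ ih =>
    rw [map_add, coeffMultiplier_monomial, coeff_add, coeff_add, coeff_monomial, coeff_monomial,
      ih, mul_add]
    split_ifs with h <;> simp [h]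

variable [SeminormedCommRing R] {w w' : (σ →₀ ℕ) → ℝ} {p q : MvPolynomial σ R} {y : ℝ}

theorem weightedNorm_eq_sum {s : Finset (σ →₀ ℕ)} (h : p.support ⊆ s) :
    weightedNorm w p = ∑ α ∈ s, ‖coeff α p‖ * w α := by
  refine Finset.sum_subset h fun α _ hα => ?_
  rw [notMem_support_iff.1 hα, norm_zero, zero_mul]

theorem weightedNorm_nonneg (hw : ∀ α, 0 ≤ w α) (p : MvPolynomial σ R) : 0 ≤ weightedNorm w p :=
  Finset.sum_nonneg fun α _ => mul_nonneg (norm_nonneg _) (hw α)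

theorem weightedNorm_add_le (hw : ∀ α, 0 ≤ w α) (p q : MvPolynomial σ R) :
    weightedNorm w (p + q) ≤ weightedNorm w p + weightedNorm w q := by
  classical
  rw [weightedNorm_eq_sum (support_add (p := p) (q := q)),
    weightedNorm_eq_sum (p := p) Finset.subset_union_left,
    weightedNorm_eq_sum (p := q) Finset.subset_union_right, ← Finset.sum_add_distrib]
  refine Finset.sum_le_sum fun α _ => ?_
  rw [← add_mul, coeff_add]
  exact mul_le_mul_of_nonneg_right (norm_add_le _ _) (hw α)

theorem weightedNorm_sum_le (hw : ∀ α, 0 ≤ w α) {ι : Type*} (s : Finset ι)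
    (p : ι → MvPolynomial σ R) : weightedNorm w (∑ i ∈ s, p i) ≤ ∑ i ∈ s, weightedNorm w (p i) :=
  s.le_sum_of_subadditive _ (by simp [weightedNorm]) (weightedNorm_add_le hw) p

theorem weightedNorm_monomial (α : σ →₀ ℕ) (a : R) :
    weightedNorm w (monomial α a) = ‖a‖ * w α := by
  classical
  rw [weightedNorm_eq_sum (s := {α}) support_monomial_subset, Finset.sum_singleton,
    coeff_monomial, if_pos rfl]

theorem weightedNorm_X [NormOneClass R] (i : σ) :
    weightedNorm w (X i : MvPolynomial σ R) = w (Finsupp.single i 1) := by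
  rw [X, weightedNorm_monomial, norm_one, one_mul]

theorem weightedNorm_C_mul_le (hw : ∀ α, 0 ≤ w α) (a : R) (p : MvPolynomial σ R) :
    weightedNorm w (C a * p) ≤ ‖a‖ * weightedNorm w p := by
  rw [C_mul', weightedNorm_eq_sum support_smul, weightedNorm, Finset.mul_sum]
  refine Finset.sum_le_sum fun α _ => ?_
  rw [coeff_smul, smul_eq_mul, ← mul_assoc]
  exact mul_le_mul_of_nonneg_right (norm_mul_le _ _) (hw α)

theorem weightedNorm_mul_le (hw' : ∀ α, 0 ≤ w' α)
    (h : ∀ α ∈ p.support, ∀ β ∈ q.support, w' (α + β) ≤ w α * w β) :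
    weightedNorm w' (p * q) ≤ weightedNorm w p * weightedNorm w q := by
  rw [MvPolynomial.mul_def]
  simp only [Finsupp.sum]
  refine (weightedNorm_sum_le hw' _ _).trans ?_
  rw [weightedNorm, Finset.sum_mul]
  refine Finset.sum_le_sum fun α hα => (weightedNorm_sum_le hw' _ _).trans ?_
  rw [weightedNorm, Finset.mul_sum]
  refine Finset.sum_le_sum fun β hβ => ?_
  rw [weightedNorm_monomial]
  calc ‖coeff α p * coeff β q‖ * w' (α + β)
      ≤ ‖coeff α p‖ * ‖coeff β q‖ * (w α * w β) :=
        mul_le_mul (norm_mul_le _ _) (h α hα β hβ) (hw' _) (by positivity)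
    _ = ‖coeff α p‖ * w α * (‖coeff β q‖ * w β) := mul_mul_mul_comm _ _ _ _

theorem weightedNorm_prod_le (hw : ∀ α, 0 ≤ w α) (hmul : ∀ α β, w (α + β) ≤ w α * w β) (m : ℕ)
    {p : Fin (m + 1) → MvPolynomial σ R} (hp : ∀ i, weightedNorm w (p i) ≤ y) :
    weightedNorm w (∏ i, p i) ≤ y ^ (m + 1) := by
  induction m with
  | zero => simpa using hp 0
  | succ m ih =>
    rw [Fin.prod_univ_succ, pow_succ']
    refine (weightedNorm_mul_le hw fun α _ β _ => hmul α β).trans ?_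
    exact mul_le_mul (hp 0) (ih fun i => hp i.succ) (weightedNorm_nonneg hw _)
      ((weightedNorm_nonneg hw _).trans (hp 0))

theorem weightedNorm_coeffMultiplier_le (hw : ∀ α, 0 ≤ w α) {d : (σ →₀ ℕ) → R}
    (hd : ∀ α, ‖d α‖ * w α ≤ w' α) (p : MvPolynomial σ R) :
    weightedNorm w (coeffMultiplier d p) ≤ weightedNorm w' p := by
  have hsupp : (coeffMultiplier d p).support ⊆ p.support := fun α hα => by
    rw [mem_support_iff, coeff_coeffMultiplier] at hα
    exact mem_support_iff.2 (right_ne_zero_of_mul hα)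
  rw [weightedNorm_eq_sum hsupp, weightedNorm]
  refine Finset.sum_le_sum fun α _ => ?_
  rw [coeff_coeffMultiplier]
  calc ‖d α * coeff α p‖ * w α ≤ ‖d α‖ * ‖coeff α p‖ * w α :=
        mul_le_mul_of_nonneg_right (norm_mul_le _ _) (hw α)
    _ = ‖coeff α p‖ * (‖d α‖ * w α) := by ring
    _ ≤ ‖coeff α p‖ * w' α := by gcongr; exact hd α

end WeightedNorm

section IdealOfVars

open MvPolynomial

theorem prod_mem_ideal_pow {R : Type*} [CommSemiring R] {I : Ideal R} {m : ℕ} {p : Fin m → R}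
    (hp : ∀ i, p i ∈ I) : ∏ i, p i ∈ I ^ m := by
  simpa only [Finset.prod_const, Finset.card_univ, Fintype.card_fin] using
    Ideal.prod_mem_prod (s := Finset.univ) fun i _ => hp i

theorem prod_sub_prod_mem_ideal_pow {R : Type*} [CommRing R] {I : Ideal R} {d : ℕ} (m : ℕ)
    {p q : Fin (m + 1) → R} (hp : ∀ i, p i ∈ I) (hq : ∀ i, q i ∈ I)
    (hpq : ∀ i, p i - q i ∈ I ^ d) : ∏ i, p i - ∏ i, q i ∈ I ^ (d + m) := by
  induction m with
  | zero => simpa using hpq 0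
  | succ m ih =>
    have htail := Ideal.mul_mem_mul (hpq 0) (prod_mem_ideal_pow fun i => hp (Fin.succ i))
    have hhead := Ideal.mul_mem_mul (hq 0)
      (ih (fun i => hp i.succ) (fun i => hq i.succ) fun i => hpq i.succ)
    rw [← pow_add] at htail
    rw [← pow_succ'] at hhead
    rw [Fin.prod_univ_succ, Fin.prod_univ_succ (f := q)]
    convert add_mem htail hhead using 1
    ring

variable {σ R : Type*} [CommSemiring R] {d : ℕ} {p : MvPolynomial σ R}

theorem coeff_zero_of_mem_idealOfVars (hp : p ∈ idealOfVars σ R) : coeff 0 p = 0 := by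
  rw [← pow_one (idealOfVars σ R), mem_pow_idealOfVars_iff'] at hp
  exact hp 0 (by simp)

theorem coeffMultiplier_mem_pow_idealOfVars (hp : p ∈ idealOfVars σ R ^ d)
    (e : (σ →₀ ℕ) → R) : coeffMultiplier e p ∈ idealOfVars σ R ^ d := by
  rw [mem_pow_idealOfVars_iff'] at hp ⊢
  intro α hα
  rw [coeff_coeffMultiplier, hp α hα, mul_zero]

end IdealOfVars

/-! ### The truncated linearization -/

section Composition

open MvPolynomial

variable {n : ℕ}

/-- The composition with the polynomial map `h` of the homogeneous terms of degrees `2, …, N` of the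
power series with coefficients `c`; the monomials of degree `m` are indexed by `Fin m → Fin n`. -/
noncomputable def compTerms (N : ℕ) (c : (m : ℕ) → (Fin m → Fin n) → Fin n → ℂ)
    (h : Fin n → MvPolynomial (Fin n) ℂ) (j : Fin n) : MvPolynomial (Fin n) ℂ :=
  ∑ m ∈ Finset.Icc 2 N, ∑ i : Fin m → Fin n, C (c m i j) * ∏ k, h (i k)

/-- The weight `w` makes the weighted norm submultiplicative, with room to absorb a factor `Δ`. -/
structure IsNormWeight (Δ w : (Fin n →₀ ℕ) → ℝ) : Prop where
  pos : ∀ α, 0 < w α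
  le_mul : ∀ α β, w (α + β) ≤ w α * w β
  divisor_mul_le : ∀ α β, α ≠ 0 → β ≠ 0 → Δ (α + β) * w (α + β) ≤ w α * w β

theorem IsNormWeight.nonneg {Δ w : (Fin n →₀ ℕ) → ℝ} (hw : IsNormWeight Δ w) (α : Fin n →₀ ℕ) :
    0 ≤ w α := (hw.pos α).le

variable {N d : ℕ} {c : (m : ℕ) → (Fin m → Fin n) → Fin n → ℂ}
  {g h : Fin n → MvPolynomial (Fin n) ℂ} {Δ w : (Fin n →₀ ℕ) → ℝ} {a y : ℝ}

theorem compTerms_mem (hh : ∀ i, h i ∈ idealOfVars _ ℂ) (j : Fin n) :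
    compTerms N c h j ∈ idealOfVars _ ℂ ^ 2 :=
  sum_mem fun _ hm => sum_mem fun i _ => Ideal.mul_mem_left _ _ <|
    Ideal.pow_le_pow_right (Finset.mem_Icc.1 hm).1 (prod_mem_ideal_pow fun k => hh (i k))

theorem compTerms_sub_mem (hg : ∀ i, g i ∈ idealOfVars _ ℂ) (hh : ∀ i, h i ∈ idealOfVars _ ℂ)
    (hgh : ∀ i, g i - h i ∈ idealOfVars _ ℂ ^ d) (j : Fin n) :
    compTerms N c g j - compTerms N c h j ∈ idealOfVars _ ℂ ^ (d + 1) := by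
  simp only [compTerms, ← Finset.sum_sub_distrib, ← mul_sub]
  refine sum_mem fun m hm => sum_mem fun i _ => Ideal.mul_mem_left _ _ ?_
  obtain ⟨k, rfl⟩ := Nat.exists_eq_add_of_le' (Finset.mem_Icc.1 hm).1
  exact Ideal.pow_le_pow_right (by omega) (prod_sub_prod_mem_ideal_pow (k + 1)
    (fun l => hg (i l)) (fun l => hh (i l)) fun l => hgh (i l))

theorem weightedNorm_divisor_mul_prod_le (hΔ : ∀ α, 0 ≤ Δ α) (hw : IsNormWeight Δ w) (m : ℕ)
    {p : Fin (m + 2) → MvPolynomial (Fin n) ℂ} (hp : ∀ i, p i ∈ idealOfVars _ ℂ)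
    (hy : ∀ i, weightedNorm w (p i) ≤ y) :
    weightedNorm (fun α => Δ α * w α) (∏ i, p i) ≤ y ^ (m + 2) := by
  have hne : ∀ {q : MvPolynomial (Fin n) ℂ}, q ∈ idealOfVars _ ℂ → ∀ α ∈ q.support, α ≠ 0 := by
    rintro q hq α hα rfl
    exact mem_support_iff.1 hα (coeff_zero_of_mem_idealOfVars hq)
  have htail : ∏ i : Fin (m + 1), p i.succ ∈ idealOfVars _ ℂ :=
    Ideal.pow_le_self m.succ_ne_zero (prod_mem_ideal_pow fun i => hp i.succ)
  rw [Fin.prod_univ_succ, pow_succ']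
  refine (weightedNorm_mul_le (fun α => mul_nonneg (hΔ α) (hw.nonneg α)) fun α hα β hβ =>
    hw.divisor_mul_le α β (hne (hp 0) α hα) (hne htail β hβ)).trans ?_
  exact mul_le_mul (hy 0) (weightedNorm_prod_le hw.nonneg hw.le_mul m fun i => hy i.succ)
    (weightedNorm_nonneg hw.nonneg _) ((weightedNorm_nonneg hw.nonneg _).trans (hy 0))

theorem sum_Icc_two_pow_le {x : ℝ} (hx : 0 ≤ x) (hx2 : x ≤ 1 / 2) (N : ℕ) :
    ∑ m ∈ Finset.Icc 2 N, x ^ m ≤ 2 * x ^ 2 := by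
  rw [← Finset.Ico_add_one_right_eq_Icc]
  calc ∑ m ∈ Finset.Ico 2 (N + 1), x ^ m ≤ x ^ 2 / (1 - x) :=
        geom_sum_Ico_le_of_lt_one hx (by linarith)
    _ ≤ 2 * x ^ 2 := by
        rw [div_le_iff₀ (by linarith)]
        linarith [mul_nonneg (sq_nonneg x) (by linarith : 0 ≤ 1 - 2 * x)]

theorem weightedNorm_compTerms_le (hΔ : ∀ α, 0 ≤ Δ α) (hw : IsNormWeight Δ w) (ha : 0 ≤ a)
    (hy : 0 ≤ y) (hay : a * y ≤ 1 / 2) (hc : ∀ m j, ∑ i, ‖c m i j‖ ≤ a ^ m)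
    (hh : ∀ i, h i ∈ idealOfVars _ ℂ) (hhy : ∀ i, weightedNorm w (h i) ≤ y) (j : Fin n) :
    weightedNorm (fun α => Δ α * w α) (compTerms N c h j) ≤ 2 * (a * y) ^ 2 := by
  have hΔw : ∀ α, 0 ≤ Δ α * w α := fun α => mul_nonneg (hΔ α) (hw.nonneg α)
  refine le_trans ?_ (sum_Icc_two_pow_le (mul_nonneg ha hy) hay N)
  refine (weightedNorm_sum_le hΔw _ _).trans (Finset.sum_le_sum fun m hm => ?_)
  obtain ⟨k, rfl⟩ := Nat.exists_eq_add_of_le' (Finset.mem_Icc.1 hm).1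
  refine (weightedNorm_sum_le hΔw _ _).trans ?_
  calc ∑ i, weightedNorm (fun α => Δ α * w α) (C (c (k + 2) i j) * ∏ l, h (i l))
      ≤ ∑ i, ‖c (k + 2) i j‖ * y ^ (k + 2) := by
        refine Finset.sum_le_sum fun i _ => (weightedNorm_C_mul_le hΔw _ _).trans ?_
        gcongr
        exact weightedNorm_divisor_mul_prod_le hΔ hw k (fun l => hh (i l)) fun l => hhy (i l)
    _ = (∑ i, ‖c (k + 2) i j‖) * y ^ (k + 2) := by rw [Finset.sum_mul]
    _ ≤ a ^ (k + 2) * y ^ (k + 2) := by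
        gcongr
        exact hc _ j
    _ = (a * y) ^ (k + 2) := by rw [mul_pow]

end Composition

section Linearization

open MvPolynomial

variable {n : ℕ}

open Classical in
/-- The coefficients of the inverse of the homological operator, truncated to the degrees
`2, …, N`. -/
noncomputable def homologicalInverse (ω : Fin n → ℝ) (N : ℕ) (j : Fin n) (α : Fin n →₀ ℕ) : ℂ :=
  if 2 ≤ α.degree ∧ α.degree ≤ N then (Complex.I * divisor ω α j)⁻¹ else 0

/-- The map whose fixed points solve the linearization equation up to degree `N`. -/
noncomputable def linearizationStep (ω : Fin n → ℝ) (N : ℕ)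
    (c : (m : ℕ) → (Fin m → Fin n) → Fin n → ℂ) (h : Fin n → MvPolynomial (Fin n) ℂ)
    (j : Fin n) : MvPolynomial (Fin n) ℂ :=
  X j + coeffMultiplier (homologicalInverse ω N j) (compTerms N c h j)

/-- `H` is a polynomial map of degree at most `N`, tangent to the identity, that conjugates the
linear field to the field with nonlinear terms `c` up to degree `N`. -/
structure IsTruncatedLinearization (ω : Fin n → ℝ) (N : ℕ)
    (c : (m : ℕ) → (Fin m → Fin n) → Fin n → ℂ) (H : Fin n → MvPolynomial (Fin n) ℂ) : Prop where
  sub_X_mem : ∀ j, H j - X j ∈ idealOfVars _ ℂ ^ 2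
  coeff_of_lt : ∀ j α, N < α.degree → coeff α (H j) = 0
  homological : ∀ j α, 2 ≤ α.degree → α.degree ≤ N →
    Complex.I * divisor ω α j * coeff α (H j) = coeff α (compTerms N c H j)

variable {ω : Fin n → ℝ} {N : ℕ} {c : (m : ℕ) → (Fin m → Fin n) → Fin n → ℂ}
  {h H : Fin n → MvPolynomial (Fin n) ℂ}

theorem X_mem_idealOfVars (j : Fin n) : (X j : MvPolynomial (Fin n) ℂ) ∈ idealOfVars _ ℂ :=
  Ideal.subset_span (Set.mem_range_self j)

theorem IsTruncatedLinearization.mem (hH : IsTruncatedLinearization ω N c H) (j : Fin n) :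
    H j ∈ idealOfVars _ ℂ := by
  rw [← sub_add_cancel (H j) (X j)]
  exact add_mem (Ideal.pow_le_self two_ne_zero (hH.sub_X_mem j)) (X_mem_idealOfVars j)

theorem linearizationStep_sub_X_mem (ω : Fin n → ℝ) (N : ℕ)
    (c : (m : ℕ) → (Fin m → Fin n) → Fin n → ℂ) (h : Fin n → MvPolynomial (Fin n) ℂ) (j : Fin n) :
    linearizationStep ω N c h j - X j ∈ idealOfVars _ ℂ ^ 2 := by
  rw [linearizationStep, add_sub_cancel_left, mem_pow_idealOfVars_iff']
  intro α hα
  rw [coeff_coeffMultiplier, homologicalInverse, if_neg (by omega), zero_mul]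

theorem linearizationStep_mem (ω : Fin n → ℝ) (N : ℕ)
    (c : (m : ℕ) → (Fin m → Fin n) → Fin n → ℂ) (h : Fin n → MvPolynomial (Fin n) ℂ) (j : Fin n) :
    linearizationStep ω N c h j ∈ idealOfVars _ ℂ := by
  rw [← sub_add_cancel (linearizationStep ω N c h j) (X j)]
  exact add_mem (Ideal.pow_le_self two_ne_zero (linearizationStep_sub_X_mem ω N c h j))
    (X_mem_idealOfVars j)

theorem iterate_linearizationStep_mem (ω : Fin n → ℝ) (N : ℕ)
    (c : (m : ℕ) → (Fin m → Fin n) → Fin n → ℂ) (r : ℕ) (j : Fin n) :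
    (linearizationStep ω N c)^[r] X j ∈ idealOfVars _ ℂ := by
  cases r with
  | zero => exact X_mem_idealOfVars j
  | succ r =>
    rw [Function.iterate_succ_apply']
    exact linearizationStep_mem ω N c _ j

theorem iterate_linearizationStep_succ_sub_mem (ω : Fin n → ℝ) (N : ℕ)
    (c : (m : ℕ) → (Fin m → Fin n) → Fin n → ℂ) (r : ℕ) (j : Fin n) :
    (linearizationStep ω N c)^[r + 1] X j - (linearizationStep ω N c)^[r] X j ∈
      idealOfVars _ ℂ ^ (r + 2) := by
  induction r generalizing j with
  | zero => exact linearizationStep_sub_X_mem ω N c X j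
  | succ r ih =>
    rw [Function.iterate_succ_apply', Function.iterate_succ_apply' _ r, linearizationStep,
      linearizationStep, add_sub_add_left_eq_sub, ← map_sub,
      ← Function.iterate_succ_apply' (linearizationStep ω N c) r]
    exact coeffMultiplier_mem_pow_idealOfVars
      (compTerms_sub_mem (iterate_linearizationStep_mem ω N c (r + 1))
        (iterate_linearizationStep_mem ω N c r) ih j) _

theorem coeff_linearizationStep {α : Fin n →₀ ℕ} (hα : α.degree ≠ 1) (j : Fin n) :
    coeff α (linearizationStep ω N c h j) =
      homologicalInverse ω N j α * coeff α (compTerms N c h j) := by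
  classical
  have hne : Finsupp.single j 1 ≠ α := by
    rintro rfl
    exact hα (by simp)
  rw [linearizationStep, coeff_add, coeff_coeffMultiplier, coeff_X, if_neg hne, zero_add]

theorem coeff_linearizationStep_of_lt (hN : 1 ≤ N) {α : Fin n →₀ ℕ} (hα : N < α.degree)
    (j : Fin n) : coeff α (linearizationStep ω N c h j) = 0 := by
  rw [coeff_linearizationStep (by omega), homologicalInverse, if_neg (by omega), zero_mul]

theorem linearizationStep_iterate_eq (ω : Fin n → ℝ) (hN : 1 ≤ N)
    (c : (m : ℕ) → (Fin m → Fin n) → Fin n → ℂ) :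
    linearizationStep ω N c ((linearizationStep ω N c)^[N] X) =
      (linearizationStep ω N c)^[N] X := by
  obtain ⟨r, rfl⟩ := Nat.exists_eq_add_of_le' hN
  funext j
  ext α
  rcases lt_or_ge (r + 1) α.degree with hα | hα
  · rw [Function.iterate_succ_apply', coeff_linearizationStep_of_lt hN hα,
      coeff_linearizationStep_of_lt hN hα]
  · rw [← Function.iterate_succ_apply' (linearizationStep ω _ c), ← sub_eq_zero, ← coeff_sub]
    exact (mem_pow_idealOfVars_iff' _ _).1
      (iterate_linearizationStep_succ_sub_mem ω (r + 1) c (r + 1) j) α (by omega)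

theorem isTruncatedLinearization_iterate (hω : NonResonant ω) (hN : 1 ≤ N)
    (c : (m : ℕ) → (Fin m → Fin n) → Fin n → ℂ) :
    IsTruncatedLinearization ω N c ((linearizationStep ω N c)^[N] X) where
  sub_X_mem j := by
    rw [← linearizationStep_iterate_eq ω hN c]
    exact linearizationStep_sub_X_mem ω N c _ j
  coeff_of_lt j α hα := by
    rw [← linearizationStep_iterate_eq ω hN c]
    exact coeff_linearizationStep_of_lt hN hα j
  homological j α hα hαN := by
    have hdiv : Complex.I * divisor ω α j ≠ 0 :=
      mul_ne_zero Complex.I_ne_zero (mod_cast hω.divisor_ne_zero hα j)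
    conv_lhs => rw [← linearizationStep_iterate_eq ω hN c]
    rw [coeff_linearizationStep (by omega), homologicalInverse, if_pos ⟨hα, hαN⟩,
      mul_inv_cancel_left₀ hdiv]

theorem invDivisor_nonneg (ω : Fin n → ℝ) (α : Fin n →₀ ℕ) : 0 ≤ invDivisor ω α :=
  Real.iSup_nonneg fun _ => inv_nonneg.2 (abs_nonneg _)

theorem norm_homologicalInverse_le (ω : Fin n → ℝ) (N : ℕ) (j : Fin n) (α : Fin n →₀ ℕ) :
    ‖homologicalInverse ω N j α‖ ≤ invDivisor ω α := by
  rw [homologicalInverse]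
  split_ifs
  · rw [norm_inv, norm_mul, Complex.norm_I, one_mul, Complex.norm_real, Real.norm_eq_abs]
    exact inv_abs_divisor_le ω α j
  · rw [norm_zero]
    exact invDivisor_nonneg ω α

theorem weightedNorm_iterate_linearizationStep_le {w : (Fin n →₀ ℕ) → ℝ}
    (hw : IsNormWeight (invDivisor ω) w) {a y : ℝ} (ha : 0 ≤ a) (hay : a * y ≤ 1 / 2)
    (hc : ∀ m j, ∑ i, ‖c m i j‖ ≤ a ^ m) (hy2 : 2 * (a * y) ^ 2 ≤ y / 2)
    (hX : ∀ j, w (Finsupp.single j 1) ≤ y / 2) (r : ℕ) (j : Fin n) :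
    weightedNorm w ((linearizationStep ω N c)^[r] X j) ≤ y := by
  have hy : 0 ≤ y := by linarith [(hw.pos _).trans_le (hX j)]
  have hXj : ∀ j, weightedNorm w (X j : MvPolynomial (Fin n) ℂ) ≤ y / 2 := fun j =>
    (weightedNorm_X j).trans_le (hX j)
  induction r generalizing j with
  | zero => exact (hXj j).trans (half_le_self hy)
  | succ r ih =>
    rw [Function.iterate_succ_apply', linearizationStep]
    calc _ ≤ weightedNorm w (X j : MvPolynomial (Fin n) ℂ) + weightedNorm w
            (coeffMultiplier (homologicalInverse ω N j)
              (compTerms N c ((linearizationStep ω N c)^[r] X) j)) :=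
          weightedNorm_add_le hw.nonneg _ _
      _ ≤ weightedNorm w (X j : MvPolynomial (Fin n) ℂ) + weightedNorm
            (fun α => invDivisor ω α * w α)
            (compTerms N c ((linearizationStep ω N c)^[r] X) j) := by
          gcongr
          exact weightedNorm_coeffMultiplier_le hw.nonneg (fun α => mul_le_mul_of_nonneg_right
            (norm_homologicalInverse_le ω N j α) (hw.nonneg α)) _
      _ ≤ y / 2 + 2 * (a * y) ^ 2 := by
          gcongr
          · exact hXj j
          · exact weightedNorm_compTerms_le (invDivisor_nonneg ω) hw ha hy hay hc
              (iterate_linearizationStep_mem ω N c r) ih j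
      _ ≤ y := by linarith

end Linearization

/-! ### Polynomial maps -/

section Evaluation

open MvPolynomial Topology

variable {σ 𝕜 : Type*} [Fintype σ]

theorem norm_eval_le_weightedNorm [NormedField 𝕜] {z : σ → 𝕜} {ρ : ℝ} (hz : ‖z‖ ≤ ρ)
    (p : MvPolynomial σ 𝕜) : ‖eval z p‖ ≤ weightedNorm (fun α => ρ ^ α.degree) p := by
  rw [eval_eq', weightedNorm]
  refine (norm_sum_le _ _).trans (Finset.sum_le_sum fun α _ => ?_)
  rw [norm_mul, norm_prod, Finsupp.degree_eq_sum, ← Finset.prod_pow_eq_pow_sum]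
  gcongr with i
  rw [norm_pow]
  gcongr
  exact (norm_le_pi_norm z i).trans hz

theorem isBigO_eval_of_mem_pow_idealOfVars [NormedField 𝕜] {d : ℕ} {p : MvPolynomial σ 𝕜}
    (hp : p ∈ idealOfVars σ 𝕜 ^ d) : (fun z => eval z p) =O[𝓝 0] fun z : σ → 𝕜 => ‖z‖ ^ d := by
  refine Asymptotics.IsBigO.of_bound (weightedNorm (fun _ => 1) p) ?_
  filter_upwards [Metric.closedBall_mem_nhds (0 : σ → 𝕜) one_pos] with z hz
  rw [mem_closedBall_zero_iff] at hz
  refine (norm_eval_le_weightedNorm le_rfl p).trans ?_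
  rw [weightedNorm, weightedNorm, Finset.sum_mul]
  refine Finset.sum_le_sum fun α hα => ?_
  rw [mul_one, norm_pow, norm_norm]
  exact mul_le_mul_of_nonneg_left (pow_le_pow_of_le_one (norm_nonneg _) hz
    ((mem_pow_idealOfVars_iff d p).1 hp α hα)) (norm_nonneg _)

theorem hasFDerivAt_eval [NontriviallyNormedField 𝕜] (p : MvPolynomial σ 𝕜) (z : σ → 𝕜) :
    HasFDerivAt (fun z => eval z p)
      (∑ k, eval z (pderiv k p) • ContinuousLinearMap.proj (R := 𝕜) (φ := fun _ : σ => 𝕜) k)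
      z := by
  classical
  induction p using MvPolynomial.induction_on with
  | C a =>
    simp only [eval_C]
    refine (hasFDerivAt_const (𝕜 := 𝕜) a z).congr_fderiv ?_
    ext v
    simp
  | add p q hp hq =>
    simp only [map_add]
    refine (hp.fun_add hq).congr_fderiv ?_
    ext v
    simp [add_mul, Finset.sum_add_distrib]
  | mul_X p i hp =>
    simp only [map_mul, eval_X]
    refine (hp.mul (hasFDerivAt_apply (𝕜 := 𝕜) (F' := fun _ : σ => 𝕜) i z)).congr_fderiv ?_
    ext v
    simp [Derivation.leibniz, pderiv_X, Pi.single_apply, add_mul, Finset.sum_add_distrib,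
      Finset.mul_sum, mul_assoc, apply_ite (eval z)]

theorem sum_eval_pderiv_mul {R : Type*} [CommRing R] (ν z : σ → R) (p : MvPolynomial σ R) :
    ∑ k, eval z (pderiv k p) * (ν k * z k) =
      eval z (coeffMultiplier (fun α => ∑ k, (α k : R) * ν k) p) := by
  have hmon : ∀ k α, eval z (pderiv k (monomial α (coeff α p))) * (ν k * z k) =
      α k * ν k * eval z (monomial α (coeff α p)) := fun k α => by
    have heuler := congrArg (eval z) (X_mul_pderiv_monomial (i := k) (m := α) (r := coeff α p))
    rw [map_mul, eval_X, map_nsmul, nsmul_eq_mul] at heuler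
    linear_combination ν k * heuler
  conv_lhs => rw [p.as_sum]; simp only [map_sum, Finset.sum_mul, hmon]
  conv_rhs => rw [p.as_sum, map_sum, map_sum]
  rw [Finset.sum_comm]
  refine Finset.sum_congr rfl fun α _ => ?_
  rw [coeffMultiplier_monomial, ← Finset.sum_mul, eval_monomial, eval_monomial, mul_assoc]

end Evaluation

section PolyMap

open MvPolynomial Topology

variable {n : ℕ} {H : Fin n → MvPolynomial (Fin n) ℂ}

/-- The polynomial map with components `H`. -/
noncomputable def polyMap (H : Fin n → MvPolynomial (Fin n) ℂ) (z : Fin n → ℂ) : Fin n → ℂ :=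
  fun j => eval z (H j)

theorem analyticAt_polyMap (H : Fin n → MvPolynomial (Fin n) ℂ) (z : Fin n → ℂ) :
    AnalyticAt ℂ (polyMap H) z :=
  AnalyticAt.pi fun j => AnalyticOnNhd.eval_mvPolynomial (H j) z (Set.mem_univ z)

theorem polyMap_zero (hH : ∀ j, H j ∈ idealOfVars _ ℂ) : polyMap H 0 = 0 := by
  funext j
  rw [polyMap, eval_zero, constantCoeff_eq, coeff_zero_of_mem_idealOfVars (hH j), Pi.zero_apply]

theorem tendsto_polyMap (hH : ∀ j, H j ∈ idealOfVars _ ℂ) : Tendsto (polyMap H) (𝓝 0) (𝓝 0) := by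
  simpa only [polyMap_zero hH] using (analyticAt_polyMap H 0).continuousAt.tendsto

theorem isBigO_polyMap {d : ℕ} (hH : ∀ j, H j ∈ idealOfVars _ ℂ ^ d) :
    polyMap H =O[𝓝 0] fun z : Fin n → ℂ => ‖z‖ ^ d :=
  Asymptotics.isBigO_pi.2 fun j => isBigO_eval_of_mem_pow_idealOfVars (hH j)

/-- The linear vector field `z ↦ (i ω_j z_j)_j`. -/
noncomputable def linearField (ω : Fin n → ℝ) : (Fin n → ℂ) →L[ℂ] (Fin n → ℂ) :=
  ContinuousLinearMap.pi fun j => (Complex.I * (ω j : ℂ)) • ContinuousLinearMap.proj j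

@[simp]
theorem linearField_apply (ω : Fin n → ℝ) (z : Fin n → ℂ) (j : Fin n) :
    linearField ω z j = Complex.I * ω j * z j := rfl

theorem fderiv_polyMap_linearField (ω : Fin n → ℝ) (H : Fin n → MvPolynomial (Fin n) ℂ)
    (z : Fin n → ℂ) : fderiv ℂ (polyMap H) z (linearField ω z) =
      linearField ω (polyMap H z) +
        polyMap (fun j => coeffMultiplier (fun α => Complex.I * divisor ω α j) (H j)) z := by
  have hfderiv : HasFDerivAt (polyMap H) _ z := hasFDerivAt_pi.2 fun j => hasFDerivAt_eval (H j) z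
  funext j
  have hmult : coeffMultiplier (fun α => ∑ k, (α k : ℂ) * (Complex.I * ω k)) (H j) =
      C (Complex.I * (ω j : ℂ)) * H j +
        coeffMultiplier (fun α => Complex.I * divisor ω α j) (H j) := by
    ext α
    have hsum : ∑ k, (α k : ℂ) * (Complex.I * ω k) = Complex.I * ∑ k, (α k : ℂ) * ω k := by
      rw [Finset.mul_sum]
      exact Finset.sum_congr rfl fun k _ => mul_left_comm _ _ _
    simp only [coeff_add, coeff_C_mul, coeff_coeffMultiplier, divisor, hsum]
    push_cast
    ring
  calc fderiv ℂ (polyMap H) z (linearField ω z) j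
      = ∑ k, eval z (pderiv k (H j)) * (Complex.I * ω k * z k) := by
        rw [hfderiv.fderiv]
        simp
    _ = eval z (C (Complex.I * (ω j : ℂ)) * H j +
          coeffMultiplier (fun α => Complex.I * divisor ω α j) (H j)) := by
        rw [sum_eval_pderiv_mul, hmult]
    _ = _ := by rw [map_add, map_mul, eval_C]; rfl

end PolyMap

section SeriesCoeff

open MvPolynomial

variable {n : ℕ} {p : FormalMultilinearSeries ℂ (Fin n → ℂ) (Fin n → ℂ)}

/-- The coefficients of a power series in coordinates: the homogeneous term of degree `m` is
`∑ i : Fin m → Fin n, seriesCoeff p m i * ∏ k, z (i k)`. -/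
noncomputable def seriesCoeff (p : FormalMultilinearSeries ℂ (Fin n → ℂ) (Fin n → ℂ)) (m : ℕ)
    (i : Fin m → Fin n) (j : Fin n) : ℂ := p m (fun k => Pi.single (i k) 1) j

theorem series_apply_eq_sum (p : FormalMultilinearSeries ℂ (Fin n → ℂ) (Fin n → ℂ)) (m : ℕ)
    (v : Fin n → ℂ) (j : Fin n) :
    p m (fun _ => v) j = ∑ i : Fin m → Fin n, seriesCoeff p m i j * ∏ k, v (i k) := by
  conv_lhs => rw [pi_eq_sum_univ' v]
  rw [ContinuousMultilinearMap.map_sum]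
  simp only [ContinuousMultilinearMap.map_smul_univ, Finset.sum_apply, Pi.smul_apply, smul_eq_mul,
    seriesCoeff, mul_comm (∏ _, _)]

theorem norm_seriesCoeff_le (p : FormalMultilinearSeries ℂ (Fin n → ℂ) (Fin n → ℂ)) (m : ℕ)
    (i : Fin m → Fin n) (j : Fin n) : ‖seriesCoeff p m i j‖ ≤ ‖p m‖ :=
  calc ‖seriesCoeff p m i j‖ ≤ ‖p m fun k => Pi.single (i k) 1‖ := norm_le_pi_norm _ j
    _ ≤ ‖p m‖ * ∏ k, ‖(Pi.single (i k) 1 : Fin n → ℂ)‖ := (p m).le_opNorm _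
    _ = ‖p m‖ := by simp only [Pi.norm_single, norm_one, Finset.prod_const_one, mul_one]

theorem exists_sum_norm_seriesCoeff_le (hp : 0 < p.radius) (h0 : p 0 = 0) :
    ∃ a : ℝ, 1 ≤ a ∧ ∀ m j, ∑ i, ‖seriesCoeff p m i j‖ ≤ a ^ m := by
  obtain ⟨r, hr0, hr⟩ := ENNReal.lt_iff_exists_nnreal_btwn.1 hp
  have hr0' : 0 < r := mod_cast hr0
  obtain ⟨C, hC, hb⟩ := p.norm_le_div_pow_of_pos_of_lt_radius hr0' hr
  refine ⟨1 + (1 + C) * (n / r), by simp only [le_add_iff_nonneg_right]; positivity,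
    fun m j => ?_⟩
  rcases Nat.eq_zero_or_pos m with rfl | hm
  · simp [seriesCoeff, h0]
  calc ∑ i, ‖seriesCoeff p m i j‖ ≤ ∑ _i : Fin m → Fin n, C / (r : ℝ) ^ m :=
        Finset.sum_le_sum fun i _ => (norm_seriesCoeff_le p m i j).trans (hb m)
    _ = C * (n / r) ^ m := by
        rw [Finset.sum_const, Finset.card_univ, Fintype.card_fun, Fintype.card_fin,
          Fintype.card_fin, nsmul_eq_mul, Nat.cast_pow, div_pow]
        ring
    _ ≤ (1 + C) ^ m * (n / r) ^ m := by
        gcongr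
        exact (le_add_of_nonneg_left zero_le_one).trans (le_self_pow₀ (by linarith) hm.ne')
    _ ≤ (1 + (1 + C) * (n / r)) ^ m := by
        rw [← mul_pow]
        gcongr
        exact le_add_of_nonneg_left zero_le_one

theorem partialSum_polyMap (h0 : p 0 = 0) (h1 : p 1 = 0) (N : ℕ)
    (H : Fin n → MvPolynomial (Fin n) ℂ) (z : Fin n → ℂ) :
    p.partialSum (N + 1) (polyMap H z) = polyMap (compTerms N (seriesCoeff p) H) z := by
  have hlow : ∀ m ∈ Finset.range (N + 1), m ∉ Finset.Icc 2 N →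
      p m (fun _ => polyMap H z) = 0 := fun m hm hm' => by
    rw [Finset.mem_range] at hm
    rw [Finset.mem_Icc] at hm'
    obtain rfl | rfl : m = 0 ∨ m = 1 := by omega
    · rw [h0, zero_apply]
    · rw [h1, zero_apply]
  have hsub : Finset.Icc 2 N ⊆ Finset.range (N + 1) := fun m hm =>
    Finset.mem_range.2 (Nat.lt_succ_of_le (Finset.mem_Icc.1 hm).2)
  rw [FormalMultilinearSeries.partialSum, ← Finset.sum_subset hsub hlow]
  funext j
  simp only [Finset.sum_apply, series_apply_eq_sum, polyMap, compTerms, map_sum, map_mul, eval_C,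
    map_prod]

end SeriesCoeff

/-! ### The truncated normal form -/

section NormalForm

open MvPolynomial Topology

variable {n N : ℕ} {ω : Fin n → ℝ} {F f : (Fin n → ℂ) → (Fin n → ℂ)}
  {p : FormalMultilinearSeries ℂ (Fin n → ℂ) (Fin n → ℂ)} {H : Fin n → MvPolynomial (Fin n) ℂ}

theorem IsTruncatedLinearization.compTerms_sub_coeffMultiplier_mem
    {c : (m : ℕ) → (Fin m → Fin n) → Fin n → ℂ} (hH : IsTruncatedLinearization ω N c H)
    (j : Fin n) : compTerms N c H j - coeffMultiplier (fun α => Complex.I * divisor ω α j) (H j) ∈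
      idealOfVars _ ℂ ^ (N + 1) := by
  classical
  rw [mem_pow_idealOfVars_iff']
  intro α hα
  rw [coeff_sub, coeff_coeffMultiplier]
  rcases lt_or_ge α.degree 2 with hlt | hge
  · have hX := (mem_pow_idealOfVars_iff' _ _).1 (hH.sub_X_mem j) α hlt
    rw [coeff_sub, sub_eq_zero] at hX
    rw [(mem_pow_idealOfVars_iff' _ _).1 (compTerms_mem hH.mem j) α hlt, hX, coeff_X]
    split_ifs with hα'
    · subst hα'
      have hdiv : divisor ω (Finsupp.single j 1) j = 0 := by
        rw [divisor, Finset.sum_eq_single j] <;> simp +contextual [eq_comm]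
      rw [hdiv, Complex.ofReal_zero, mul_zero, zero_mul, sub_zero]
    · rw [mul_zero, sub_zero]
  · rw [hH.homological j α hge (by omega), sub_self]

theorem isBigO_comp_polyMap_sub_compTerms (hp : HasFPowerSeriesAt f p 0) (h0 : p 0 = 0)
    (h1 : p 1 = 0) (hH : ∀ j, H j ∈ idealOfVars _ ℂ) :
    (fun z => f (polyMap H z) - polyMap (compTerms N (seriesCoeff p) H) z) =O[𝓝 0]
      fun z : Fin n → ℂ => ‖z‖ ^ (N + 1) := by
  have hbig : polyMap H =O[𝓝 0] fun z : Fin n → ℂ => ‖z‖ := by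
    simpa only [pow_one] using isBigO_polyMap (d := 1) (by simpa only [pow_one] using hH)
  have htaylor := (hp.isBigO_sub_partialSum_pow (N + 1)).comp_tendsto (tendsto_polyMap hH)
  simp only [zero_add, Function.comp_def, partialSum_polyMap h0 h1] at htaylor
  exact htaylor.trans (hbig.norm_left.pow (N + 1))

/-- The error `F ∘ h - Dh · A` in the conjugacy equation: it vanishes iff `h` maps the solutions of
`dz/dt = A z` to solutions of `dz/dt = F z`. -/
noncomputable def conjugacyDefect {E : Type*} [NormedAddCommGroup E] [NormedSpace ℂ E]
    (A : E →L[ℂ] E) (F h : E → E) (z : E) : E :=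
  F (h z) - fderiv ℂ h z (A z)

theorem isLittleO_conjugacyDefect (hFf : ∀ᶠ z in 𝓝 0, F z = linearField ω z + f z)
    (hp : HasFPowerSeriesAt f p 0) (h0 : p 0 = 0) (h1 : p 1 = 0)
    (hH : IsTruncatedLinearization ω N (seriesCoeff p) H) :
    conjugacyDefect (linearField ω) F (polyMap H) =o[𝓝 0] fun z => ‖z‖ ^ N := by
  have hhom := isBigO_polyMap hH.compTerms_sub_coeffMultiplier_mem
  refine (((isBigO_comp_polyMap_sub_compTerms hp h0 h1 hH.mem).add hhom).trans_isLittleO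
    ((Asymptotics.isLittleO_pow_pow N.lt_succ_self).comp_tendsto tendsto_norm_zero)).congr' ?_
    EventuallyEq.rfl
  filter_upwards [(tendsto_polyMap hH.mem).eventually hFf] with z hz
  rw [conjugacyDefect, hz, fderiv_polyMap_linearField]
  funext j
  simp only [polyMap, Pi.add_apply, Pi.sub_apply, map_sub]
  ring

end NormalForm

section WeightComparison

open MvPolynomial

variable {σ : Type*} {w : (σ →₀ ℕ) → ℝ}

theorem weightedNorm_le_mul_weightedNorm {R : Type*} [SeminormedCommRing R]
    {w' : (σ →₀ ℕ) → ℝ} {κ : ℝ} {p : MvPolynomial σ R}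
    (h : ∀ α ∈ p.support, w' α ≤ κ * w α) : weightedNorm w' p ≤ κ * weightedNorm w p := by
  rw [weightedNorm, weightedNorm, Finset.mul_sum]
  refine Finset.sum_le_sum fun α hα => ?_
  rw [mul_left_comm]
  exact mul_le_mul_of_nonneg_left (h α hα) (norm_nonneg _)

theorem coeff_sub_X_of_one_lt_degree {R : Type*} [CommRing R] (p : MvPolynomial σ R) (j : σ)
    {α : σ →₀ ℕ} (hα : 1 < α.degree) : coeff α (p - X j) = coeff α p := by
  classical
  rw [coeff_sub, coeff_X, if_neg, sub_zero]
  rintro rfl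
  simp at hα

theorem weightedNorm_sub_X_le {R : Type*} [SeminormedCommRing R] (hw : ∀ α, 0 ≤ w α)
    {p : MvPolynomial σ R} {j : σ} (hp : p - X j ∈ idealOfVars σ R ^ 2) :
    weightedNorm w (p - X j) ≤ weightedNorm w p := by
  have hcoeff : ∀ α ∈ (p - X j).support, coeff α (p - X j) = coeff α p := fun α hα =>
    coeff_sub_X_of_one_lt_degree p j ((mem_pow_idealOfVars_iff 2 _).1 hp α hα)
  have hsub : (p - X j).support ⊆ p.support := fun α hα => by
    rw [mem_support_iff, ← hcoeff α hα]
    exact mem_support_iff.1 hα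
  calc weightedNorm w (p - X j) = ∑ α ∈ (p - X j).support, ‖coeff α p‖ * w α :=
        Finset.sum_congr rfl fun α hα => by rw [hcoeff α hα]
    _ ≤ weightedNorm w p := Finset.sum_le_sum_of_subset_of_nonneg hsub fun α _ _ =>
        mul_nonneg (norm_nonneg _) (hw α)

theorem rpow_mul_div_pow_le {s : ℝ} (hs : 0 ≤ s) {N m : ℕ} (hm : 1 ≤ m) (hmN : m ≤ N) :
    (m : ℝ) ^ (s * m) / ((N : ℝ) ^ s) ^ m ≤ Real.exp s ^ m / (N : ℝ) ^ s := by
  have hm1 : (1 : ℝ) ≤ m := mod_cast hm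
  have hmN' : (m : ℝ) ≤ N := mod_cast hmN
  have hm0 : (0 : ℝ) < m := one_pos.trans_le hm1
  have hN0 : (0 : ℝ) < N := hm0.trans_le hmN'
  calc (m : ℝ) ^ (s * m) / ((N : ℝ) ^ s) ^ m = ((m : ℝ) / N) ^ (s * m) := by
        rw [Real.div_rpow hm0.le hN0.le, Real.rpow_mul hN0.le, Real.rpow_natCast]
    _ ≤ ((m : ℝ) / N) ^ s :=
        Real.rpow_le_rpow_of_exponent_ge (by positivity) ((div_le_one hN0).2 hmN')
          (le_mul_of_one_le_right hs hm1)
    _ = (m : ℝ) ^ s / (N : ℝ) ^ s := Real.div_rpow hm0.le hN0.le s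
    _ ≤ Real.exp s ^ m / (N : ℝ) ^ s := by
        gcongr
        rw [Real.rpow_def_of_pos hm0, ← Real.exp_nat_mul, Real.exp_le_exp]
        exact mul_le_mul_of_nonneg_right (Real.log_le_self hm0.le) hs

theorem pow_le_mul_pow_div {s K t c μ : ℝ} (hs : 0 ≤ s) (hK : 0 ≤ K) (ht : 0 < t) (hc : 0 ≤ c)
    (hBc : K * Real.exp s / t * c ≤ 1) {N m : ℕ} (hm : 2 ≤ m) (hmN : m ≤ N) (hμ0 : 0 < μ)
    (hμ : μ ≤ K ^ m * (m : ℝ) ^ (s * m)) :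
    (c / (N : ℝ) ^ s) ^ m ≤ (K * Real.exp s / t * c) ^ 2 / (N : ℝ) ^ s * (t ^ m / μ) := by
  rw [← mul_div_assoc, le_div_iff₀ hμ0]
  calc (c / (N : ℝ) ^ s) ^ m * μ
      ≤ (c / (N : ℝ) ^ s) ^ m * (K ^ m * (m : ℝ) ^ (s * m)) := by gcongr
    _ = (c * K) ^ m * ((m : ℝ) ^ (s * m) / ((N : ℝ) ^ s) ^ m) := by
        rw [div_pow, mul_pow]
        ring
    _ ≤ (c * K) ^ m * (Real.exp s ^ m / (N : ℝ) ^ s) := by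
        gcongr ?_ * ?_
        exact rpow_mul_div_pow_le hs (by omega) hmN
    _ = (K * Real.exp s / t * c) ^ m / (N : ℝ) ^ s * t ^ m := by
        rw [← mul_div_assoc, ← mul_pow, div_mul_eq_mul_div, ← mul_pow]
        congr 2
        field_simp
    _ ≤ (K * Real.exp s / t * c) ^ 2 / (N : ℝ) ^ s * t ^ m := by
        gcongr ?_ / _ * _
        exact pow_le_pow_of_le_one (by positivity) hBc hm

end WeightComparison

section NormalFormBounds

open MvPolynomial Topology

variable {n N : ℕ} {ω : Fin n → ℝ} {s : ℝ} {M : (Fin n →₀ ℕ) → ℝ}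
  {c : (m : ℕ) → (Fin m → Fin n) → Fin n → ℂ} {a : ℝ} {H : Fin n → MvPolynomial (Fin n) ℂ}

theorem IsGevreyWeight.isNormWeight {Δ : (Fin n →₀ ℕ) → ℝ} (hM : IsGevreyWeight Δ s M) {t : ℝ}
    (ht : 0 < t) : IsNormWeight Δ fun α => t ^ α.degree / M α := by
  have hsplit : ∀ α β : Fin n →₀ ℕ, t ^ α.degree / M α * (t ^ β.degree / M β) =
      t ^ (α + β).degree / (M α * M β) := fun α β => by
    rw [map_add, pow_add, div_mul_div_comm]
  refine ⟨fun α => div_pos (pow_pos ht _) (hM.pos α), fun α β => ?_, fun α β hα hβ => ?_⟩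
  · rw [hsplit]
    exact div_le_div_of_nonneg_left (by positivity) (mul_pos (hM.pos α) (hM.pos β))
      (hM.mul_le α β)
  · rw [hsplit, ← mul_div_assoc, div_le_div_iff₀ (hM.pos _) (mul_pos (hM.pos α) (hM.pos β)),
      mul_comm (Δ _), mul_assoc]
    exact mul_le_mul_of_nonneg_left (hM.divisor_mul_le α β hα hβ) (by positivity)

theorem exists_isTruncatedLinearization_weightedNorm_le (hω : NonResonant ω)
    (hM : IsGevreyWeight (invDivisor ω) s M) (ha : 1 ≤ a)
    (hc : ∀ m j, ∑ i, ‖c m i j‖ ≤ a ^ m) :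
    ∃ y t : ℝ, 0 < y ∧ 0 < t ∧ ∀ N : ℕ, 1 ≤ N → ∃ H : Fin n → MvPolynomial (Fin n) ℂ,
      IsTruncatedLinearization ω N c H ∧
        ∀ j, weightedNorm (fun α => t ^ α.degree / M α) (H j) ≤ y := by
  set y : ℝ := 1 / (4 * a ^ 2) with hy
  have hy0 : 0 < y := by positivity
  have hay2 : a ^ 2 * y = 1 / 4 := by rw [hy]; field_simp
  set D : ℝ := 1 + ∑ j : Fin n, (M (Finsupp.single j 1))⁻¹
  have hinv : ∀ j ∈ Finset.univ, 0 ≤ (M (Finsupp.single j 1))⁻¹ := fun j _ =>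
    (inv_pos.2 (hM.pos _)).le
  have hD0 : 0 < D := add_pos_of_pos_of_nonneg one_pos (Finset.sum_nonneg hinv)
  have hX : ∀ j : Fin n, (y / 2 / D) ^ (Finsupp.single j 1).degree / M (Finsupp.single j 1) ≤
      y / 2 := fun j => by
    rw [Finsupp.degree_single, pow_one, div_eq_mul_inv _ (M _), div_mul_eq_mul_div,
      div_le_iff₀ hD0]
    gcongr
    exact (Finset.single_le_sum hinv (Finset.mem_univ j)).trans (le_add_of_nonneg_left zero_le_one)
  refine ⟨y, y / 2 / D, hy0, by positivity, fun N hN =>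
    ⟨_, isTruncatedLinearization_iterate hω hN c, fun j => ?_⟩⟩
  exact weightedNorm_iterate_linearizationStep_le (hM.isNormWeight (by positivity)) (by linarith)
    (by nlinarith) hc (by nlinarith) hX N j

theorem IsTruncatedLinearization.degree_le (hH : IsTruncatedLinearization ω N c H) {j : Fin n}
    {α : Fin n →₀ ℕ} (hα : α ∈ (H j - X j).support) (hα2 : 2 ≤ α.degree) : α.degree ≤ N := by
  by_contra! hlt
  refine mem_support_iff.1 hα ?_
  rw [coeff_sub_X_of_one_lt_degree _ _ hα2, hH.coeff_of_lt j α hlt]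

theorem IsTruncatedLinearization.norm_polyMap_sub_le (hH : IsTruncatedLinearization ω N c H)
    {Δ : (Fin n →₀ ℕ) → ℝ} (hM : IsGevreyWeight Δ s M) (hs : 0 ≤ s) {K t y c₀ : ℝ} (hK : 0 ≤ K)
    (hgrow : ∀ α, α ≠ 0 → M α ≤ K ^ α.degree * (α.degree : ℝ) ^ (s * (α.degree : ℝ)))
    (ht : 0 < t) (hy : ∀ j, weightedNorm (fun α => t ^ α.degree / M α) (H j) ≤ y) (hc₀ : 0 ≤ c₀)
    (hBc : K * Real.exp s / t * c₀ ≤ 1) (hyBc : (K * Real.exp s / t * c₀) ^ 2 * y ≤ c₀ / 8)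
    {z : Fin n → ℂ} (hz : ‖z‖ ≤ c₀ / (N : ℝ) ^ s) :
    ‖polyMap H z - z‖ ≤ c₀ / (N : ℝ) ^ s / 8 := by
  refine (pi_norm_le_iff_of_nonneg (by positivity)).2 fun j => ?_
  have hpow : ∀ α ∈ (H j - X j).support, (c₀ / (N : ℝ) ^ s) ^ α.degree ≤
      (K * Real.exp s / t * c₀) ^ 2 / (N : ℝ) ^ s * (t ^ α.degree / M α) := fun α hα => by
    have hα2 := (mem_pow_idealOfVars_iff 2 _).1 (hH.sub_X_mem j) α hα
    refine pow_le_mul_pow_div hs hK ht hc₀ hBc hα2 (hH.degree_le hα hα2) (hM.pos α)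
      (hgrow α ?_)
    rintro rfl
    simp at hα2
  calc ‖polyMap H z j - z j‖ = ‖eval z (H j - X j)‖ := by rw [map_sub, eval_X, polyMap]
    _ ≤ weightedNorm (fun α => (c₀ / (N : ℝ) ^ s) ^ α.degree) (H j - X j) :=
        norm_eval_le_weightedNorm hz _
    _ ≤ (K * Real.exp s / t * c₀) ^ 2 / (N : ℝ) ^ s *
          weightedNorm (fun α => t ^ α.degree / M α) (H j - X j) :=
        weightedNorm_le_mul_weightedNorm hpow
    _ ≤ (K * Real.exp s / t * c₀) ^ 2 / (N : ℝ) ^ s * y := by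
        gcongr
        exact (weightedNorm_sub_X_le (hM.isNormWeight ht).nonneg (hH.sub_X_mem j)).trans (hy j)
    _ ≤ c₀ / (N : ℝ) ^ s / 8 := by
        rw [div_mul_eq_mul_div, div_right_comm]
        gcongr

theorem exists_isTruncatedLinearization_norm_sub_le (hω : NonResonant ω) (hs : 0 ≤ s)
    (hM : IsGevreyWeight (invDivisor ω) s M) (ha : 1 ≤ a) (hc : ∀ m j, ∑ i, ‖c m i j‖ ≤ a ^ m)
    {b : ℝ} (hb : 0 < b) :
    ∃ c₀ : ℝ, 0 < c₀ ∧ c₀ ≤ b ∧ ∀ N : ℕ, 1 ≤ N → ∃ H : Fin n → MvPolynomial (Fin n) ℂ,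
      IsTruncatedLinearization ω N c H ∧
        ∀ z, ‖z‖ ≤ c₀ / (N : ℝ) ^ s → ‖polyMap H z - z‖ ≤ c₀ / (N : ℝ) ^ s / 8 := by
  obtain ⟨K, hK1, hgrow⟩ := hM.growth
  obtain ⟨y, t, hy, ht, hlin⟩ := exists_isTruncatedLinearization_weightedNorm_le hω hM ha hc
  set B : ℝ := K * Real.exp s / t
  have hB0 : 0 < B := by positivity
  set c₀ : ℝ := min b (min (1 / B) (1 / (8 * y * B ^ 2)))
  have hc₀ : 0 < c₀ := by positivity
  have hBc : B * c₀ ≤ 1 :=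
    (le_div_iff₀' hB0).1 ((min_le_right _ _).trans (min_le_left _ _))
  have hyBc : (B * c₀) ^ 2 * y ≤ c₀ / 8 := by
    have hle : 8 * y * B ^ 2 * c₀ ≤ 1 :=
      (le_div_iff₀' (by positivity)).1 ((min_le_right _ _).trans (min_le_right _ _))
    calc (B * c₀) ^ 2 * y = 8 * y * B ^ 2 * c₀ * (c₀ / 8) := by ring
      _ ≤ c₀ / 8 := mul_le_of_le_one_left (by positivity) hle
  refine ⟨c₀, hc₀, min_le_left _ _, fun N hN => ?_⟩
  obtain ⟨H, hH, hHy⟩ := hlin N hN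
  exact ⟨H, hH, fun z hz => hH.norm_polyMap_sub_le hM hs (zero_le_one.trans hK1) hgrow ht hHy
    hc₀.le hBc hyBc hz⟩

/-- A holomorphic change of coordinates that fixes the origin and is close to the identity on the
ball of radius `ρ`; the constant `1 / 8` makes its derivative `1 / 2`-close to the identity on the
ball of radius `ρ / 2`. -/
structure IsNearIdentity {E : Type*} [NormedAddCommGroup E] [NormedSpace ℂ E] (h : E → E)
    (ρ : ℝ) : Prop where
  analyticAt : ∀ z, AnalyticAt ℂ h z
  map_zero : h 0 = 0
  norm_sub_le : ∀ z, ‖z‖ ≤ ρ → ‖h z - z‖ ≤ ρ / 8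

theorem exists_normalForm (hω : NonResonant ω) (hs : 0 ≤ s)
    (hM : IsGevreyWeight (invDivisor ω) s M) {F f : (Fin n → ℂ) → (Fin n → ℂ)}
    (hF : AnalyticAt ℂ F 0) (hFf : ∀ᶠ z in 𝓝 0, F z = linearField ω z + f z) (hf0 : f 0 = 0)
    (hDf0 : HasFDerivAt f (0 : (Fin n → ℂ) →L[ℂ] (Fin n → ℂ)) 0) {b : ℝ} (hb : 0 < b) :
    ∃ c₀ : ℝ, 0 < c₀ ∧ c₀ ≤ b ∧ ∀ N : ℕ, 1 ≤ N → ∃ h : (Fin n → ℂ) → (Fin n → ℂ),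
      IsNearIdentity h (c₀ / (N : ℝ) ^ s) ∧
        conjugacyDefect (linearField ω) F h =o[𝓝 0] fun z => ‖z‖ ^ N := by
  obtain ⟨p, hp⟩ : AnalyticAt ℂ f 0 := by
    refine (hF.sub ((linearField ω).analyticAt 0)).congr (hFf.mono fun z hz => ?_)
    rw [Pi.sub_apply, hz, add_sub_cancel_left]
  have h0 : p 0 = 0 := ContinuousMultilinearMap.ext fun v => by
    rw [hp.coeff_zero, hf0, zero_apply]
  have h1 : p 1 = 0 :=
    (continuousMultilinearCurryFin1 ℂ _ _).map_eq_zero_iff.1 (hp.hasFDerivAt.unique hDf0)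
  obtain ⟨a, ha, hc⟩ := exists_sum_norm_seriesCoeff_le hp.radius_pos h0
  obtain ⟨c₀, hc₀, hc₀b, hlin⟩ := exists_isTruncatedLinearization_norm_sub_le hω hs hM ha hc hb
  refine ⟨c₀, hc₀, hc₀b, fun N hN => ?_⟩
  obtain ⟨H, hH, hnear⟩ := hlin N hN
  exact ⟨polyMap H, ⟨analyticAt_polyMap H, polyMap_zero hH.mem, hnear⟩,
    isLittleO_conjugacyDefect hFf hp h0 h1 hH⟩

end NormalFormBounds

/-! ### Perturbations of the linear flow -/

section LinearFlow

open Topology Metric Set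
open scoped NNReal

/-- Unlike the version of the Picard–Lindelöf theorem stated for `HasDerivWithinAt` in Mathlib, this
one keeps track of the ball in which the solution stays. -/
theorem exists_hasDerivWithinAt_mem_closedBall {E : Type*} [NormedAddCommGroup E]
    [NormedSpace ℝ E] [CompleteSpace E] {f : ℝ → E → E} {tmin tmax : ℝ} {t₀ : Icc tmin tmax}
    {x₀ : E} {a L K : ℝ≥0} (hf : IsPicardLindelof f t₀ x₀ a 0 L K) :
    ∃ α : ℝ → E, α t₀ = x₀ ∧ (∀ t, α t ∈ closedBall x₀ a) ∧
      ∀ t ∈ Icc tmin tmax, HasDerivWithinAt α (f t (α t)) (Icc tmin tmax) t := by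
  obtain ⟨α, hα⟩ := ODE.FunSpace.exists_isFixedPt_next hf (mem_closedBall_self le_rfl)
  have hmem : ∀ t, α.compProj t ∈ closedBall x₀ a := fun _ =>
    α.compProj_mem_closedBall hf.mul_max_le
  have hpicard : ∀ t ∈ Icc tmin tmax, α.compProj t = ODE.picard f t₀ x₀ α.compProj t :=
    fun t ht => by
      conv_lhs => rw [← hα]
      rw [ODE.FunSpace.compProj_of_mem ht, ODE.FunSpace.next_apply]
  refine ⟨α.compProj, ?_, hmem, fun t ht => ?_⟩
  · rw [ODE.FunSpace.compProj_val, ← hα, ODE.FunSpace.next_apply₀]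
  · exact (ODE.hasDerivWithinAt_picard_Icc t₀.2 hf.continuousOn_uncurry
      α.continuous_compProj.continuousOn (fun _ _ => hmem _) x₀ ht).congr_of_mem hpicard ht

variable {n : ℕ}

/-- The flow of `linearField ω`. -/
noncomputable def linearFlow (ω : Fin n → ℝ) (t : ℝ) : (Fin n → ℂ) →L[ℂ] (Fin n → ℂ) :=
  ContinuousLinearMap.pi fun j =>
    Complex.exp ((ω j * t : ℝ) * Complex.I) • ContinuousLinearMap.proj j

theorem linearFlow_apply (ω : Fin n → ℝ) (t : ℝ) (v : Fin n → ℂ) (j : Fin n) :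
    linearFlow ω t v j = Complex.exp ((ω j * t : ℝ) * Complex.I) * v j := rfl

@[simp]
theorem norm_linearFlow (ω : Fin n → ℝ) (t : ℝ) (v : Fin n → ℂ) : ‖linearFlow ω t v‖ = ‖v‖ := by
  have hcoord : ∀ j, ‖linearFlow ω t v j‖₊ = ‖v j‖₊ := fun j => NNReal.eq <| by
    simp only [coe_nnnorm, linearFlow_apply, norm_mul, Complex.norm_exp_ofReal_mul_I, one_mul]
  simp only [Pi.norm_def, hcoord]

@[simp]
theorem linearFlow_linearFlow_neg (ω : Fin n → ℝ) (t : ℝ) (v : Fin n → ℂ) :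
    linearFlow ω t (linearFlow ω (-t) v) = v := by
  funext j
  rw [linearFlow_apply, linearFlow_apply, ← mul_assoc, ← Complex.exp_add]
  simp

@[simp]
theorem linearFlow_zero (ω : Fin n → ℝ) (v : Fin n → ℂ) : linearFlow ω 0 v = v := by
  funext j
  simp [linearFlow_apply]

theorem continuous_linearFlow_apply (ω : Fin n → ℝ) (v : Fin n → ℂ) :
    Continuous fun t => linearFlow ω t v := by
  refine continuous_pi fun j => ?_
  simp only [linearFlow_apply]
  fun_prop

theorem hasDerivWithinAt_linearFlow_apply (ω : Fin n → ℝ) {v : ℝ → Fin n → ℂ} {v' : Fin n → ℂ}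
    {J : Set ℝ} {t : ℝ} (hv : HasDerivWithinAt v v' J t) :
    HasDerivWithinAt (fun t => linearFlow ω t (v t))
      (linearField ω (linearFlow ω t (v t)) + linearFlow ω t v') J t := by
  refine hasDerivWithinAt_pi.2 fun j => ?_
  have hphase : HasDerivAt (fun t : ℝ => ((ω j * t : ℝ) : ℂ) * Complex.I) (ω j * Complex.I) t := by
    simpa using ((hasDerivAt_id t).const_mul (ω j)).ofReal_comp.mul_const Complex.I
  refine (hphase.cexp.hasDerivWithinAt.mul (hasDerivWithinAt_pi.1 hv j)).congr_deriv ?_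
  simp only [Pi.add_apply, linearField_apply, linearFlow_apply]
  ring

theorem linearFlow_mem_closedBall (ω : Fin n → ℝ) {σ δ : ℝ} {v₀ v : Fin n → ℂ} (hv₀ : ‖v₀‖ ≤ σ)
    (hv : v ∈ closedBall v₀ δ) (t : ℝ) : linearFlow ω t v ∈ closedBall 0 (σ + δ) := by
  rw [mem_closedBall_zero_iff, norm_linearFlow]
  exact (norm_le_norm_add_norm_sub' v v₀).trans (add_le_add hv₀ (mem_closedBall_iff_norm.1 hv))

theorem isPicardLindelof_linearFlow (ω : Fin n → ℝ) {R : (Fin n → ℂ) → (Fin n → ℂ)} {σ T : ℝ}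
    {δ L K : ℝ≥0} (hRK : LipschitzOnWith K R (closedBall 0 (σ + δ)))
    (hRL : ∀ z, ‖z‖ ≤ σ + δ → ‖R z‖ ≤ L) (hT : 0 ∈ Icc (-T) T) (hLT : L * T ≤ δ)
    {v₀ : Fin n → ℂ} (hv₀ : ‖v₀‖ ≤ σ) :
    IsPicardLindelof (fun t v => linearFlow ω (-t) (R (linearFlow ω t v)))
      (⟨0, hT⟩ : Icc (-T) T) v₀ δ 0 L K := by
  have hmem : ∀ {v}, v ∈ closedBall v₀ (δ : ℝ) → ∀ t, linearFlow ω t v ∈ closedBall 0 (σ + δ) :=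
    linearFlow_mem_closedBall ω hv₀
  refine ⟨fun t _ => ?_, fun v hv => ?_, fun t _ v hv => ?_, ?_⟩
  · refine LipschitzOnWith.of_dist_le_mul fun x hx y hy => ?_
    rw [dist_eq_norm, ← map_sub, norm_linearFlow, ← dist_eq_norm]
    refine (hRK.dist_le_mul _ (hmem hx t) _ (hmem hy t)).trans_eq ?_
    rw [dist_eq_norm, ← map_sub, norm_linearFlow, ← dist_eq_norm]
  · refine Continuous.continuousOn (continuous_pi fun j => ?_)
    simp only [linearFlow_apply]
    refine Continuous.mul (by fun_prop) ((continuous_apply j).comp ?_)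
    exact hRK.continuousOn.comp_continuous (continuous_linearFlow_apply ω v) (hmem hv)
  · rw [norm_linearFlow]
    exact hRL _ (mem_closedBall_zero_iff.1 (hmem hv t))
  · simpa using hLT

theorem exists_solution_linearField_add (ω : Fin n → ℝ) {R : (Fin n → ℂ) → (Fin n → ℂ)}
    {δ σ L T : ℝ} (hδ : 0 ≤ δ) (hL : 0 ≤ L) (hR : ContDiffOn ℝ 1 R (closedBall 0 (σ + δ)))
    (hRL : ∀ z, ‖z‖ ≤ σ + δ → ‖R z‖ ≤ L) (hT : 0 ≤ T) (hLT : L * T ≤ δ) {v₀ : Fin n → ℂ}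
    (hv₀ : ‖v₀‖ ≤ σ) :
    ∃ u : ℝ → Fin n → ℂ, u 0 = v₀ ∧ ∀ t ∈ Icc (-T) T, ‖u t‖ ≤ σ + δ ∧
      HasDerivWithinAt u (linearField ω (u t) + R (u t)) (Icc (-T) T) t := by
  obtain ⟨K, hK⟩ := hR.exists_lipschitzOnWith one_ne_zero (convex_closedBall _ _)
    (isCompact_closedBall _ _)
  lift δ to ℝ≥0 using hδ
  lift L to ℝ≥0 using hL
  -- Pass to rotating coordinates: `v t = linearFlow ω (-t) (u t)`.
  obtain ⟨v, hv0, hvmem, hv⟩ := exists_hasDerivWithinAt_mem_closedBall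
    (isPicardLindelof_linearFlow ω hK hRL ⟨neg_nonpos.2 hT, hT⟩ hLT hv₀)
  refine ⟨fun t => linearFlow ω t (v t), (linearFlow_zero ω _).trans hv0, fun t ht => ⟨?_, ?_⟩⟩
  · exact mem_closedBall_zero_iff.1 (linearFlow_mem_closedBall ω hv₀ (hvmem t) t)
  · simpa only [linearFlow_linearFlow_neg] using hasDerivWithinAt_linearFlow_apply ω (hv t ht)

end LinearFlow

section Uniqueness

open Topology Metric Set

variable {n : ℕ} {F : (Fin n → ℂ) → (Fin n → ℂ)} {z₀ : Fin n → ℂ} {T : ℝ} {y z : ℝ → Fin n → ℂ}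

theorem unitPolydisk_eq_ball : unitPolydisk n = ball 0 1 := by
  ext z
  rw [mem_ball_zero_iff, pi_norm_lt_iff one_pos]
  rfl

theorem IsSolutionOn.continuousOn {J : Set ℝ} (hz : IsSolutionOn F z₀ J z) : ContinuousOn z J :=
  fun t ht => (hz.2 t ht).2.continuousWithinAt

theorem IsSolutionOn.exists_norm_le_lt_one (hT : 0 ≤ T)
    (hz : IsSolutionOn F z₀ (Icc (-T) T) z) : ∃ ρ < 1, ∀ t ∈ Icc (-T) T, ‖z t‖ ≤ ρ := by
  obtain ⟨t, ht, hmax⟩ := isCompact_Icc.exists_isMaxOn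
    (nonempty_Icc.2 ((neg_nonpos.2 hT).trans hT)) hz.continuousOn.norm
  refine ⟨‖z t‖, ?_, fun u hu => hmax hu⟩
  simpa only [unitPolydisk_eq_ball, mem_ball_zero_iff] using (hz.2 t ht).1

theorem IsSolutionOn.hasDerivAt (hz : IsSolutionOn F z₀ (Icc (-T) T) z) :
    ∀ t ∈ Ioo (-T) T, HasDerivAt z (F (z t)) t := fun t ht =>
  (hz.2 t (Ioo_subset_Icc_self ht)).2.hasDerivAt (Icc_mem_nhds ht.1 ht.2)

theorem IsSolutionOn.eqOn (hF : AnalyticOnNhd ℂ F (unitPolydisk n)) (hT : 0 < T)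
    (hy : IsSolutionOn F z₀ (Icc (-T) T) y) (hz : IsSolutionOn F z₀ (Icc (-T) T) z) :
    EqOn y z (Icc (-T) T) := by
  obtain ⟨ρ₁, hρ₁, hyρ⟩ := hy.exists_norm_le_lt_one hT.le
  obtain ⟨ρ₂, hρ₂, hzρ⟩ := hz.exists_norm_le_lt_one hT.le
  rw [unitPolydisk_eq_ball] at hF
  obtain ⟨K, hK⟩ := ((hF.mono (closedBall_subset_ball (max_lt hρ₁ hρ₂))).restrictScalars
    (𝕜 := ℝ)).contDiffOn_of_completeSpace.exists_lipschitzOnWith one_ne_zero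
      (convex_closedBall _ _) (isCompact_closedBall _ _)
  exact ODE_solution_unique_of_mem_Icc (v := fun _ => F)
    (s := fun _ => closedBall 0 (max ρ₁ ρ₂)) (t₀ := 0) (fun _ _ => hK) ⟨neg_lt_zero.2 hT, hT⟩
    hy.continuousOn hy.hasDerivAt
    (fun t ht => mem_closedBall_zero_iff.2 (le_max_of_le_left (hyρ t (Ioo_subset_Icc_self ht))))
    hz.continuousOn hz.hasDerivAt
    (fun t ht => mem_closedBall_zero_iff.2 (le_max_of_le_right (hzρ t (Ioo_subset_Icc_self ht))))
    (hy.1.trans hz.1.symm)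

end Uniqueness

/-! ### Solutions in normal form coordinates -/

section Perturbation

open ContinuousLinearMap

variable {𝕜 E : Type*} [NontriviallyNormedField 𝕜] [NormedAddCommGroup E] [NormedSpace 𝕜 E]
  {D : E →L[𝕜] E}

theorem isUnit_of_norm_sub_id_lt_one [CompleteSpace E] (hD : ‖D - .id 𝕜 E‖ < 1) : IsUnit D := by
  rw [norm_sub_rev] at hD
  have hunit := isUnit_one_sub_of_norm_lt_one hD
  rwa [show (1 : E →L[𝕜] E) - (.id 𝕜 E - D) = D from sub_sub_cancel _ _] at hunit

theorem apply_ringInverse_of_isUnit (hD : IsUnit D) (w : E) : D (Ring.inverse D w) = w :=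
  congrArg (fun L : E →L[𝕜] E => L w) (Ring.mul_inverse_cancel D hD)

theorem norm_ringInverse_apply_le [CompleteSpace E] (hD : ‖D - .id 𝕜 E‖ ≤ 1 / 2) (w : E) :
    ‖Ring.inverse D w‖ ≤ 2 * ‖w‖ := by
  have hunit : IsUnit D := isUnit_of_norm_sub_id_lt_one (hD.trans_lt one_half_lt_one)
  have happly := apply_ringInverse_of_isUnit hunit w
  have hdiff : ‖w - Ring.inverse D w‖ ≤ 1 / 2 * ‖Ring.inverse D w‖ := by
    simpa only [sub_apply, happly, id_apply] using le_of_opNorm_le _ hD (Ring.inverse D w)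
  linarith [norm_le_norm_add_norm_sub' (Ring.inverse D w) w, norm_sub_rev (Ring.inverse D w) w]

theorem norm_apply_le_two_mul (hD : ‖D - .id 𝕜 E‖ ≤ 1 / 2) (w : E) : ‖D w‖ ≤ 2 * ‖w‖ := by
  have hdiff : ‖D w - w‖ ≤ 1 / 2 * ‖w‖ := le_of_opNorm_le _ hD w
  linarith [norm_le_norm_add_norm_sub' (D w) w, norm_nonneg w]

end Perturbation

section NearIdentity

open Topology Metric Set
open scoped NNReal

variable {E : Type*} [NormedAddCommGroup E] [NormedSpace ℂ E] {h F : E → E} {A : E →L[ℂ] E}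
  {ρ C : ℝ} {N : ℕ} {z : E}

theorem IsNearIdentity.differentiable (hh : IsNearIdentity h ρ) : Differentiable ℂ h := fun z =>
  (hh.analyticAt z).differentiableAt

theorem IsNearIdentity.norm_fderiv_sub_id_le (hh : IsNearIdentity h ρ) (hρ : 0 < ρ)
    (hz : ‖z‖ ≤ ρ / 2) : ‖fderiv ℂ h z - .id ℂ E‖ ≤ 1 / 2 := by
  have hfderiv : fderiv ℂ h z - .id ℂ E = fderiv ℂ (fun w => h w - w) z := by
    rw [fderiv_fun_sub (hh.differentiable z) differentiableAt_fun_id, fderiv_fun_id]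
  have hmaps : MapsTo (fun w => h w - w) (ball z (ρ / 2)) (closedBall (h z - z) (ρ / 4)) :=
    fun w hw => by
      rw [mem_ball_iff_norm] at hw
      rw [mem_closedBall_iff_norm]
      have hw' : ‖w‖ ≤ ρ := by linarith [norm_le_norm_add_norm_sub' w z]
      linarith [_root_.norm_sub_le (h w - w) (h z - z), hh.norm_sub_le w hw',
        hh.norm_sub_le z (by linarith)]
  rw [hfderiv]
  refine (Complex.norm_fderiv_le_div_of_mapsTo_ball
    (hh.differentiable.sub differentiable_id).differentiableOn hmaps (by positivity)).trans_eq ?_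
  field_simp
  norm_num

theorem IsNearIdentity.lipschitzOnWith_sub_id (hh : IsNearIdentity h ρ) (hρ : 0 < ρ) :
    LipschitzOnWith (1 / 2) (fun z => h z - z) (closedBall 0 (ρ / 2)) := by
  refine (convex_closedBall _ _).lipschitzOnWith_of_nnnorm_fderiv_le (𝕜 := ℂ)
    (fun z _ => (hh.differentiable z).sub differentiableAt_fun_id) fun z hz => ?_
  rw [fderiv_fun_sub (hh.differentiable z) differentiableAt_fun_id, fderiv_fun_id]
  exact NNReal.coe_le_coe.1 (hh.norm_fderiv_sub_id_le hρ (mem_closedBall_zero_iff.1 hz))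

theorem IsNearIdentity.norm_le_two_mul (hh : IsNearIdentity h ρ) (hρ : 0 < ρ)
    (hz : ‖z‖ ≤ ρ / 2) : ‖h z‖ ≤ 2 * ‖z‖ := by
  have hlip : ‖h z - z‖ ≤ 1 / 2 * ‖z‖ := by
    simpa [hh.map_zero] using (hh.lipschitzOnWith_sub_id hρ).norm_sub_le
      (mem_closedBall_zero_iff.2 hz) (mem_closedBall_self (by positivity))
  linarith [norm_le_norm_add_norm_sub' (h z) z, norm_nonneg z]

theorem IsNearIdentity.exists_preimage [CompleteSpace E] (hh : IsNearIdentity h ρ) (hρ : 0 < ρ)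
    (hz : 2 * ‖z‖ ≤ ρ / 2) : ∃ v, ‖v‖ ≤ 2 * ‖z‖ ∧ h v = z := by
  have happrox : ApproximatesLinearOn h (.id ℂ E) (closedBall 0 (ρ / 2)) (1 / 2) :=
    fun x hx y hy => by
      simpa only [ContinuousLinearMap.id_apply, sub_sub_sub_comm] using
        (hh.lipschitzOnWith_sub_id hρ).norm_sub_le hx hy
  have hsurj := happrox.surjOn_closedBall_of_nonlinearRightInverse
    ⟨id, 1, fun _ => by simp, fun _ => rfl⟩ (ε := 2 * ‖z‖) (b := 0) (by positivity)
    (closedBall_subset_closedBall hz)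
  obtain ⟨v, hv, hvz⟩ := hsurj (a := z) (by
    rw [hh.map_zero, mem_closedBall_zero_iff]
    norm_num
    linarith)
  exact ⟨v, mem_closedBall_zero_iff.1 hv, hvz⟩

theorem IsNearIdentity.norm_le_half (hh : IsNearIdentity h ρ) (hρ : 0 < ρ) (hρ1 : ρ ≤ 1 / 2)
    (hz : ‖z‖ ≤ ρ / 2) : ‖h z‖ ≤ 1 / 2 := by
  linarith [hh.norm_le_two_mul hρ hz]

theorem IsNearIdentity.contDiffAt_conjugacyDefect (hh : IsNearIdentity h ρ) (hρ : 0 < ρ)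
    (hρ1 : ρ ≤ 1 / 2) [CompleteSpace E] (hF : AnalyticOnNhd ℂ F (ball 0 1)) (hz : ‖z‖ ≤ ρ / 2) :
    ContDiffAt ℂ 1 (conjugacyDefect A F h) z := by
  have hmem : h z ∈ ball 0 1 :=
    mem_ball_zero_iff.2 ((hh.norm_le_half hρ hρ1 hz).trans_lt one_half_lt_one)
  exact ((hF _ hmem).comp (hh.analyticAt z)).contDiffAt.sub
    ((hh.analyticAt z).fderiv.contDiffAt.clm_apply A.contDiff.contDiffAt)

theorem IsNearIdentity.norm_conjugacyDefect_le (hh : IsNearIdentity h ρ)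
    (hρ : 0 < ρ) (hρ1 : ρ ≤ 1 / 2) (hC : ∀ z, ‖z‖ ≤ 1 / 2 → ‖F z‖ ≤ C) (hz : ‖z‖ ≤ ρ / 2) :
    ‖conjugacyDefect A F h z‖ ≤ C + ‖A‖ := by
  refine (_root_.norm_sub_le _ _).trans (add_le_add (hC _ (hh.norm_le_half hρ hρ1 hz)) ?_)
  calc ‖fderiv ℂ h z (A z)‖ ≤ 2 * ‖A z‖ :=
        norm_apply_le_two_mul (hh.norm_fderiv_sub_id_le hρ hz) _
    _ ≤ 2 * (‖A‖ * (1 / 2)) := by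
        gcongr
        exact A.le_opNorm_of_le (by linarith)
    _ = ‖A‖ := by ring

theorem IsNearIdentity.norm_conjugacyDefect_le_exp [CompleteSpace E] (hh : IsNearIdentity h ρ)
    (hρ : 0 < ρ) (hρ1 : ρ ≤ 1 / 2) (hF : AnalyticOnNhd ℂ F (ball 0 1)) (hF0 : F 0 = 0)
    (hC : ∀ z, ‖z‖ ≤ 1 / 2 → ‖F z‖ ≤ C)
    (hdefect : conjugacyDefect A F h =o[𝓝 0] fun z => ‖z‖ ^ N) (hz : Real.exp 1 * ‖z‖ ≤ ρ / 2) :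
    ‖conjugacyDefect A F h z‖ ≤ (C + ‖A‖) * Real.exp (-(N + 1)) := by
  have hzero : conjugacyDefect A F h 0 = 0 := by
    rw [conjugacyDefect, hh.map_zero, hF0, _root_.map_zero, _root_.map_zero, sub_zero]
  have hzexp : ‖z‖ / (ρ / 2) ≤ Real.exp (-1) := by
    rwa [div_le_iff₀ (by positivity), Real.exp_neg, inv_mul_eq_div,
      le_div_iff₀' (Real.exp_pos _)]
  have hzball : ‖z‖ < ρ / 2 := (div_lt_one (by positivity)).1
    (hzexp.trans_lt (Real.exp_lt_one_iff.2 (by norm_num)))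
  have hdiff : DifferentiableOn ℂ (conjugacyDefect A F h) (ball 0 (ρ / 2)) := fun w hw =>
    ((hh.contDiffAt_conjugacyDefect hρ hρ1 hF (mem_ball_zero_iff.1 hw).le).differentiableAt
      one_ne_zero).differentiableWithinAt
  have hmaps : MapsTo (conjugacyDefect A F h) (ball 0 (ρ / 2))
      (closedBall (conjugacyDefect A F h 0) (C + ‖A‖)) := fun w hw => by
    rw [hzero, mem_closedBall_zero_iff]
    exact hh.norm_conjugacyDefect_le hρ hρ1 hC (mem_ball_zero_iff.1 hw).le
  have hC0 : 0 ≤ C := (norm_nonneg _).trans (hC 0 (by simp))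
  calc ‖conjugacyDefect A F h z‖ ≤ (C + ‖A‖) * (‖z‖ / (ρ / 2)) ^ (N + 1) := by
        simpa only [hzero, dist_zero_right] using
          Complex.dist_le_mul_div_pow_of_mapsTo_ball_of_isLittleO hdiff hmaps
            (by simpa only [hzero, sub_zero] using hdefect) (mem_ball_zero_iff.2 hzball)
    _ ≤ (C + ‖A‖) * Real.exp (-1) ^ (N + 1) := by gcongr
    _ = (C + ‖A‖) * Real.exp (-(N + 1)) := by
        rw [← Real.exp_nat_mul, Nat.cast_add_one, mul_neg_one]

end NearIdentity

section NormalFormSolution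

open Topology Metric Set

variable {E : Type*} [NormedAddCommGroup E] [NormedSpace ℂ E] {h F : E → E} {A : E →L[ℂ] E}
  {ρ C : ℝ} {N : ℕ} {z : E}

/-- The perturbation `Dh(z)⁻¹ (F (h z) - Dh(z) A z)` of the linear field `A` in the coordinates
`h`: wherever `Dh(z)` is invertible, `h` carries the field `A + pullbackPerturbation A F h` to
`F`. Elsewhere the value is `0`. -/
noncomputable def pullbackPerturbation (A : E →L[ℂ] E) (F h : E → E) (z : E) : E :=
  Ring.inverse (fderiv ℂ h z) (conjugacyDefect A F h z)

variable [CompleteSpace E]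

theorem IsNearIdentity.isUnit_fderiv (hh : IsNearIdentity h ρ) (hρ : 0 < ρ) (hz : ‖z‖ ≤ ρ / 2) :
    IsUnit (fderiv ℂ h z) :=
  isUnit_of_norm_sub_id_lt_one ((hh.norm_fderiv_sub_id_le hρ hz).trans_lt one_half_lt_one)

theorem IsNearIdentity.fderiv_add_pullbackPerturbation (hh : IsNearIdentity h ρ) (hρ : 0 < ρ)
    (hz : ‖z‖ ≤ ρ / 2) : fderiv ℂ h z (A z + pullbackPerturbation A F h z) = F (h z) := by
  rw [_root_.map_add, pullbackPerturbation,
    apply_ringInverse_of_isUnit (hh.isUnit_fderiv hρ hz), conjugacyDefect, add_sub_cancel]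

theorem IsNearIdentity.contDiffAt_pullbackPerturbation (hh : IsNearIdentity h ρ) (hρ : 0 < ρ)
    (hρ1 : ρ ≤ 1 / 2) (hF : AnalyticOnNhd ℂ F (ball 0 1)) (hz : ‖z‖ ≤ ρ / 2) :
    ContDiffAt ℂ 1 (pullbackPerturbation A F h) z := by
  obtain ⟨U, hU⟩ := hh.isUnit_fderiv hρ hz
  have hinv : ContDiffAt ℂ 1 Ring.inverse (fderiv ℂ h z) := hU ▸ contDiffAt_ringInverse ℂ U
  exact (hinv.comp z (hh.analyticAt z).fderiv.contDiffAt).clm_apply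
    (hh.contDiffAt_conjugacyDefect hρ hρ1 hF hz)

theorem exists_solution_of_normalForm {n : ℕ} {ω : Fin n → ℝ}
    {F h : (Fin n → ℂ) → (Fin n → ℂ)} (hF : AnalyticOnNhd ℂ F (ball 0 1)) (hF0 : F 0 = 0)
    (hC : ∀ z, ‖z‖ ≤ 1 / 2 → ‖F z‖ ≤ C) (hρ : 0 < ρ) (hρ1 : ρ ≤ 1 / 2) (hh : IsNearIdentity h ρ)
    (hdefect : conjugacyDefect (linearField ω) F h =o[𝓝 0] fun z => ‖z‖ ^ N)
    {z₀ : Fin n → ℂ} (hz₀ : 6 * Real.exp 1 * ‖z₀‖ ≤ ρ) {T : ℝ} (hT : 0 ≤ T)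
    (hT' : 2 * (C + ‖linearField ω‖) * Real.exp (-(N + 1)) * T ≤ ‖z₀‖) :
    ∃ z, IsSolutionOn F z₀ (Icc (-T) T) z ∧ ∀ t ∈ Icc (-T) T, ‖z t‖ ≤ 6 * ‖z₀‖ := by
  have hz₀ρ : 3 * ‖z₀‖ ≤ ρ / 4 := by nlinarith [norm_nonneg z₀, Real.add_one_le_exp 1]
  have hC0 : 0 ≤ C := (norm_nonneg _).trans (hC 0 (by simp))
  obtain ⟨v₀, hv₀, hv₀z⟩ := hh.exists_preimage hρ (z := z₀) (by linarith)
  have hnorm : ∀ z, ‖z‖ ≤ 2 * ‖z₀‖ + ‖z₀‖ →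
      ‖pullbackPerturbation (linearField ω) F h z‖ ≤
        2 * (C + ‖linearField ω‖) * Real.exp (-(N + 1)) := fun z hz => by
    rw [mul_assoc]
    refine (norm_ringInverse_apply_le (hh.norm_fderiv_sub_id_le hρ (by linarith)) _).trans ?_
    gcongr
    exact hh.norm_conjugacyDefect_le_exp hρ hρ1 hF hF0 hC hdefect
      (by nlinarith [Real.exp_pos 1])
  obtain ⟨u, hu0, hu⟩ := exists_solution_linearField_add ω (norm_nonneg z₀) (by positivity)
    (fun z hz => ((hh.contDiffAt_pullbackPerturbation hρ hρ1 hF (by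
      linarith [mem_closedBall_zero_iff.1 hz])).restrict_scalars ℝ).contDiffWithinAt)
    hnorm hT hT' hv₀
  have huρ : ∀ t ∈ Icc (-T) T, ‖u t‖ ≤ ρ / 2 := fun t ht => by linarith [(hu t ht).1]
  refine ⟨fun t => h (u t), ⟨(congrArg h hu0).trans hv₀z, fun t ht => ⟨?_, ?_⟩⟩, fun t ht => ?_⟩
  · rw [unitPolydisk_eq_ball, mem_ball_zero_iff]
    exact (hh.norm_le_half hρ hρ1 (huρ t ht)).trans_lt one_half_lt_one
  · rw [← hh.fderiv_add_pullbackPerturbation (A := linearField ω) (F := F) hρ (huρ t ht)]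
    exact ((hh.differentiable (u t)).hasFDerivAt.restrictScalars ℝ).comp_hasDerivWithinAt t
      (hu t ht).2
  · linarith [hh.norm_le_two_mul hρ (huρ t ht), (hu t ht).1]

end NormalFormSolution

section EffectiveStability

open Topology Metric Set

theorem rpow_le_mul_exp_half {s x : ℝ} (hs : 0 < s) (hx : 0 ≤ x) :
    x ^ s ≤ (2 * s) ^ s * Real.exp (x / 2) := by
  calc x ^ s = (2 * s * (x / (2 * s))) ^ s := by rw [mul_div_cancel₀ _ (by positivity)]
    _ = (2 * s) ^ s * (x / (2 * s)) ^ s := Real.mul_rpow (by positivity) (by positivity)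
    _ ≤ (2 * s) ^ s * Real.exp (x / (2 * s)) ^ s := by
        gcongr
        linarith [Real.add_one_le_exp (x / (2 * s))]
    _ = (2 * s) ^ s * Real.exp (x / 2) := by
        rw [← Real.exp_mul, ← div_div, div_mul_cancel₀ _ hs.ne']

theorem exp_neg_floor_mul_exp_half_mul_rpow_le {s x : ℝ} (hs : 0 < s) (hx : 0 ≤ x) :
    Real.exp (-(⌊x⌋₊ + 1)) * Real.exp (x / 2) * x ^ s ≤ (2 * s) ^ s := by
  calc Real.exp (-(⌊x⌋₊ + 1)) * Real.exp (x / 2) * x ^ s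
      ≤ Real.exp (-x) * Real.exp (x / 2) * ((2 * s) ^ s * Real.exp (x / 2)) := by
        gcongr
        · exact (Nat.lt_floor_add_one x).le
        · exact rpow_le_mul_exp_half hs hx
    _ = (2 * s) ^ s * Real.exp (-x + x / 2 + x / 2) := by
        rw [Real.exp_add, Real.exp_add]
        ring
    _ = (2 * s) ^ s := by rw [add_assoc, add_halves, neg_add_cancel, Real.exp_zero, mul_one]

theorem exists_pos_norm_le_of_continuousOn_ball {E G : Type*} [SeminormedAddCommGroup E]
    [ProperSpace E] [SeminormedAddCommGroup G] {F : E → G} {r R : ℝ}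
    (hF : ContinuousOn F (ball 0 R)) (hr : r < R) :
    ∃ C, 0 < C ∧ ∀ z, ‖z‖ ≤ r → ‖F z‖ ≤ C := by
  obtain ⟨C, hC0, hC⟩ := (((isCompact_closedBall 0 r).image_of_continuousOn
    (hF.mono (closedBall_subset_ball hr))).isBounded).exists_pos_norm_le
  exact ⟨C, hC0, fun z hz => hC _ (mem_image_of_mem F (mem_closedBall_zero_iff.2 hz))⟩

theorem exists_solution_exponential_time {n : ℕ} {ω : Fin n → ℝ} (hω : NonResonant ω) {s : ℝ}
    (hs : 0 < s) {M : (Fin n →₀ ℕ) → ℝ} (hM : IsGevreyWeight (invDivisor ω) s M)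
    {F f : (Fin n → ℂ) → (Fin n → ℂ)} (hF : AnalyticOnNhd ℂ F (ball 0 1))
    (hFf : ∀ z ∈ ball 0 1, F z = linearField ω z + f z) (hf0 : f 0 = 0)
    (hDf0 : HasFDerivAt f (0 : (Fin n → ℂ) →L[ℂ] (Fin n → ℂ)) 0) :
    ∃ κ a : ℝ, 0 < κ ∧ 0 < a ∧ ∀ z₀ : Fin n → ℂ, 0 < ‖z₀‖ → ‖z₀‖ ≤ κ →
      ∀ T : ℝ, T = a * Real.exp ((κ / ‖z₀‖) ^ (1 / s) / 2) →
        ∃ z, IsSolutionOn F z₀ (Icc (-T) T) z ∧ ∀ t ∈ Icc (-T) T, ‖z t‖ ≤ 6 * ‖z₀‖ := by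
  have h0 : (0 : Fin n → ℂ) ∈ ball 0 1 := mem_ball_self one_pos
  have hF0 : F 0 = 0 := by rw [hFf 0 h0, map_zero, hf0, add_zero]
  obtain ⟨C, hC0, hC⟩ := exists_pos_norm_le_of_continuousOn_ball hF.continuousOn one_half_lt_one
  obtain ⟨c₀, hc₀, hc₀1, hnormal⟩ := exists_normalForm hω hs.le hM (hF 0 h0)
    (eventually_of_mem (ball_mem_nhds 0 one_pos) hFf) hf0 hDf0 one_half_pos
  set κ : ℝ := c₀ / (6 * Real.exp 1) with hκ
  set Q : ℝ := 2 * (C + ‖linearField ω‖)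
  have hQ0 : 0 < Q := by positivity
  refine ⟨κ, κ / (Q * (2 * s) ^ s), by positivity, by positivity, fun z₀ hz₀ hz₀κ T hT => ?_⟩
  -- The normal form of order `N` is valid up to the radius `c₀ / N ^ s`; `N = ⌊x⌋₊` is the largest
  -- order for which this exceeds a multiple of `‖z₀‖`, and the remainder is then about `exp (-x)`.
  set x : ℝ := (κ / ‖z₀‖) ^ (1 / s)
  have hx1 : 1 ≤ x := Real.one_le_rpow ((one_le_div hz₀).2 hz₀κ) (by positivity)
  have hx0 : 0 ≤ x := zero_le_one.trans hx1
  have hxs : x ^ s = κ / ‖z₀‖ := by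
    rw [← Real.rpow_mul (by positivity), one_div_mul_cancel hs.ne', Real.rpow_one]
  have hN1 : 1 ≤ ⌊x⌋₊ := (Nat.one_le_floor_iff x).2 hx1
  have hNs1 : 1 ≤ (⌊x⌋₊ : ℝ) ^ s := Real.one_le_rpow (mod_cast hN1) hs.le
  obtain ⟨h, hh, hdefect⟩ := hnormal ⌊x⌋₊ hN1
  refine exists_solution_of_normalForm hF hF0 hC (by positivity)
    ((div_le_self hc₀.le hNs1).trans hc₀1) hh hdefect ?_ (by rw [hT]; positivity) ?_
  · calc 6 * Real.exp 1 * ‖z₀‖ = c₀ / x ^ s := by rw [hxs, hκ]; field_simp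
      _ ≤ c₀ / (⌊x⌋₊ : ℝ) ^ s := by gcongr; exact Nat.floor_le hx0
  · calc Q * Real.exp (-(⌊x⌋₊ + 1)) * T
        = Real.exp (-(⌊x⌋₊ + 1)) * Real.exp (x / 2) * x ^ s / (2 * s) ^ s * ‖z₀‖ := by
          rw [hT, hxs]; field_simp
      _ ≤ (2 * s) ^ s / (2 * s) ^ s * ‖z₀‖ := by
          gcongr
          exact exp_neg_floor_mul_exp_half_mul_rpow_le hs hx0
      _ = ‖z₀‖ := by rw [div_self (by positivity), one_mul]

end EffectiveStability

/-- `‖·‖` on `Fin n → ℂ` is the maximum norm. -/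
theorem theorem1p3 (n : ℕ) (hn : 2 ≤ n) (ω : Fin n → ℝ) (s : ℝ) (hs : 0 < s)
    (F f : (Fin n → ℂ) → (Fin n → ℂ))
    (hF : AnalyticOnNhd ℂ F (unitPolydisk n))
    (hFf : ∀ z ∈ unitPolydisk n,
      F z = (Matrix.diagonal fun j => Complex.I * (ω j : ℂ)).mulVec z + f z)
    (hf0 : f 0 = 0)
    (hDf0 : HasFDerivAt f (0 : (Fin n → ℂ) →L[ℂ] (Fin n → ℂ)) 0)
    (hres : NonResonant ω)
    (hB : BrunoS ω s ∨ ∃ h : n = 2,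
      BrunoSContFract (-ω (Fin.cast h.symm 0) / ω (Fin.cast h.symm 1)) s) :
    ∃ r₀ : ℝ, 0 < r₀ ∧ ∀ r : ℝ, 0 < r → r < 1 → r < r₀ →
      ∃ A B C : ℝ, 0 < A ∧ 0 < B ∧ 0 < C ∧
        ∀ z₀ : Fin n → ℂ, 0 < ‖z₀‖ → ‖z₀‖ < r / 2 →
          ∀ T : ℝ, T = A⁻¹ * Real.exp (B * (r / ‖z₀‖) ^ (1 / s)) →
            ∃ z : ℝ → Fin n → ℂ,
              IsSolutionOn F z₀ (Set.Icc (-T) T) z ∧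
              (∀ t ∈ Set.Icc (-T) T, ‖z t‖ ≤ C * r) ∧
              ∀ y : ℝ → Fin n → ℂ, IsSolutionOn F z₀ (Set.Icc (-T) T) y →
                Set.EqOn y z (Set.Icc (-T) T) := by
  have : NeZero n := ⟨by omega⟩
  obtain ⟨M, hM⟩ : ∃ M, IsGevreyWeight (invDivisor ω) s M := by
    rcases hB with hB | ⟨rfl, hcf⟩
    · exact hB.exists_isGevreyWeight hs.le hres
    · exact BrunoSContFract.exists_isGevreyWeight hs.le hres hcf
  have hFlin : ∀ z ∈ unitPolydisk n, F z = linearField ω z + f z := fun z hz => by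
    rw [hFf z hz]
    congr 1
    funext j
    rw [Matrix.mulVec_diagonal, linearField_apply]
  obtain ⟨κ, a, hκ, ha, hsol⟩ := exists_solution_exponential_time hres hs hM
    (unitPolydisk_eq_ball ▸ hF) (unitPolydisk_eq_ball ▸ hFlin) hf0 hDf0
  refine ⟨κ, hκ, fun r hr _ hrκ => ⟨a⁻¹, (κ / r) ^ (1 / s) / 2, 3, by positivity, by positivity,
    three_pos, fun z₀ hz₀ hz₀r T hT => ?_⟩⟩
  have hT' : T = a * Real.exp ((κ / ‖z₀‖) ^ (1 / s) / 2) := by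
    rw [hT, inv_inv, div_mul_eq_mul_div, ← Real.mul_rpow (by positivity) (by positivity),
      div_mul_div_cancel₀ hr.ne']
  have hT0 : 0 < T := by
    rw [hT']
    positivity
  obtain ⟨z, hz, hbound⟩ := hsol z₀ hz₀ (by linarith) T hT'
  exact ⟨z, hz, fun t ht => (hbound t ht).trans (by linarith), fun y hy => hy.eqOn hF hT0 hz⟩
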